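/- Let $n\ge 0$, $d=2^n$, and let $\mathbb P_n=\{I,X,Y,Z\}^{\otimes n}$ be the set of $n$-qubit Pauli strings. For a Hermitian $d\times d$ matrix (Hamiltonian) $H$ put $\alpha_P=\mathrm{Tr}(HP)/2^n$; for $S\subseteq\mathbb P_n$ write $H\in\Pi_S$ if $\alpha_P=0$ for all $P\notin S$. Call $H$ $\varepsilon$-far from $\Pi_S$ if $\frac1{\sqrt{2^n}}\|H-K\|_2\ge\varepsilon$ for all Hamiltonians $K\in\Pi_S$, where $\|\cdot\|_2$ is the Frobenius norm. Stabilizer bases: let $G_1,\dots,G_{d+1}$ be subgroups of the Pauli group modulo phases that cover it, each with $|G_i|=d$ and equal to its own commutant, and with $G_i\cap G_{i'}=\{I\}$ for $i\ne i'$; let $\zeta_{i,g}\in\{\pm1\}$ be signs such that the matrices $\zeta_{i,g}P(g)$, $g\in G_i$, form a group, $P(g)$ being the Pauli string that represents $g$; let $r^i_1,\dots,r^i_d$ represent the cosets of $G_i$; and let $|\phi_{i,j}\rangle$ be unit vectors with $|\phi_{i,j}\rangle\langle\phi_{i,j}|=\frac1d\sum_{p\in G_i}(-1)^{p\circ r^i_j}\zeta_{i,p}P(p)$,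 where $p\circ r\in\{0,1\}$ is $0$ if and only if $P(p)$ and $P(r)$ commute. For unit vectors write $\phi\sim_S\psi$ if $P\phi=e^{\mathrm i\theta}\psi$ for some $P\in S\cup\{I\}$ and $\theta\in\mathbb R$. Tester: given $S$ and $\varepsilon\in(0,1)$, put $t=\varepsilon/6$ and $N=\lceil 2\log 3/(t^2\varepsilon^2)\rceil$. In each of at most $N$ rounds draw $i\in\{1,\dots,d+1\}$ and $j\in\{1,\dots,d\}$ uniformly and independently, prepare $|\phi_{i,j}\rangle$, evolve it under $e^{-\mathrm itH}$, measure in the basis $(|\phi_{i,\ell}\rangle)_\ell$, and, if the outcome $\ell$ violates $\phi_{i,j}\sim_S\phi_{i,\ell}$, stop and answer "far". If no round finds a violation, answer "$H\in\Pi_S$". Theorem. Such stabilizer bases exist for every $n$. There are a program of a random access machine (unit cost per instruction, with incrementing and decrementing as the only arithmetic) and a constant $C>0$ such that the following holds for all $n$, all stabilizer bases as above, all $\varepsilon\in(0,1)$, all $S\subseteq\mathbb P_n$ with $|S\cup\{I\}|\le\frac{(2^n+1)\varepsilon^4}{144}$, and all Hamiltonians $H$ with $\mathrm{Tr}(H)=0$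 and operator norm $\|H\|_\infty\le1$. 1. If $H\in\Pi_S$, then the tester answers "$H\in\Pi_S$" with probability at least $2/3$. If $H$ is $\varepsilon$-far from $\Pi_S$, then it answers "far" with probability at least $2/3$. 2. Every run uses at most $C/\varepsilon^4$ experiments and total evolution time at most $C/\varepsilon^3$. For every list of the elements of $S$ without repetition, the program, given in each round this list, the representatives $r^i_j$ and $r^i_\ell$ and $n$ generators of $G_i$, correctly decides whether $\phi_{i,j}\sim_S\phi_{i,\ell}$, and its total number of steps over all rounds is at most $C\,n^2\,|S\cup\{I\}|/\varepsilon^4$. 3. The states and measurements are efficiently implementable: each $|\phi_{i,j}\rangle$ is prepared from $|0\rangle^{\otimes n}$, up to a phase, by a circuit of at most $Cn^2$ Hadamard, phase and controlled-NOT gates, and each measurement in the basis $(|\phi_{i,\ell}\rangle)_\ell$ is carried out by such a circuit followed by a measurement in the computational basis. -/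

import Mathlib

open scoped ENNReal Matrix BigOperators

noncomputable section

namespace HamiltonianTesting

/-! ### Pauli strings -/

/-- Labels of the computational basis of `n` qubits. -/
abbrev Bits (n : ℕ) : Type := Fin n → Fin 2

/-- Complex matrices on `n` qubits, of size `2 ^ n`. -/
abbrev QMat (n : ℕ) : Type := Matrix (Bits n) (Bits n) ℂ

/-- Pauli strings of length `n`. A letter is a pair of bits `(a, b)`, with `(0, 0) = I`, `(1, 0) = X`,
`(0, 1) = Z`, `(1, 1) = Y`. Addition is multiplication of Pauli strings up to a phase, so this is at
the same time the set of Pauli strings and the Pauli group modulo phases. -/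
abbrev PauliString (n : ℕ) : Type := Fin n → ZMod 2 × ZMod 2

/-- The one-qubit matrices `I`, `X`, `Z`, `Y`. -/
def sigma (a : ZMod 2 × ZMod 2) : Matrix (Fin 2) (Fin 2) ℂ :=
  if a.1 = 0 then
    if a.2 = 0 then !![1, 0; 0, 1] else !![1, 0; 0, -1]
  else
    if a.2 = 0 then !![0, 1; 1, 0] else !![0, -Complex.I; Complex.I, 0]

/-- The tensor product of `n` one-qubit matrices. -/
def tensor {n : ℕ} (A : Fin n → Matrix (Fin 2) (Fin 2) ℂ) : QMat n :=
  Matrix.of fun x y => ∏ k, A k (x k) (y k)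

/-- The matrix `P(g)` of a Pauli string `g`. -/
def pauli {n : ℕ} (g : PauliString n) : QMat n := tensor fun k => sigma (g k)

open Classical in
/-- The sign `(-1)^{p ∘ q}`: it is `1` if the Pauli strings commute and `-1` otherwise. -/
def commSign {n : ℕ} (p q : PauliString n) : ℂ :=
  if pauli p * pauli q = pauli q * pauli p then 1 else -1

/-! ### Hamiltonians, properties, norms -/

/-- Hamiltonians on `n` qubits: Hermitian matrices. -/
abbrev Hamiltonian (n : ℕ) : Type := selfAdjoint (QMat n)

/-- The Pauli coefficient `α_P = Tr(H P) / 2 ^ n`. -/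
def pauliCoeff {n : ℕ} (H : Hamiltonian n) (p : PauliString n) : ℂ :=
  ((H : QMat n) * pauli p).trace / 2 ^ n

/-- `H ∈ Π_S`: all Pauli coefficients of `H` outside `S` vanish. -/
def HasProperty {n : ℕ} (S : Finset (PauliString n)) (H : Hamiltonian n) : Prop :=
  ∀ p, p ∉ S → pauliCoeff H p = 0

/-- The operator norm `‖A‖_∞` with respect to the Euclidean norm. -/
def opNorm {n : ℕ} (A : QMat n) : ℝ := ‖Matrix.toEuclideanCLM (𝕜 := ℂ) A‖

/-- The Frobenius norm `‖A‖_2 = Tr(A† A)^{1/2}`. -/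
def frobNorm {n : ℕ} (A : QMat n) : ℝ := Real.sqrt (Aᴴ * A).trace.re

/-- `H` is `ε`-far from `Π_S` in normalized Frobenius norm. -/
def IsFar {n : ℕ} (S : Finset (PauliString n)) (ε : ℝ) (H : Hamiltonian n) : Prop :=
  ∀ K : Hamiltonian n, HasProperty S K →
    ε ≤ 1 / Real.sqrt (2 ^ n) * frobNorm ((H : QMat n) - (K : QMat n))

/-- The time evolution `U_t = exp(-i t H)`. -/
def evolution {n : ℕ} (H : Hamiltonian n) (t : ℝ) : QMat n :=
  NormedSpace.exp ((-(Complex.I * (t : ℂ))) • (H : QMat n))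

/-! ### Mutually unbiased bases of stabilizer states -/

/-- The signed Pauli matrix `S(g) = ζ_g P(g)`. -/
def signedPauli {n : ℕ} (ζ : PauliString n → ℤˣ) (g : PauliString n) : QMat n :=
  (((ζ g : ℤˣ) : ℤ) : ℂ) • pauli g

open Classical in
/-- `M_G^r = 1/d ∑_{p ∈ G} (-1)^{p ∘ r} S(p)`, where `d = 2 ^ n`. -/
def stabProj {n : ℕ} (G : AddSubgroup (PauliString n)) (ζ : PauliString n → ℤˣ)
    (r : PauliString n) : QMat n :=
  (1 / 2 ^ n : ℂ) • ∑ p : PauliString n with p ∈ G, commSign p r • signedPauli ζ p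

/-- The data defining the `d + 1` stabilizer bases `|φ_{i,j}⟩`, `d = 2 ^ n`. -/
structure StabilizerMUB (n : ℕ) where
  /-- The groups `G_i`, as subgroups of the Pauli group modulo phases. -/
  group : Fin (2 ^ n + 1) → AddSubgroup (PauliString n)
  card_group : ∀ i, Nat.card (group i) = 2 ^ n
  /-- Each `G_i` is equal to its own commutant. -/
  mem_group_iff : ∀ i g, g ∈ group i ↔ ∀ h ∈ group i, pauli g * pauli h = pauli h * pauli g
  inter_group : ∀ i i', i ≠ i' → group i ⊓ group i' = ⊥
  cover : ∀ g, ∃ i, g ∈ group i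
  /-- A list of `n` generators of each `G_i`. -/
  gen : Fin (2 ^ n + 1) → Fin n → PauliString n
  closure_gen : ∀ i, AddSubgroup.closure (Set.range (gen i)) = group i
  /-- Signs that turn the matrices `P(g)`, `g ∈ G_i`, into a group. -/
  sign : Fin (2 ^ n + 1) → PauliString n → ℤˣ
  sign_mul : ∀ i, ∀ g ∈ group i, ∀ h ∈ group i,
    signedPauli (sign i) g * signedPauli (sign i) h = signedPauli (sign i) (g + h)
  /-- Representatives `r_j^i` of the cosets of `G_i`. -/
  rep : Fin (2 ^ n + 1) → Fin (2 ^ n) → PauliString n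
  rep_bijective : ∀ i, Function.Bijective
    fun j => (QuotientAddGroup.mk (rep i j) : PauliString n ⧸ group i)
  /-- The unit vectors `|φ_{i,j}⟩`, with `|φ_{i,j}⟩⟨φ_{i,j}| = M_{G_i}^{r_j^i}`. -/
  ket : Fin (2 ^ n + 1) → Fin (2 ^ n) → Bits n → ℂ
  ket_unit : ∀ i j, star (ket i j) ⬝ᵥ ket i j = 1
  ket_proj : ∀ i j,
    Matrix.vecMulVec (ket i j) (star (ket i j)) = stabProj (group i) (sign i) (rep i j)

/-! ### Each family of stabilizer vectors is a basis, so that the Born rule gives a distribution -/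

/-- The commutation sign of two letters. -/
def letterSign (a b : ZMod 2 × ZMod 2) : ℤ := if a.1 * b.2 + a.2 * b.1 = 0 then 1 else -1

theorem tensor_mul {n : ℕ} (A B : Fin n → Matrix (Fin 2) (Fin 2) ℂ) :
    tensor A * tensor B = tensor fun k => A k * B k := by
  ext x y
  simp only [tensor, Matrix.mul_apply, Matrix.of_apply, Finset.prod_univ_sum,
    Fintype.piFinset_univ, Finset.prod_mul_distrib]

theorem tensor_one {n : ℕ} : tensor (fun _ : Fin n => (1 : Matrix (Fin 2) (Fin 2) ℂ)) = 1 := by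
  ext x y
  simp only [tensor, Matrix.of_apply, Matrix.one_apply]
  by_cases h : x = y
  · simp [h]
  · obtain ⟨k, hk⟩ := Function.ne_iff.1 h
    rw [if_neg h]
    exact Finset.prod_eq_zero (Finset.mem_univ k) (by simp [hk])

theorem bit_cases (a : ZMod 2) : a = 0 ∨ a = 1 := by
  revert a; decide

theorem sigma_sq (a : ZMod 2 × ZMod 2) : sigma a * sigma a = 1 := by
  rcases a with ⟨a, b⟩
  rcases bit_cases a with rfl | rfl <;> rcases bit_cases b with rfl | rfl <;>
    simp [sigma, Matrix.one_fin_two]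

theorem sigma_comm (a b : ZMod 2 × ZMod 2) :
    sigma a * sigma b = (letterSign a b : ℂ) • (sigma b * sigma a) := by
  have h2 : (1 : ZMod 2) + 1 = 0 := by decide
  rcases a with ⟨a, a'⟩
  rcases b with ⟨b, b'⟩
  rcases bit_cases a with rfl | rfl <;> rcases bit_cases a' with rfl | rfl <;>
    rcases bit_cases b with rfl | rfl <;> rcases bit_cases b' with rfl | rfl <;>
    simp [sigma, letterSign, h2]

theorem letterSign_add (a b c : ZMod 2 × ZMod 2) :
    letterSign a (b + c) = letterSign a b * letterSign a c := by
  revert a b c; unfold letterSign; decide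

theorem pauli_sq {n : ℕ} (p : PauliString n) : pauli p * pauli p = 1 := by
  simp only [pauli, tensor_mul, sigma_sq, tensor_one]

theorem pauli_zero {n : ℕ} : pauli (0 : PauliString n) = 1 := by
  rw [← tensor_one, pauli]
  congr 1
  funext k
  simp [sigma, Matrix.one_fin_two]

/-- The commutation sign of two Pauli strings, computed letter by letter. -/
def stringSign {n : ℕ} (p q : PauliString n) : ℤ := ∏ k, letterSign (p k) (q k)

theorem pauli_comm {n : ℕ} (p q : PauliString n) :
    pauli p * pauli q = (stringSign p q : ℂ) • (pauli q * pauli p) := by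
  simp only [pauli, tensor_mul, stringSign]
  ext x y
  simp only [tensor, Matrix.of_apply, Matrix.smul_apply, smul_eq_mul]
  push_cast
  rw [← Finset.prod_mul_distrib]
  refine Finset.prod_congr rfl fun k _ => ?_
  rw [sigma_comm (p k) (q k)]
  simp

theorem stringSign_add {n : ℕ} (p q r : PauliString n) :
    stringSign p (q + r) = stringSign p q * stringSign p r := by
  simp only [stringSign, Pi.add_apply, letterSign_add, Finset.prod_mul_distrib]

theorem stringSign_eq {n : ℕ} (p q : PauliString n) :
    stringSign p q = 1 ∨ stringSign p q = -1 := by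
  unfold stringSign
  refine Finset.prod_induction _ (fun z : ℤ => z = 1 ∨ z = -1) ?_ (Or.inl rfl) ?_
  · rintro a b (rfl | rfl) (rfl | rfl) <;> simp
  · intro k _
    unfold letterSign
    split_ifs <;> simp

theorem commSign_eq {n : ℕ} (p q : PauliString n) : commSign p q = (stringSign p q : ℂ) := by
  have h := pauli_comm p q
  unfold commSign
  rcases stringSign_eq p q with hs | hs
  · rw [hs] at h ⊢
    rw [if_pos (by simpa using h)]
    simp
  · rw [hs] at h ⊢
    rw [if_neg]
    · simp
    · intro hc
      rw [hc] at h
      have h0 : pauli q * pauli p = 0 := by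
        ext x y
        have := congrFun (congrFun h x) y
        simp only [Int.cast_neg, Int.cast_one, neg_smul, one_smul, Matrix.neg_apply] at this
        simpa using self_eq_neg.1 this
      have h1 : (1 : QMat n) = 0 := by
        calc (1 : QMat n) = pauli q * (pauli p * pauli p) * pauli q := by
              rw [pauli_sq, mul_one, pauli_sq]
          _ = (pauli q * pauli p) * (pauli p * pauli q) := by simp only [mul_assoc]
          _ = 0 := by rw [h0, zero_mul]
      have := congrFun (congrFun h1 0) 0
      simp at this

theorem commSign_add {n : ℕ} (p q r : PauliString n) :
    commSign p (q + r) = commSign p q * commSign p r := by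
  simp only [commSign_eq, stringSign_add]; push_cast; rfl

theorem exists_stringSign_eq_neg_one {n : ℕ} {p : PauliString n} (hp : p ≠ 0) :
    ∃ q, stringSign p q = -1 := by
  obtain ⟨k, hk⟩ := Function.ne_iff.1 hp
  have key : ∀ a : ZMod 2 × ZMod 2, a ≠ 0 → ∃ b, letterSign a b = -1 := by
    unfold letterSign; decide
  obtain ⟨b, hb⟩ := key (p k) hk
  refine ⟨Pi.single k b, ?_⟩
  unfold stringSign
  rw [Finset.prod_eq_single k, Pi.single_eq_same, hb]
  · intro l _ hl
    rw [Pi.single_eq_of_ne hl]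
    simp [letterSign]
  · simp

theorem sum_commSign {n : ℕ} {p : PauliString n} (hp : p ≠ 0) : ∑ r, commSign p r = 0 := by
  obtain ⟨q, hq⟩ := exists_stringSign_eq_neg_one hp
  have h : ∑ r, commSign p r = ∑ r, commSign p (r + q) :=
    (Equiv.sum_comp (Equiv.addRight q) (commSign p)).symm
  simp only [commSign_add, commSign_eq p q, hq] at h
  rw [← Finset.sum_mul] at h
  push_cast at h
  have h2 : (2 : ℂ) * ∑ r, commSign p r = 0 := by linear_combination h
  simpa using h2

namespace StabilizerMUB

variable {n : ℕ} (B : StabilizerMUB n)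

theorem commSign_of_mem {i : Fin (2 ^ n + 1)} {p g : PauliString n} (hp : p ∈ B.group i)
    (hg : g ∈ B.group i) : commSign p g = 1 := by
  unfold commSign
  rw [if_pos ((B.mem_group_iff i p).1 hp g hg)]

theorem sum_commSign_rep {i : Fin (2 ^ n + 1)} {p : PauliString n} (hp : p ∈ B.group i)
    (h0 : p ≠ 0) : ∑ j, commSign p (B.rep i j) = 0 := by
  let e : Fin (2 ^ n) × B.group i → PauliString n := fun x => B.rep i x.1 + x.2
  have he : Function.Bijective e := by
    constructor
    · rintro ⟨j, g, hg⟩ ⟨j', g', hg'⟩ h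
      simp only [e] at h
      have hj : j = j' := by
        apply (B.rep_bijective i).1
        simp only [QuotientAddGroup.eq]
        have : -B.rep i j + B.rep i j' = g - g' := by
          rw [← eq_sub_iff_add_eq] at h
          rw [h]; abel
        rw [this]
        exact sub_mem hg hg'
      subst hj
      simpa using h
    · intro q
      obtain ⟨j, hj⟩ := (B.rep_bijective i).2 (QuotientAddGroup.mk q)
      rw [QuotientAddGroup.eq] at hj
      exact ⟨(j, ⟨_, hj⟩), by simp [e]⟩
  classical
  have hs := sum_commSign h0
  rw [← he.sum_comp, Fintype.sum_prod_type] at hs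
  have : ∀ j, ∑ g : B.group i, commSign p (e (j, g)) = (2 ^ n : ℂ) * commSign p (B.rep i j) := by
    intro j
    have : ∀ g : B.group i, commSign p (e (j, g)) = commSign p (B.rep i j) := by
      intro g
      simp only [e, commSign_add, B.commSign_of_mem hp g.2, mul_one]
    simp only [this, Finset.sum_const, Finset.card_univ, ← Nat.card_eq_fintype_card,
      B.card_group i, nsmul_eq_mul]
    push_cast; rfl
  simp only [this, ← Finset.mul_sum] at hs
  simpa using hs

theorem sign_zero (i : Fin (2 ^ n + 1)) : signedPauli (B.sign i) 0 = 1 := by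
  have h := B.sign_mul i 0 (zero_mem _) 0 (zero_mem _)
  rw [add_zero] at h
  rcases Int.units_eq_one_or (B.sign i 0) with hs | hs <;>
    simp only [signedPauli, hs, pauli_zero] at h ⊢
  · simp
  · exfalso
    have := congrFun (congrFun h 0) 0
    norm_num at this

/-- The projectors of one basis sum up to the identity. -/
theorem sum_proj (i : Fin (2 ^ n + 1)) :
    ∑ j, Matrix.vecMulVec (B.ket i j) (star (B.ket i j)) = 1 := by
  classical
  simp only [B.ket_proj, stabProj]
  rw [← Finset.smul_sum, Finset.sum_comm]
  simp only [← Finset.sum_smul]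
  rw [Finset.sum_eq_single 0]
  · have : ∀ r : PauliString n, commSign 0 r = 1 := by
      intro r; simp [commSign, pauli_zero]
    simp only [this, Finset.sum_const, Finset.card_univ, Fintype.card_fin, B.sign_zero i]
    rw [smul_smul]
    simp
  · intro p hp h0
    rw [B.sum_commSign_rep (by simpa using hp) h0, zero_smul]
  · intro h
    simp at h

end StabilizerMUB

theorem evolution_unitary {n : ℕ} (H : Hamiltonian n) (t : ℝ) :
    (evolution H t)ᴴ * evolution H t = 1 := by
  have hH : (H : QMat n)ᴴ = H := H.2
  unfold evolution
  rw [← Matrix.exp_conjTranspose, Matrix.conjTranspose_smul, hH,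
    ← Matrix.exp_add_of_commute _ _ (((Commute.refl (H : QMat n)).smul_left _).smul_right _),
    ← add_smul]
  simp

/-! ### One experiment -/

/-- The outcome probability `|⟨φ_{i,ℓ}| exp(-i t H) |φ_{i,j}⟩|²`. -/
def bornWeight {n : ℕ} (B : StabilizerMUB n) (H : Hamiltonian n) (t : ℝ)
    (i : Fin (2 ^ n + 1)) (j l : Fin (2 ^ n)) : ℝ :=
  ‖star (B.ket i l) ⬝ᵥ (evolution H t *ᵥ B.ket i j)‖ ^ 2

theorem sum_bornWeight {n : ℕ} (B : StabilizerMUB n) (H : Hamiltonian n) (t : ℝ)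
    (i : Fin (2 ^ n + 1)) (j : Fin (2 ^ n)) : ∑ l, bornWeight B H t i j l = 1 := by
  set v := evolution H t *ᵥ B.ket i j with hv
  have h1 : ∀ l, ((bornWeight B H t i j l : ℝ) : ℂ) =
      star v ⬝ᵥ (Matrix.vecMulVec (B.ket i l) (star (B.ket i l)) *ᵥ v) := by
    intro l
    rw [Matrix.vecMulVec_mulVec, dotProduct_smul, bornWeight, ← hv]
    have : star v ⬝ᵥ B.ket i l = star (star (B.ket i l) ⬝ᵥ v) := by
      rw [Matrix.star_dotProduct]
    rw [this]
    simp only [op_smul_eq_mul, Complex.star_def]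
    rw [← Complex.normSq_eq_conj_mul_self, Complex.normSq_eq_norm_sq]
  have h2 : ((∑ l, bornWeight B H t i j l : ℝ) : ℂ) = 1 := by
    push_cast
    simp only [h1]
    rw [← dotProduct_sum, ← Matrix.sum_mulVec, B.sum_proj, Matrix.one_mulVec, hv,
      Matrix.star_mulVec, ← Matrix.dotProduct_mulVec, Matrix.mulVec_mulVec, evolution_unitary,
      Matrix.one_mulVec, B.ket_unit]
  exact_mod_cast h2

/-- The law of the outcome `ℓ` when `|φ_{i,j}⟩` is prepared, evolves under `H` for time `t` and is
measured in the `i`-th basis. -/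
def measure {n : ℕ} (B : StabilizerMUB n) (H : Hamiltonian n) (t : ℝ)
    (i : Fin (2 ^ n + 1)) (j : Fin (2 ^ n)) : PMF (Fin (2 ^ n)) :=
  PMF.ofFintype (fun l => ENNReal.ofReal (bornWeight B H t i j l)) (by
    rw [← ENNReal.ofReal_sum_of_nonneg (fun l _ => by unfold bornWeight; positivity),
      sum_bornWeight, ENNReal.ofReal_one])

/-- The classical record of one experiment: the basis `i`, the input `j` and the outcome `ℓ`. -/
structure Round (n : ℕ) where
  basis : Fin (2 ^ n + 1)
  input : Fin (2 ^ n)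
  outcome : Fin (2 ^ n)

/-- One experiment: `i` and `j` are uniform and independent, `ℓ` is the measurement outcome. -/
def experiment {n : ℕ} (B : StabilizerMUB n) (H : Hamiltonian n) (t : ℝ) : PMF (Round n) :=
  (PMF.uniformOfFintype (Fin (2 ^ n + 1))).bind fun i =>
    (PMF.uniformOfFintype (Fin (2 ^ n))).bind fun j =>
      (measure B H t i j).map fun l => ⟨i, j, l⟩

/-! ### The tester -/

/-- `φ ∼_S ψ`: some Pauli string in `S ∪ {I}` maps `φ` to `ψ` up to a phase. -/
def Related {n : ℕ} (S : Finset (PauliString n)) (φ ψ : Bits n → ℂ) : Prop :=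
  ∃ θ : ℝ, ∃ p ∈ insert 0 S, pauli p *ᵥ φ = Complex.exp (Complex.I * θ) • ψ

/-- The input state and the outcome state of a round are related. -/
def Round.Passes {n : ℕ} (r : Round n) (B : StabilizerMUB n) (S : Finset (PauliString n)) : Prop :=
  Related S (B.ket r.basis r.input) (B.ket r.basis r.outcome)

/-- `null`: `H` has the property. `alt`: `H` is far from having the property. -/
inductive Verdict
  | null
  | alt

/-- A run of the tester: its verdict and the records of the experiments it performed. -/
structure Run (n : ℕ) where
  verdict : Verdict
  rounds : List (Round n)

open Classical in
/-- At most `N` rounds. A violation stops the loop with verdict `alt`; if there is none, the verdict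
is `null`. -/
def testerLoop {n : ℕ} (B : StabilizerMUB n) (S : Finset (PauliString n)) (H : Hamiltonian n)
    (t : ℝ) : ℕ → PMF (Run n)
  | 0 => PMF.pure ⟨Verdict.null, []⟩
  | N + 1 => (experiment B H t).bind fun r =>
      if r.Passes B S then
        (testerLoop B S H t N).map fun o => ⟨o.verdict, r :: o.rounds⟩
      else PMF.pure ⟨Verdict.alt, [r]⟩

/-- The evolution time of one experiment. -/
def evolTime (ε : ℝ) : ℝ := ε / 6

/-- The tester: evolution time `t = ε / 6`, and at most `⌈2 log 3 / (t² ε²)⌉` experiments. -/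
def tester {n : ℕ} (B : StabilizerMUB n) (S : Finset (PauliString n)) (ε : ℝ)
    (H : Hamiltonian n) : PMF (Run n) :=
  testerLoop B S H (evolTime ε) ⌈2 * Real.log 3 / (evolTime ε ^ 2 * ε ^ 2)⌉₊

/-- The probability that the tester returns the verdict `v`. -/
def verdictProb {n : ℕ} (B : StabilizerMUB n) (S : Finset (PauliString n)) (ε : ℝ)
    (H : Hamiltonian n) (v : Verdict) : ℝ≥0∞ :=
  (tester B S ε H).map Run.verdict v

/-! ### Classical processing time: a random access machine -/

/-- Registers and memory cells hold natural numbers. -/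
structure Store where
  reg : ℕ → ℕ
  mem : ℕ → ℕ

def Store.setReg (s : Store) (x v : ℕ) : Store := { s with reg := Function.update s.reg x v }

def Store.setMem (s : Store) (a v : ℕ) : Store := { s with mem := Function.update s.mem a v }

/-- Programs of a random access machine whose only arithmetic is adding and subtracting one. -/
inductive Program
  | const (x c : ℕ)
  | copy (x y : ℕ)
  | inc (x : ℕ)
  | dec (x : ℕ)
  | load (x a : ℕ)
  | store (a x : ℕ)
  | seq (p q : Program)
  | ifNonzero (x : ℕ) (p q : Program)
  | whileNonzero (x : ℕ) (p : Program)

/-- `Exec p s T s'`: the program `p`, started in `s`, halts in `s'` after `T` steps. Each elementary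
instruction and each test of a register is one step. -/
inductive Exec : Program → Store → ℕ → Store → Prop
  | const (x c : ℕ) (s : Store) : Exec (.const x c) s 1 (s.setReg x c)
  | copy (x y : ℕ) (s : Store) : Exec (.copy x y) s 1 (s.setReg x (s.reg y))
  | inc (x : ℕ) (s : Store) : Exec (.inc x) s 1 (s.setReg x (s.reg x + 1))
  | dec (x : ℕ) (s : Store) : Exec (.dec x) s 1 (s.setReg x (s.reg x - 1))
  | load (x a : ℕ) (s : Store) : Exec (.load x a) s 1 (s.setReg x (s.mem (s.reg a)))
  | store (a x : ℕ) (s : Store) : Exec (.store a x) s 1 (s.setMem (s.reg a) (s.reg x))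
  | seq {p q : Program} {s s' s'' : Store} {T T' : ℕ} :
      Exec p s T s' → Exec q s' T' s'' → Exec (.seq p q) s (T + T') s''
  | ifTrue {x : ℕ} {p q : Program} {s s' : Store} {T : ℕ} :
      s.reg x ≠ 0 → Exec p s T s' → Exec (.ifNonzero x p q) s (T + 1) s'
  | ifFalse {x : ℕ} {p q : Program} {s s' : Store} {T : ℕ} :
      s.reg x = 0 → Exec q s T s' → Exec (.ifNonzero x p q) s (T + 1) s'
  | whileTrue {x : ℕ} {p : Program} {s s' s'' : Store} {T T' : ℕ} :
      s.reg x ≠ 0 → Exec p s T s' → Exec (.whileNonzero x p) s' T' s'' →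
        Exec (.whileNonzero x p) s (T + T' + 1) s''
  | whileFalse {x : ℕ} {p : Program} {s : Store} :
      s.reg x = 0 → Exec (.whileNonzero x p) s 1 s

/-- The `2 n` bits of a Pauli string. -/
def stringBits {n : ℕ} (p : PauliString n) : List ℕ :=
  (List.finRange n).flatMap fun k => [(p k).1.val, (p k).2.val]

/-- The input of the check made in a round: `n`, the length of the list `L` of the Pauli strings in
`S`, the coset representatives of the input and of the outcome, the `n` generators of the group of
the basis, and the list `L`. -/
def checkInput {n : ℕ} (B : StabilizerMUB n) (L : List (PauliString n)) (r : Round n) : List ℕ :=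
  [n, L.length] ++ stringBits (B.rep r.basis r.input) ++ stringBits (B.rep r.basis r.outcome) ++
    (List.finRange n).flatMap (fun k => stringBits (B.gen r.basis k)) ++ L.flatMap stringBits

/-- The store in which the input is written in the memory and all else is zero. -/
def initialStore (input : List ℕ) : Store where
  reg := fun _ => 0
  mem := fun a => input.getD a 0

/-- `ClassicalRun prog B S L rs T`: run on the records `rs` one after the other, `prog` halts on each
of them, with a nonzero number in register `0` if and only if the round passes, and `T` is the total
number of steps. -/
inductive ClassicalRun {n : ℕ} (prog : Program) (B : StabilizerMUB n) (S : Finset (PauliString n))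
    (L : List (PauliString n)) : List (Round n) → ℕ → Prop
  | nil : ClassicalRun prog B S L [] 0
  | cons {r : Round n} {rs : List (Round n)} {T T' : ℕ} {s : Store} :
      Exec prog (initialStore (checkInput B L r)) T s → (s.reg 0 ≠ 0 ↔ r.Passes B S) →
        ClassicalRun prog B S L rs T' → ClassicalRun prog B S L (r :: rs) (T + T')

/-! ### Implementation of the states and measurements: Clifford circuits -/

/-- Hadamard, phase and controlled-NOT gates on `n` qubits. -/
inductive Gate (n : ℕ)
  | hadamard (k : Fin n)
  | phase (k : Fin n)
  | cnot (c k : Fin n) (h : c ≠ k)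

/-- The matrix which acts as `A` on qubit `k` and trivially on all others. -/
def onQubit {n : ℕ} (A : Matrix (Fin 2) (Fin 2) ℂ) (k : Fin n) : QMat n :=
  tensor (Function.update (fun _ => 1) k A)

/-- The unitary matrix of a gate; `cnot c k` adds the bit `c` to the bit `k`. -/
def Gate.matrix {n : ℕ} : Gate n → QMat n
  | .hadamard k => onQubit ((1 / Real.sqrt 2 : ℂ) • !![1, 1; 1, -1]) k
  | .phase k => onQubit !![1, 0; 0, Complex.I] k
  | .cnot c k _ => Matrix.of fun x y => if x = Function.update y k (y k + y c) then 1 else 0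

/-- The unitary matrix of a circuit, whose first gate is applied first. -/
def circuitMatrix {n : ℕ} : List (Gate n) → QMat n
  | [] => 1
  | g :: gs => circuitMatrix gs * g.matrix

/-- The circuit maps the state `|0…0⟩` to `φ` up to a phase. -/
def Prepares {n : ℕ} (c : List (Gate n)) (φ : Bits n → ℂ) : Prop :=
  ∃ θ : ℝ, circuitMatrix c *ᵥ Pi.single 0 1 = Complex.exp (Complex.I * θ) • φ

/-- The circuit maps the vectors `φ_j` to the computational basis up to phases, so that applying it
and measuring in the computational basis is the same as measuring in the basis `φ_j`. -/
def ImplementsMeasurement {n : ℕ} (c : List (Gate n)) (φ : Fin (2 ^ n) → Bits n → ℂ) : Prop :=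
  ∃ e : Fin (2 ^ n) ≃ Bits n, ∀ j, ∃ θ : ℝ,
    circuitMatrix c *ᵥ φ j = Complex.exp (Complex.I * θ) • Pi.single (e j) 1

end HamiltonianTesting

end

open HamiltonianTesting

/-!
The tester works because of two facts about the expansion `e^{-itH} = ∑ u_P P` into Pauli strings.

First, in the `i`-th stabilizer basis a Pauli string permutes the basis vectors up to phases, by
translating the cosets of `G_i` (`StabilizerMUB.ket_pauli_ket_eq_zero`, `StabilizerMUB.related_iff`).
Hence a transition between unrelated vectors only sees the coefficients `u_P` with
`P ∉ (S ∪ {I}) + G_i`, and averaging over the input vector the probability of a violation in this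
basis is exactly the sum of `|u_P|²` over these `P` (`sum_violation`). The groups `G_i` meet
trivially, so that a given `P ∉ S ∪ {I}` lies in `(S ∪ {I}) + G_i` for at most `|S ∪ {I}|` of the
`2 ^ n + 1` indices `i` (`card_not_mem_farStrings_le`), and the violation probability is
between `(1 - ε⁴/144) w` and `w`, where `w` is the sum of `|u_P|²` over `P ∉ S ∪ {I}`.

Second, `e^{-itH} = 1 - itH` up to an error of operator norm, hence of normalized Frobenius norm, at
most `t²` (`exists_coeff_evolution`). So `w ≤ t⁴` if `H ∈ Π_S`, while `w ≥ (25/36) t² ε²` for `t = ε/6`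
if `H` is far and has trace zero. As the verdict is `null` with probability `(1 - F) ^ N`, where `F` is
the violation probability (`testerLoop_null`), the two bounds on the verdicts follow.

A round passes if and only if `p + r_j + r_ℓ ∈ G_i` for some `p ∈ S ∪ {I}`, that is, if `p + r_j + r_ℓ`
commutes with the `n` generators of `G_i`. The program `Checker.program` computes these parities
with three nested loops; its pointers only move by increments.

Circuits: pairwise commuting Pauli strings are turned into strings of `I` and `Z` by `O(n²)` Clifford
gates, clearing one qubit at a time (`exists_circuit_of_commute`). The circuit for `G_i` turns the
projectors of the `i`-th basis into diagonal ones, so it maps this basis to the computational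
basis; preparation uses the inverse circuit. The same circuits yield signs and eigenvectors for
the existence of stabilizer bases, once the Pauli strings are partitioned into maximal commuting
groups. Such a partition comes from the field `F` of `2 ^ n` elements: the groups are the graphs of
the symmetric matrices of the forms `(x, y) ↦ Tr(a x y)`, `a ∈ F`, and the strings of `I` and `Z`
(`exists_spread`).
-/

namespace HamiltonianTesting

/-! ### The Pauli strings as an orthogonal basis of the matrices -/

section PauliBasis

variable {n : ℕ}

theorem sigma_conjTranspose (a : ZMod 2 × ZMod 2) : (sigma a)ᴴ = sigma a := by
  rcases a with ⟨a, b⟩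
  rcases bit_cases a with rfl | rfl <;> rcases bit_cases b with rfl | rfl <;>
    ext i j <;> fin_cases i <;> fin_cases j <;> simp [sigma]

theorem tensor_conjTranspose (A : Fin n → Matrix (Fin 2) (Fin 2) ℂ) :
    (tensor A)ᴴ = tensor fun k => (A k)ᴴ := by
  ext x y
  simp [tensor, Matrix.conjTranspose_apply]

theorem pauli_conjTranspose (p : PauliString n) : (pauli p)ᴴ = pauli p := by
  simp only [pauli, tensor_conjTranspose, sigma_conjTranspose]

theorem trace_tensor (A : Fin n → Matrix (Fin 2) (Fin 2) ℂ) :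
    (tensor A).trace = ∏ k, (A k).trace := by
  simp only [Matrix.trace, Matrix.diag_apply, tensor, Matrix.of_apply, Finset.prod_univ_sum,
    Fintype.piFinset_univ]

theorem trace_sigma_mul (a b : ZMod 2 × ZMod 2) :
    (sigma a * sigma b).trace = if a = b then 2 else 0 := by
  rcases a with ⟨a, a'⟩
  rcases b with ⟨b, b'⟩
  rcases bit_cases a with rfl | rfl <;> rcases bit_cases a' with rfl | rfl <;>
    rcases bit_cases b with rfl | rfl <;> rcases bit_cases b' with rfl | rfl <;>
    norm_num [sigma, Matrix.trace_fin_two, Prod.ext_iff]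

theorem trace_pauli_mul (p q : PauliString n) :
    (pauli p * pauli q).trace = if p = q then 2 ^ n else 0 := by
  rw [pauli, pauli, tensor_mul, trace_tensor]
  simp only [trace_sigma_mul]
  split_ifs with h
  · simp [h]
  · obtain ⟨k, hk⟩ := Function.ne_iff.1 h
    exact Finset.prod_eq_zero (Finset.mem_univ k) (by simp [hk])

theorem sum_sigma_mul_sigma (x y x' y' : Fin 2) :
    ∑ a, sigma a x y * sigma a x' y' = if x = y' ∧ y = x' then 2 else 0 := by
  rw [Fintype.sum_prod_type]
  have h2 : ∀ f : ZMod 2 → ℂ, ∑ a, f a = f 0 + f 1 := fun f => Fin.sum_univ_two f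
  simp only [h2]
  fin_cases x <;> fin_cases y <;> fin_cases x' <;> fin_cases y' <;> norm_num [sigma]

theorem sum_pauli_mul_pauli (x y x' y' : Bits n) :
    ∑ p, pauli p x y * pauli p x' y' = if x = y' ∧ y = x' then 2 ^ n else 0 := by
  have h : ∑ p, pauli p x y * pauli p x' y' =
      ∏ k, ∑ a, sigma a (x k) (y k) * sigma a (x' k) (y' k) := by
    simp only [Finset.prod_univ_sum, Fintype.piFinset_univ, pauli, tensor, Matrix.of_apply,
      Finset.prod_mul_distrib]
  rw [h]
  simp only [sum_sigma_mul_sigma]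
  split_ifs with hxy
  · simp [hxy.1, hxy.2]
  · have : ∃ k, ¬ (x k = y' k ∧ y k = x' k) := by
      by_contra! hc
      exact hxy ⟨funext fun k => (hc k).1, funext fun k => (hc k).2⟩
    obtain ⟨k, hk⟩ := this
    exact Finset.prod_eq_zero (Finset.mem_univ k) (if_neg hk)

/-- The coefficient of the Pauli string `p` in the Pauli expansion of a matrix. -/
noncomputable def coeff (A : QMat n) (p : PauliString n) : ℂ := (A * pauli p).trace / 2 ^ n

theorem sum_coeff_smul_pauli (A : QMat n) : ∑ p, coeff A p • pauli p = A := by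
  ext x y
  have h2 : (2 ^ n : ℂ) ≠ 0 := pow_ne_zero _ two_ne_zero
  rw [Matrix.sum_apply]
  simp only [Matrix.smul_apply, coeff, Matrix.trace, Matrix.diag_apply, Matrix.mul_apply,
    smul_eq_mul]
  calc ∑ p, (∑ a, ∑ b, A a b * pauli p b a) / 2 ^ n * pauli p x y
      = ∑ a, ∑ b, A a b / 2 ^ n * ∑ p, pauli p b a * pauli p x y := by
        simp only [Finset.sum_div, Finset.sum_mul, Finset.mul_sum]
        rw [Finset.sum_comm]
        refine Finset.sum_congr rfl fun a _ => ?_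
        rw [Finset.sum_comm]
        refine Finset.sum_congr rfl fun b _ => Finset.sum_congr rfl fun p _ => ?_
        ring
    _ = A x y := by
        simp only [sum_pauli_mul_pauli]
        rw [Finset.sum_eq_single x, Finset.sum_eq_single y]
        · simp [h2]
        · intro b _ hb
          simp [hb]
        · simp
        · intro a _ ha
          simp [ha]
        · simp

theorem trace_conjTranspose_mul_sum_pauli (V : Finset (PauliString n)) (c : PauliString n → ℂ) :
    ((∑ p ∈ V, c p • pauli p)ᴴ * ∑ p ∈ V, c p • pauli p).trace =
      ((2 ^ n * ∑ p ∈ V, ‖c p‖ ^ 2 : ℝ) : ℂ) := by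
  rw [Matrix.conjTranspose_sum, Finset.sum_mul_sum, Matrix.trace_sum]
  push_cast
  rw [Finset.mul_sum]
  refine Finset.sum_congr rfl fun p hp => ?_
  rw [Matrix.trace_sum]
  simp only [Matrix.conjTranspose_smul, pauli_conjTranspose, Matrix.smul_mul, Matrix.mul_smul,
    Matrix.trace_smul, trace_pauli_mul]
  rw [Finset.sum_eq_single p]
  · rw [if_pos rfl, ← Complex.ofReal_pow, ← Complex.normSq_eq_norm_sq,
      Complex.normSq_eq_conj_mul_self]
    simp only [smul_eq_mul, Complex.star_def]
    ring
  · intro q _ hq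
    simp [hq.symm]
  · exact fun h => absurd hp h

theorem trace_conjTranspose_mul_self (A : QMat n) :
    (Aᴴ * A).trace = ((2 ^ n * ∑ p, ‖coeff A p‖ ^ 2 : ℝ) : ℂ) := by
  conv_lhs => rw [← sum_coeff_smul_pauli A]
  exact trace_conjTranspose_mul_sum_pauli _ _

theorem coeff_sub (A A' : QMat n) (p : PauliString n) :
    coeff (A - A') p = coeff A p - coeff A' p := by
  simp [coeff, Matrix.sub_mul, Matrix.trace_sub, sub_div]

theorem coeff_smul (c : ℂ) (A : QMat n) (p : PauliString n) :
    coeff (c • A) p = c * coeff A p := by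
  simp [coeff, Matrix.trace_smul, mul_div_assoc]

theorem coeff_sum_smul_pauli (V : Finset (PauliString n)) (c : PauliString n → ℂ)
    (p : PauliString n) : coeff (∑ q ∈ V, c q • pauli q) p = if p ∈ V then c p else 0 := by
  have h2 : (2 ^ n : ℂ) ≠ 0 := pow_ne_zero _ two_ne_zero
  rw [coeff, Finset.sum_mul, Matrix.trace_sum]
  simp only [Matrix.smul_mul, Matrix.trace_smul, trace_pauli_mul, smul_eq_mul, mul_ite, mul_zero,
    Finset.sum_ite_eq']
  split_ifs <;> simp [h2]

theorem coeff_one {p : PauliString n} (hp : p ≠ 0) : coeff (1 : QMat n) p = 0 := by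
  rw [coeff, ← pauli_zero, trace_pauli_mul, if_neg hp.symm, zero_div]

theorem coeff_isSelfAdjoint (H : Hamiltonian n) (p : PauliString n) :
    star (coeff (H : QMat n) p) = coeff (H : QMat n) p := by
  have hH : (H : QMat n)ᴴ = H := H.2
  rw [coeff, star_div₀, ← Matrix.trace_conjTranspose, Matrix.conjTranspose_mul, hH,
    pauli_conjTranspose, Matrix.trace_mul_comm]
  simp

end PauliBasis

/-! ### Stabilizer bases and the action of the Pauli strings on them -/

section Strings

variable {n : ℕ}

theorem stringSign_comm (p q : PauliString n) : stringSign p q = stringSign q p := by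
  unfold stringSign letterSign
  refine Finset.prod_congr rfl fun k _ => ?_
  rw [show (p k).1 * (q k).2 + (p k).2 * (q k).1 = (q k).1 * (p k).2 + (q k).2 * (p k).1 by ring]

theorem commSign_comm (p q : PauliString n) : commSign p q = commSign q p := by
  rw [commSign_eq, commSign_eq, stringSign_comm]

theorem commSign_mul_self (p q : PauliString n) : commSign p q * commSign p q = 1 := by
  rw [commSign_eq]
  rcases stringSign_eq p q with h | h <;> rw [h] <;> norm_num

theorem pauli_mul_comm_sign (p q : PauliString n) :
    pauli p * pauli q = commSign p q • (pauli q * pauli p) := by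
  rw [commSign_eq, pauli_comm]

theorem commSign_eq_one_iff (p q : PauliString n) :
    commSign p q = 1 ↔ pauli p * pauli q = pauli q * pauli p := by
  unfold commSign
  split_ifs with h
  · simp [h]
  · simp only [h, iff_false]
    norm_num

theorem commSign_eq_one_iff_stringSign (p q : PauliString n) :
    commSign p q = 1 ↔ stringSign p q = 1 := by
  rw [commSign_eq]
  exact_mod_cast Iff.rfl

theorem add_self_string (p : PauliString n) : p + p = 0 := by
  have h2 : ∀ a : ZMod 2 × ZMod 2, a + a = 0 := by decide
  funext k
  exact h2 (p k)

theorem neg_string (p : PauliString n) : -p = p :=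
  (eq_neg_of_add_eq_zero_left (add_self_string p)).symm

theorem commSign_neg_one_of_ne {p q : PauliString n} (h : commSign p q ≠ 1) :
    commSign p q = -1 := by
  rw [commSign_eq] at h ⊢
  rcases stringSign_eq p q with hs | hs
  · simp [hs] at h
  · simp [hs]

end Strings

namespace StabilizerMUB

variable {n : ℕ} (B : StabilizerMUB n)

theorem mem_group_iff_commSign (i : Fin (2 ^ n + 1)) (g : PauliString n) :
    g ∈ B.group i ↔ ∀ h ∈ B.group i, commSign h g = 1 := by
  rw [B.mem_group_iff]
  refine forall₂_congr fun h _ => ?_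
  rw [commSign_comm, commSign_eq_one_iff]

theorem mem_group_iff_gen (i : Fin (2 ^ n + 1)) (g : PauliString n) :
    g ∈ B.group i ↔ ∀ k, commSign (B.gen i k) g = 1 := by
  rw [mem_group_iff_commSign]
  constructor
  · intro h k
    refine h _ ?_
    rw [← B.closure_gen i]
    exact AddSubgroup.subset_closure ⟨k, rfl⟩
  · intro h p hp
    rw [← B.closure_gen i] at hp
    rw [commSign_comm]
    induction hp using AddSubgroup.closure_induction with
    | mem x hx =>
      obtain ⟨k, rfl⟩ := hx
      rw [commSign_comm, h k]
    | zero => rw [commSign_comm]; simp [commSign, pauli_zero]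
    | add x y _ _ hx hy => rw [commSign_add, hx, hy, one_mul]
    | neg x _ hx => rw [neg_string, hx]

theorem proj_mulVec_ket (i : Fin (2 ^ n + 1)) (j : Fin (2 ^ n)) :
    Matrix.vecMulVec (B.ket i j) (star (B.ket i j)) *ᵥ B.ket i j = B.ket i j := by
  rw [Matrix.vecMulVec_mulVec, B.ket_unit]
  simp

/-- The basis vectors are joint eigenvectors of the signed group elements. -/
theorem signedPauli_mulVec_ket (i : Fin (2 ^ n + 1)) (j : Fin (2 ^ n)) {g : PauliString n}
    (hg : g ∈ B.group i) :
    signedPauli (B.sign i) g *ᵥ B.ket i j = commSign g (B.rep i j) • B.ket i j := by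
  classical
  have key : signedPauli (B.sign i) g * stabProj (B.group i) (B.sign i) (B.rep i j) =
      commSign g (B.rep i j) • stabProj (B.group i) (B.sign i) (B.rep i j) := by
    unfold stabProj
    rw [Matrix.mul_smul, smul_comm (commSign g _)]
    refine congrArg (fun M : QMat n => (1 / 2 ^ n : ℂ) • M) ?_
    rw [Finset.mul_sum, Finset.smul_sum]
    -- the sum is reindexed by the translation by `g`
    refine Finset.sum_bij' (M := QMat n) (fun p _ => g + p) (fun p _ => g + p) ?_ ?_ ?_ ?_ ?_
    · intro p hp
      simp only [Finset.mem_filter, Finset.mem_univ, true_and] at hp ⊢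
      exact add_mem hg hp
    · intro p hp
      simp only [Finset.mem_filter, Finset.mem_univ, true_and] at hp ⊢
      exact add_mem hg hp
    · intro p _
      rw [← add_assoc, add_self_string, zero_add]
    · intro p _
      rw [← add_assoc, add_self_string, zero_add]
    · intro p hp
      simp only [Finset.mem_filter, Finset.mem_univ, true_and] at hp
      rw [Matrix.mul_smul, B.sign_mul i g hg p hp, smul_smul, commSign_comm (g + p),
        commSign_add, commSign_comm _ g, commSign_comm _ p, ← mul_assoc, commSign_mul_self,
        one_mul]
  rw [← B.ket_proj] at key
  have := congrArg (fun M => M *ᵥ B.ket i j) key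
  simpa only [← Matrix.mulVec_mulVec, Matrix.smul_mulVec, proj_mulVec_ket] using this

theorem signedPauli_conjTranspose (ζ : PauliString n → ℤˣ) (g : PauliString n) :
    (signedPauli ζ g)ᴴ = signedPauli ζ g := by
  rw [signedPauli, Matrix.conjTranspose_smul, pauli_conjTranspose]
  simp

/-- Selection rule: a Pauli string has matrix elements between two basis vectors only if it
maps the coset of the first to the coset of the second. -/
theorem ket_pauli_ket_eq_zero (i : Fin (2 ^ n + 1)) (j l : Fin (2 ^ n)) {p : PauliString n}
    (h : p + B.rep i j + B.rep i l ∉ B.group i) :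
    star (B.ket i l) ⬝ᵥ (pauli p *ᵥ B.ket i j) = 0 := by
  rw [mem_group_iff_commSign] at h
  push Not at h
  obtain ⟨g, hg, hne⟩ := h
  have hs := commSign_neg_one_of_ne hne
  rw [commSign_add, commSign_add] at hs
  set z := star (B.ket i l) ⬝ᵥ (pauli p *ᵥ B.ket i j) with hz
  -- the matrix element of `S(g) P(p)` is computed in two ways
  have h1 : star (B.ket i l) ⬝ᵥ (signedPauli (B.sign i) g *ᵥ (pauli p *ᵥ B.ket i j)) =
      commSign g (B.rep i l) * z := by
    have : star (B.ket i l) ᵥ* signedPauli (B.sign i) g =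
        commSign g (B.rep i l) • star (B.ket i l) := by
      have h := congrArg star (B.signedPauli_mulVec_ket i l hg)
      rw [Matrix.star_mulVec, signedPauli_conjTranspose, star_smul] at h
      rw [h, commSign_eq]
      simp
    rw [Matrix.dotProduct_mulVec, this, smul_dotProduct, smul_eq_mul]
  have h2 : star (B.ket i l) ⬝ᵥ (signedPauli (B.sign i) g *ᵥ (pauli p *ᵥ B.ket i j)) =
      commSign g p * commSign g (B.rep i j) * z := by
    have hc : signedPauli (B.sign i) g * pauli p =
        commSign g p • (pauli p * signedPauli (B.sign i) g) := by
      rw [signedPauli, Matrix.smul_mul, pauli_mul_comm_sign, Matrix.mul_smul, smul_comm]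
    rw [Matrix.mulVec_mulVec, hc, Matrix.smul_mulVec, ← Matrix.mulVec_mulVec,
      B.signedPauli_mulVec_ket i j hg, Matrix.mulVec_smul, dotProduct_smul, dotProduct_smul,
      smul_eq_mul, smul_eq_mul, ← hz]
    ring
  rw [h1] at h2
  have h3 := commSign_mul_self g (B.rep i l)
  have h4 : z = -z := by linear_combination (-z) * h3 + commSign g (B.rep i l) * h2 + z * hs
  simpa using self_eq_neg.1 h4

theorem rep_add_rep_mem_iff (i : Fin (2 ^ n + 1)) (j l : Fin (2 ^ n)) :
    B.rep i j + B.rep i l ∈ B.group i ↔ j = l := by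
  rw [← (B.rep_bijective i).1.eq_iff]
  simp only [QuotientAddGroup.eq, neg_string]

theorem ket_orthogonal (i : Fin (2 ^ n + 1)) {j l : Fin (2 ^ n)} (h : j ≠ l) :
    star (B.ket i l) ⬝ᵥ B.ket i j = 0 := by
  have := B.ket_pauli_ket_eq_zero i j l (p := 0) (by
    rwa [zero_add, rep_add_rep_mem_iff])
  rwa [pauli_zero, Matrix.one_mulVec] at this

/-- The expansion of a vector in one of the bases. -/
theorem sum_inner_smul_ket (i : Fin (2 ^ n + 1)) (v : Bits n → ℂ) :
    ∑ l, (star (B.ket i l) ⬝ᵥ v) • B.ket i l = v := by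
  conv_rhs => rw [← Matrix.one_mulVec v, ← B.sum_proj i, Matrix.sum_mulVec]
  refine Finset.sum_congr rfl fun l _ => ?_
  rw [Matrix.vecMulVec_mulVec]
  simp

theorem sum_norm_inner_sq (i : Fin (2 ^ n + 1)) (v : Bits n → ℂ) :
    ((∑ l, ‖star (B.ket i l) ⬝ᵥ v‖ ^ 2 : ℝ) : ℂ) = star v ⬝ᵥ v := by
  conv_rhs => rw [← B.sum_inner_smul_ket i v, B.sum_inner_smul_ket i v]
  conv_rhs => rhs; rw [← B.sum_inner_smul_ket i v]
  rw [dotProduct_sum]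
  push_cast
  refine Finset.sum_congr rfl fun l _ => ?_
  have : star v ⬝ᵥ B.ket i l = star (star (B.ket i l) ⬝ᵥ v) := by
    rw [Matrix.star_dotProduct]
  rw [dotProduct_smul, this, ← Complex.ofReal_pow, ← Complex.normSq_eq_norm_sq,
    Complex.normSq_eq_conj_mul_self]
  simp only [smul_eq_mul, Complex.star_def]
  ring

theorem pauli_mulVec_inner (p : PauliString n) (v : Bits n → ℂ) :
    star (pauli p *ᵥ v) ⬝ᵥ (pauli p *ᵥ v) = star v ⬝ᵥ v := by
  rw [Matrix.star_mulVec, pauli_conjTranspose, Matrix.dotProduct_mulVec, Matrix.vecMul_vecMul,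
    pauli_sq, Matrix.vecMul_one]

theorem related_iff (S : Finset (PauliString n)) (i : Fin (2 ^ n + 1)) (j l : Fin (2 ^ n)) :
    Related S (B.ket i j) (B.ket i l) ↔
      ∃ p ∈ insert 0 S, p + B.rep i j + B.rep i l ∈ B.group i := by
  constructor
  · rintro ⟨θ, p, hp, h⟩
    refine ⟨p, hp, ?_⟩
    by_contra hc
    have h0 := B.ket_pauli_ket_eq_zero i j l hc
    rw [h, dotProduct_smul, B.ket_unit, smul_eq_mul, mul_one] at h0
    exact Complex.exp_ne_zero _ h0
  · rintro ⟨p, hp, h⟩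
    set v := pauli p *ᵥ B.ket i j with hv
    set c := star (B.ket i l) ⬝ᵥ v with hc
    have hvc : v = c • B.ket i l := by
      conv_lhs => rw [← B.sum_inner_smul_ket i v]
      refine Finset.sum_eq_single l (fun l' _ hl' => ?_) (by simp)
      rw [B.ket_pauli_ket_eq_zero i j l', zero_smul]
      intro h'
      apply hl'
      rw [← B.rep_add_rep_mem_iff i]
      have := add_mem h h'
      have e : p + B.rep i j + B.rep i l + (p + B.rep i j + B.rep i l') =
          B.rep i l' + B.rep i l + (p + p) + (B.rep i j + B.rep i j) := by abel
      rwa [e, add_self_string, add_self_string, add_zero, add_zero] at this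
    have hc1 : ‖c‖ = 1 := by
      have h1 := pauli_mulVec_inner p (B.ket i j)
      rw [← hv, B.ket_unit, hvc, star_smul, smul_dotProduct, dotProduct_smul, B.ket_unit] at h1
      simp only [smul_eq_mul, mul_one, Complex.star_def] at h1
      rw [← Complex.normSq_eq_conj_mul_self, Complex.normSq_eq_norm_sq] at h1
      have h2 : ‖c‖ ^ 2 = 1 := by exact_mod_cast h1
      nlinarith [norm_nonneg c]
    refine ⟨c.arg, p, hp, ?_⟩
    rw [← hv, hvc]
    congr 1
    conv_lhs => rw [← Complex.norm_mul_exp_arg_mul_I c, hc1]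
    rw [mul_comm Complex.I]
    simp

end StabilizerMUB

/-! ### The probability that one experiment finds a violation -/

section Violation

variable {n : ℕ} (B : StabilizerMUB n)

open Classical in
/-- The Pauli strings whose coset modulo `G_i` does not meet `S ∪ {I}`. -/
noncomputable def farStrings (S : Finset (PauliString n)) (i : Fin (2 ^ n + 1)) :
    Finset (PauliString n) :=
  Finset.univ.filter fun p => ∀ s ∈ insert 0 S, p + s ∉ B.group i

theorem mem_farStrings {S : Finset (PauliString n)} {i : Fin (2 ^ n + 1)} {p : PauliString n} :
    p ∈ farStrings B S i ↔ ∀ s ∈ insert 0 S, p + s ∉ B.group i := by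
  simp [farStrings]

theorem inner_mulVec_self_eq_trace (A : QMat n) (v : Bits n → ℂ) :
    star (A *ᵥ v) ⬝ᵥ (A *ᵥ v) = (Aᴴ * A * Matrix.vecMulVec v (star v)).trace := by
  rw [Matrix.mul_vecMulVec, Matrix.trace_vecMulVec, ← Matrix.mulVec_mulVec, Matrix.star_mulVec,
    ← Matrix.dotProduct_mulVec, dotProduct_comm _ (star v)]

theorem sum_mulVec_ket (i : Fin (2 ^ n + 1)) (A : QMat n) :
    ∑ j, star (A *ᵥ B.ket i j) ⬝ᵥ (A *ᵥ B.ket i j) = (Aᴴ * A).trace := by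
  simp only [inner_mulVec_self_eq_trace]
  rw [← Matrix.trace_sum, ← Finset.mul_sum, B.sum_proj, mul_one]

theorem inner_mulVec_eq_sum (A : QMat n) (V : Finset (PauliString n)) (c : PauliString n → ℂ)
    (hA : A = ∑ p ∈ V, c p • pauli p) (v w : Bits n → ℂ) :
    star w ⬝ᵥ (A *ᵥ v) = ∑ p ∈ V, c p * (star w ⬝ᵥ (pauli p *ᵥ v)) := by
  rw [hA, Matrix.sum_mulVec, dotProduct_sum]
  refine Finset.sum_congr rfl fun p _ => ?_
  rw [Matrix.smul_mulVec, dotProduct_smul, smul_eq_mul]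

open Classical in
/-- In the `i`-th basis, the violations carry the weight of the Pauli coefficients in
`farStrings`: between unrelated basis vectors only these coefficients contribute, and between
related ones they do not contribute at all. -/
theorem sum_violation (S : Finset (PauliString n)) (i : Fin (2 ^ n + 1)) (A : QMat n) :
    ∑ j, ∑ l, (if Related S (B.ket i j) (B.ket i l) then 0
      else ‖star (B.ket i l) ⬝ᵥ (A *ᵥ B.ket i j)‖ ^ 2) =
      2 ^ n * ∑ p ∈ farStrings B S i, ‖coeff A p‖ ^ 2 := by
  set V := farStrings B S i with hV
  set AV := ∑ p ∈ V, coeff A p • pauli p with hAV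
  have key : ∀ j l, (if Related S (B.ket i j) (B.ket i l) then 0
      else ‖star (B.ket i l) ⬝ᵥ (A *ᵥ B.ket i j)‖ ^ 2) =
      ‖star (B.ket i l) ⬝ᵥ (AV *ᵥ B.ket i j)‖ ^ 2 := by
    intro j l
    rw [inner_mulVec_eq_sum AV V (coeff A) hAV,
      inner_mulVec_eq_sum A Finset.univ (coeff A) (sum_coeff_smul_pauli A).symm]
    split_ifs with hrel
    · obtain ⟨s, hs, hsG⟩ := (B.related_iff S i j l).1 hrel
      rw [Finset.sum_eq_zero]
      · simp
      · intro p hp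
        rw [B.ket_pauli_ket_eq_zero i j l, mul_zero]
        intro hpG
        refine (mem_farStrings B).1 hp s hs ?_
        have := add_mem hpG hsG
        have e : p + B.rep i j + B.rep i l + (s + B.rep i j + B.rep i l) =
            p + s + (B.rep i j + B.rep i j) + (B.rep i l + B.rep i l) := by abel
        rwa [e, add_self_string, add_self_string, add_zero, add_zero] at this
    · rw [← Finset.sum_subset (Finset.subset_univ V)]
      intro p _ hp
      rw [B.ket_pauli_ket_eq_zero i j l, mul_zero]
      intro hpG
      rw [hV, mem_farStrings] at hp
      push Not at hp
      obtain ⟨s, hs, hsG⟩ := hp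
      refine hrel ((B.related_iff S i j l).2 ⟨s, hs, ?_⟩)
      have := add_mem hpG hsG
      have e : p + B.rep i j + B.rep i l + (p + s) =
          s + B.rep i j + B.rep i l + (p + p) := by abel
      rwa [e, add_self_string, add_zero] at this
  simp only [key]
  have h : ((∑ j, ∑ l, ‖star (B.ket i l) ⬝ᵥ (AV *ᵥ B.ket i j)‖ ^ 2 : ℝ) : ℂ) =
      ((2 ^ n * ∑ p ∈ V, ‖coeff A p‖ ^ 2 : ℝ) : ℂ) := by
    rw [Complex.ofReal_sum]
    simp only [B.sum_norm_inner_sq]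
    rw [sum_mulVec_ket, hAV, trace_conjTranspose_mul_sum_pauli]
  exact_mod_cast h

/-- The probability that one experiment finds a violation, in terms of the Pauli coefficients of
the time evolution. -/
noncomputable def violationProb (S : Finset (PauliString n)) (H : Hamiltonian n) (t : ℝ) : ℝ :=
  (2 ^ n + 1 : ℝ)⁻¹ *
    ∑ i, ∑ p ∈ farStrings B S i, ‖coeff (evolution H t) p‖ ^ 2

theorem violationProb_nonneg (S : Finset (PauliString n)) (H : Hamiltonian n) (t : ℝ) :
    0 ≤ violationProb B S H t := by
  unfold violationProb
  positivity

theorem tsum_bind_mul {α β : Type*} (p : PMF α) (g : α → PMF β) (f : β → ℝ≥0∞) :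
    ∑' b, (p.bind g) b * f b = ∑' a, p a * ∑' b, g a b * f b := by
  simp only [PMF.bind_apply, ← ENNReal.tsum_mul_right, ← ENNReal.tsum_mul_left]
  rw [ENNReal.tsum_comm]
  simp only [mul_assoc]

theorem tsum_map_mul {α β : Type*} (p : PMF α) (g : α → β) (f : β → ℝ≥0∞) :
    ∑' b, (p.map g) b * f b = ∑' a, p a * f (g a) := by
  rw [← PMF.bind_pure_comp, tsum_bind_mul]
  refine tsum_congr fun a => ?_
  rw [tsum_eq_single (g a)]
  · simp
  · intro b hb
    simp [hb]

theorem tsum_experiment_mul (H : Hamiltonian n) (t : ℝ) (f : Round n → ℝ≥0∞) :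
    ∑' r, experiment B H t r * f r =
      ∑ i, (2 ^ n + 1 : ℝ≥0∞)⁻¹ * ∑ j, (2 ^ n : ℝ≥0∞)⁻¹ *
        ∑ l, ENNReal.ofReal (bornWeight B H t i j l) * f ⟨i, j, l⟩ := by
  rw [experiment, tsum_bind_mul, tsum_fintype]
  refine Finset.sum_congr rfl fun i _ => ?_
  rw [PMF.uniformOfFintype_apply, tsum_bind_mul, tsum_fintype]
  congr 1
  · simp
  refine Finset.sum_congr rfl fun j _ => ?_
  rw [PMF.uniformOfFintype_apply, tsum_map_mul, tsum_fintype]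
  congr 1
  · simp

open Classical in
theorem tsum_experiment_violation (S : Finset (PauliString n)) (H : Hamiltonian n) (t : ℝ) :
    ∑' r, experiment B H t r * (if r.Passes B S then 0 else 1) =
      ENNReal.ofReal (violationProb B S H t) := by
  rw [tsum_experiment_mul]
  have e1 : (2 ^ n + 1 : ℝ≥0∞)⁻¹ = ENNReal.ofReal (2 ^ n + 1 : ℝ)⁻¹ := by
    rw [ENNReal.ofReal_inv_of_pos (by positivity), ENNReal.ofReal_add (by positivity) zero_le_one,
      ENNReal.ofReal_pow (by norm_num)]
    simp
  have e2 : (2 ^ n : ℝ≥0∞)⁻¹ = ENNReal.ofReal (2 ^ n : ℝ)⁻¹ := by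
    rw [ENNReal.ofReal_inv_of_pos (by positivity), ENNReal.ofReal_pow (by norm_num)]
    simp
  have e3 : ∀ i j l, ENNReal.ofReal (bornWeight B H t i j l) *
      (if Round.Passes ⟨i, j, l⟩ B S then 0 else 1) =
      ENNReal.ofReal (if Related S (B.ket i j) (B.ket i l) then 0
        else ‖star (B.ket i l) ⬝ᵥ (evolution H t *ᵥ B.ket i j)‖ ^ 2) := by
    intro i j l
    unfold Round.Passes bornWeight
    dsimp only
    split_ifs <;> simp
  simp only [e1, e2, e3]
  have pos : ∀ i j l, 0 ≤ (if Related S (B.ket i j) (B.ket i l) then 0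
        else ‖star (B.ket i l) ⬝ᵥ (evolution H t *ᵥ B.ket i j)‖ ^ 2) := by
    intro i j l
    split_ifs <;> positivity
  have h : violationProb B S H t = ∑ i, (2 ^ n + 1 : ℝ)⁻¹ * ∑ j, (2 ^ n : ℝ)⁻¹ *
      ∑ l, (if Related S (B.ket i j) (B.ket i l) then 0
        else ‖star (B.ket i l) ⬝ᵥ (evolution H t *ᵥ B.ket i j)‖ ^ 2) := by
    simp only [← Finset.mul_sum, sum_violation]
    rw [violationProb, inv_mul_cancel_left₀ (by positivity)]
  have pos' : ∀ i j, 0 ≤ (2 ^ n : ℝ)⁻¹ *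
      ∑ l, (if Related S (B.ket i j) (B.ket i l) then 0
        else ‖star (B.ket i l) ⬝ᵥ (evolution H t *ᵥ B.ket i j)‖ ^ 2) := fun i j =>
    mul_nonneg (by positivity) (Finset.sum_nonneg fun l _ => pos i j l)
  rw [h, ENNReal.ofReal_sum_of_nonneg fun i _ =>
    mul_nonneg (by positivity) (Finset.sum_nonneg fun j _ => pos' i j)]
  refine Finset.sum_congr rfl fun i _ => ?_
  rw [ENNReal.ofReal_mul (by positivity), ENNReal.ofReal_sum_of_nonneg fun j _ => pos' i j]
  congr 1
  refine Finset.sum_congr rfl fun j _ => ?_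
  rw [ENNReal.ofReal_mul (by positivity), ENNReal.ofReal_sum_of_nonneg fun l _ => pos i j l]

open Classical in
theorem tsum_experiment_passes (S : Finset (PauliString n)) (H : Hamiltonian n) (t : ℝ) :
    ∑' r, experiment B H t r * (if r.Passes B S then 1 else 0) =
      ENNReal.ofReal (1 - violationProb B S H t) := by
  have h : ∑' r, experiment B H t r * (if r.Passes B S then 1 else 0) +
      ENNReal.ofReal (violationProb B S H t) = 1 := by
    rw [← tsum_experiment_violation, ← ENNReal.tsum_add, ← (experiment B H t).tsum_coe]
    refine tsum_congr fun r => ?_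
    split_ifs <;> simp
  rw [ENNReal.ofReal_sub _ (violationProb_nonneg B S H t), ENNReal.ofReal_one]
  exact ENNReal.eq_sub_of_add_eq ENNReal.ofReal_ne_top h

theorem violationProb_le_one (S : Finset (PauliString n)) (H : Hamiltonian n) (t : ℝ) :
    violationProb B S H t ≤ 1 := by
  classical
  have h : ENNReal.ofReal (violationProb B S H t) ≤ 1 := by
    rw [← tsum_experiment_violation, ← (experiment B H t).tsum_coe]
    refine ENNReal.tsum_le_tsum fun r => ?_
    split_ifs <;> simp
  simpa using h

/-! ### The verdict of the tester -/

theorem testerLoop_null (S : Finset (PauliString n)) (H : Hamiltonian n) (t : ℝ) (N : ℕ) :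
    (testerLoop B S H t N).map Run.verdict Verdict.null =
      ENNReal.ofReal ((1 - violationProb B S H t) ^ N) := by
  classical
  induction N with
  | zero => simp [testerLoop, PMF.pure_map]
  | succ N ih =>
    rw [testerLoop, PMF.map_bind, PMF.bind_apply]
    have : ∀ r : Round n, (PMF.map Run.verdict (if r.Passes B S then
        (testerLoop B S H t N).map fun o : Run n => ⟨o.verdict, r :: o.rounds⟩
        else PMF.pure ⟨Verdict.alt, [r]⟩)) Verdict.null =
        (if r.Passes B S then 1 else 0) *
          ENNReal.ofReal ((1 - violationProb B S H t) ^ N) := by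
      intro r
      split_ifs
      · rw [PMF.map_comp, one_mul, ← ih]
        rfl
      · simp [PMF.pure_map]
    simp only [this, ← mul_assoc]
    rw [ENNReal.tsum_mul_right, tsum_experiment_passes, pow_succ',
      ENNReal.ofReal_mul (by linarith [violationProb_le_one B S H t])]

theorem pmf_verdict_alt (p : PMF Verdict) : p Verdict.alt = 1 - p Verdict.null := by
  have h := p.tsum_coe
  have : ∀ f : Verdict → ℝ≥0∞, ∑' v, f v = f Verdict.null + f Verdict.alt := by
    intro f
    rw [tsum_eq_sum (s := ⟨{Verdict.null, Verdict.alt}, by simp⟩)]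
    · simp [Finset.sum]
    · intro v hv
      cases v <;> simp at hv
  rw [this] at h
  rw [← h, ENNReal.add_sub_cancel_left (PMF.apply_ne_top _ _)]

theorem length_rounds_le (S : Finset (PauliString n)) (H : Hamiltonian n) (t : ℝ) (N : ℕ) :
    ∀ o ∈ (testerLoop B S H t N).support, o.rounds.length ≤ N := by
  classical
  induction N with
  | zero =>
    intro o ho
    simp only [testerLoop, PMF.support_pure, Set.mem_singleton_iff] at ho
    simp [ho]
  | succ N ih =>
    intro o ho
    rw [testerLoop, PMF.mem_support_bind_iff] at ho
    obtain ⟨r, -, hr⟩ := ho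
    split_ifs at hr
    · rw [PMF.mem_support_map_iff] at hr
      obtain ⟨o', ho', rfl⟩ := hr
      simpa using ih o' ho'
    · simp only [PMF.support_pure, Set.mem_singleton_iff] at hr
      simp [hr]

end Violation

/-! ### The first-order expansion of the time evolution -/

section Evolution

theorem norm_exp_sub_one_sub_self_le {A : Type*} [NormedRing A] [NormedAlgebra ℂ A]
    [CompleteSpace A] {x : A} (hx : ‖x‖ ≤ 1) : ‖NormedSpace.exp x - 1 - x‖ ≤ ‖x‖ ^ 2 := by
  have h1 : HasSum (fun k : ℕ => (((k + 2).factorial : ℂ)⁻¹) • x ^ (k + 2))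
      (NormedSpace.exp x - 1 - x) := by
    have h := (hasSum_nat_add_iff' 2).2 (NormedSpace.exp_series_hasSum_exp' (𝕂 := ℂ) x)
    simpa [Finset.sum_range_succ, sub_sub] using h
  have h2 : HasSum (fun k : ℕ => (((k + 2).factorial : ℝ)⁻¹) • ‖x‖ ^ (k + 2))
      (Real.exp ‖x‖ - 1 - ‖x‖) := by
    have h := (hasSum_nat_add_iff' 2).2 (NormedSpace.exp_series_hasSum_exp' (𝕂 := ℝ) ‖x‖)
    rw [← Real.exp_eq_exp_ℝ] at h
    simpa [Finset.sum_range_succ, sub_sub] using h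
  have h3 : ‖NormedSpace.exp x - 1 - x‖ ≤ Real.exp ‖x‖ - 1 - ‖x‖ := by
    rw [← h1.tsum_eq]
    refine tsum_of_norm_bounded h2 fun k => ?_
    rw [norm_smul, norm_inv, Complex.norm_natCast, smul_eq_mul]
    exact mul_le_mul_of_nonneg_left (norm_pow_le' x (by omega)) (by positivity)
  have h4 := Real.abs_exp_sub_one_sub_id_le (x := ‖x‖) (by rwa [abs_norm])
  exact h3.trans ((le_abs_self _).trans h4)

variable {n : ℕ}

theorem opNorm_evolution_sub_le (H : Hamiltonian n) (hH : opNorm (H : QMat n) ≤ 1) {t : ℝ}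
    (ht0 : 0 ≤ t) (ht1 : t ≤ 1) :
    opNorm (evolution H t - 1 - (-(Complex.I * (t : ℂ))) • (H : QMat n)) ≤ t ^ 2 := by
  open scoped Matrix.Norms.L2Operator in
  have hn : ∀ A : QMat n, opNorm A = ‖A‖ := fun A => rfl
  rw [hn] at hH ⊢
  have hx : ‖(-(Complex.I * (t : ℂ))) • (H : QMat n)‖ ≤ t := by
    rw [norm_smul, norm_neg, norm_mul, Complex.norm_I, one_mul, Complex.norm_real,
      Real.norm_of_nonneg ht0]
    exact mul_le_of_le_one_right ht0 hH
  exact (norm_exp_sub_one_sub_self_le (hx.trans ht1)).trans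
    (pow_le_pow_left₀ (norm_nonneg _) hx 2)

theorem sum_norm_coeff_sq_le (A : QMat n) : ∑ p, ‖coeff A p‖ ^ 2 ≤ opNorm A ^ 2 := by
  have h1 : (Aᴴ * A).trace = ((∑ x, ∑ y, ‖A y x‖ ^ 2 : ℝ) : ℂ) := by
    simp only [Matrix.trace, Matrix.diag_apply, Matrix.mul_apply, Matrix.conjTranspose_apply]
    push_cast
    refine Finset.sum_congr rfl fun x _ => Finset.sum_congr rfl fun y _ => ?_
    rw [← Complex.ofReal_pow, ← Complex.normSq_eq_norm_sq, Complex.normSq_eq_conj_mul_self]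
    rfl
  rw [trace_conjTranspose_mul_self] at h1
  have h2 : (2 ^ n * ∑ p, ‖coeff A p‖ ^ 2 : ℝ) = ∑ x, ∑ y, ‖A y x‖ ^ 2 := by exact_mod_cast h1
  have h3 : ∀ x, ∑ y, ‖A y x‖ ^ 2 ≤ opNorm A ^ 2 := by
    intro x
    have h := (Matrix.toEuclideanCLM (𝕜 := ℂ) A).le_opNorm (EuclideanSpace.single x 1)
    rw [PiLp.norm_single, norm_one, mul_one] at h
    have e : ‖Matrix.toEuclideanCLM (𝕜 := ℂ) A (EuclideanSpace.single x 1)‖ ^ 2 =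
        ∑ y, ‖A y x‖ ^ 2 := by
      rw [EuclideanSpace.norm_sq_eq]
      refine Finset.sum_congr rfl fun y _ => ?_
      rw [Matrix.ofLp_toEuclideanCLM]
      simp
    rw [← e]
    exact pow_le_pow_left₀ (norm_nonneg _) h 2
  have h4 : (2 ^ n * ∑ p, ‖coeff A p‖ ^ 2 : ℝ) ≤ 2 ^ n * opNorm A ^ 2 := by
    rw [h2]
    refine (Finset.sum_le_sum fun x _ => h3 x).trans_eq ?_
    simp
  exact le_of_mul_le_mul_left h4 (by positivity)

/-- Apart from the identity, the Pauli coefficients of the evolution are those of `-itH`, up to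
an error of size `t ^ 2` in the `ℓ²` norm. -/
theorem exists_coeff_evolution (H : Hamiltonian n) (hH : opNorm (H : QMat n) ≤ 1) {t : ℝ}
    (ht0 : 0 ≤ t) (ht1 : t ≤ 1) :
    ∃ ρ : PauliString n → ℂ, ∑ p, ‖ρ p‖ ^ 2 ≤ t ^ 4 ∧
      ∀ p, p ≠ 0 → coeff (evolution H t) p =
        -(Complex.I * (t : ℂ)) * coeff (H : QMat n) p + ρ p := by
  refine ⟨coeff (evolution H t - 1 - (-(Complex.I * (t : ℂ))) • (H : QMat n)), ?_, ?_⟩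
  · refine (sum_norm_coeff_sq_le _).trans ?_
    refine (pow_le_pow_left₀ (norm_nonneg _) (opNorm_evolution_sub_le H hH ht0 ht1) 2).trans_eq ?_
    ring
  · intro p hp
    rw [coeff_sub, coeff_sub, coeff_one hp, coeff_smul]
    ring

end Evolution

/-! ### Bounds on the probability of a violation -/

section Bounds

variable {n : ℕ} (B : StabilizerMUB n)

theorem farStrings_subset (S : Finset (PauliString n)) (i : Fin (2 ^ n + 1)) :
    farStrings B S i ⊆ (insert 0 S)ᶜ := by
  intro p hp
  rw [Finset.mem_compl]
  intro hpS
  refine (mem_farStrings B).1 hp p hpS ?_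
  rw [add_self_string]
  exact zero_mem _

theorem violationProb_le (S : Finset (PauliString n)) (H : Hamiltonian n)
    (hH : opNorm (H : QMat n) ≤ 1) (hS : HasProperty S H) {t : ℝ} (ht0 : 0 ≤ t) (ht1 : t ≤ 1) :
    violationProb B S H t ≤ t ^ 4 := by
  obtain ⟨ρ, hρ, hu⟩ := exists_coeff_evolution H hH ht0 ht1
  have h : ∀ i, ∑ p ∈ farStrings B S i, ‖coeff (evolution H t) p‖ ^ 2 ≤ t ^ 4 := by
    intro i
    refine le_trans ?_ hρ
    have : ∀ p ∈ farStrings B S i, ‖coeff (evolution H t) p‖ ^ 2 = ‖ρ p‖ ^ 2 := by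
      intro p hp
      have hp' := farStrings_subset B S i hp
      rw [Finset.mem_compl, Finset.mem_insert, not_or] at hp'
      have h0 : coeff (H : QMat n) p = 0 := hS p hp'.2
      rw [hu p hp'.1, h0, mul_zero, zero_add]
    rw [Finset.sum_congr rfl this]
    exact Finset.sum_le_sum_of_subset_of_nonneg (Finset.subset_univ _) fun _ _ _ => by positivity
  unfold violationProb
  rw [inv_mul_le_iff₀ (by positivity)]
  refine (Finset.sum_le_sum fun i _ => h i).trans_eq ?_
  simp

/-- A far Hamiltonian has large Pauli coefficients outside `S`: otherwise its restriction to the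
coefficients in `S` would be close to it. -/
theorem le_sum_coeff_of_isFar (S : Finset (PauliString n)) {ε : ℝ} (hε : 0 < ε)
    (H : Hamiltonian n) (hfar : IsFar S ε H) : ε ^ 2 ≤ ∑ p ∈ Sᶜ, ‖coeff (H : QMat n) p‖ ^ 2 := by
  have hK : (∑ p ∈ S, coeff (H : QMat n) p • pauli p) ∈ selfAdjoint (QMat n) := by
    rw [selfAdjoint.mem_iff, Matrix.star_eq_conjTranspose, Matrix.conjTranspose_sum]
    refine Finset.sum_congr rfl fun p _ => ?_
    rw [Matrix.conjTranspose_smul, pauli_conjTranspose, coeff_isSelfAdjoint]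
  have h := hfar ⟨_, hK⟩ (by
    intro p hp
    change coeff (∑ p ∈ S, coeff (H : QMat n) p • pauli p) p = 0
    rw [coeff_sum_smul_pauli, if_neg hp])
  have h2 : (0 : ℝ) < 2 ^ n := by positivity
  rw [frobNorm, trace_conjTranspose_mul_self, Complex.ofReal_re,
    Real.sqrt_mul (by positivity), ← mul_assoc, one_div,
    inv_mul_cancel₀ (Real.sqrt_ne_zero'.2 h2), one_mul, Real.le_sqrt' hε] at h
  refine h.trans_eq ?_
  simp only [coeff_sub, coeff_sum_smul_pauli]
  rw [← Finset.sum_add_sum_compl S, Finset.sum_eq_zero, zero_add]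
  · refine Finset.sum_congr rfl fun p hp => ?_
    rw [if_neg (Finset.mem_compl.1 hp), sub_zero]
  · intro p hp
    simp [hp]

/-- A Pauli string outside `S ∪ {I}` differs from each of its elements by an element of exactly
one of the groups, hence it can be missed in at most `|S ∪ {I}|` of the bases. -/
theorem card_not_mem_farStrings_le (S : Finset (PauliString n)) {p : PauliString n}
    (hp : p ∉ insert 0 S) :
    (Finset.univ.filter fun i => p ∉ farStrings B S i).card ≤ (insert 0 S).card := by
  have h : ∀ i, p ∉ farStrings B S i → ∃ s ∈ insert 0 S, p + s ∈ B.group i := by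
    intro i hi
    rw [mem_farStrings] at hi
    push Not at hi
    exact hi
  choose! f hf hfG using h
  refine Finset.card_le_card_of_injOn f (fun i hi => hf i (by simpa using hi)) ?_
  intro i hi i' hi' heq
  by_contra hne
  have h1 := hfG i (by simpa using hi)
  have h2 := hfG i' (by simpa using hi')
  rw [← heq] at h2
  have h3 : p + f i ∈ B.group i ⊓ B.group i' := ⟨h1, h2⟩
  rw [B.inter_group i i' hne, AddSubgroup.mem_bot] at h3
  apply hp
  rw [eq_neg_of_add_eq_zero_left h3, neg_string]
  exact hf i (by simpa using hi)

theorem le_violationProb (S : Finset (PauliString n)) (H : Hamiltonian n) (t : ℝ) :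
    (1 - (insert 0 S).card / (2 ^ n + 1)) *
      ∑ p ∈ (insert 0 S)ᶜ, ‖coeff (evolution H t) p‖ ^ 2 ≤ violationProb B S H t := by
  have h1 : ∑ i, ∑ p ∈ farStrings B S i, ‖coeff (evolution H t) p‖ ^ 2 =
      ∑ p ∈ (insert 0 S)ᶜ, ((Finset.univ.filter fun i => p ∈ farStrings B S i).card : ℝ) *
        ‖coeff (evolution H t) p‖ ^ 2 := by
    have : ∀ i, ∑ p ∈ farStrings B S i, ‖coeff (evolution H t) p‖ ^ 2 =
        ∑ p ∈ (insert 0 S)ᶜ, if p ∈ farStrings B S i then ‖coeff (evolution H t) p‖ ^ 2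
          else 0 := by
      intro i
      rw [← Finset.sum_filter, Finset.filter_mem_eq_inter,
        Finset.inter_eq_right.2 (farStrings_subset B S i)]
    simp only [this]
    rw [Finset.sum_comm]
    refine Finset.sum_congr rfl fun p _ => ?_
    rw [← Finset.sum_filter, Finset.sum_const, nsmul_eq_mul]
  rw [violationProb, h1, ← div_eq_inv_mul, le_div_iff₀ (by positivity), Finset.mul_sum,
    Finset.sum_mul]
  refine Finset.sum_le_sum fun p hp => ?_
  have h2 := card_not_mem_farStrings_le B S (Finset.mem_compl.1 hp)
  have h3 := Finset.card_filter_add_card_filter_not (s := (Finset.univ : Finset (Fin (2 ^ n + 1))))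
    (fun i => p ∈ farStrings B S i)
  rw [Finset.card_univ, Fintype.card_fin] at h3
  have h4 : (2 ^ n + 1 : ℝ) - (insert 0 S).card ≤
      ((Finset.univ.filter fun i => p ∈ farStrings B S i).card : ℝ) := by
    rw [sub_le_iff_le_add]
    have : 2 ^ n + 1 ≤
        (Finset.univ.filter fun i => p ∈ farStrings B S i).card + (insert 0 S).card := by
      omega
    exact_mod_cast this
  have h5 : (1 - ((insert 0 S).card : ℝ) / (2 ^ n + 1)) * ‖coeff (evolution H t) p‖ ^ 2 *
      (2 ^ n + 1) = ((2 ^ n + 1 : ℝ) - (insert 0 S).card) * ‖coeff (evolution H t) p‖ ^ 2 := by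
    field_simp
  rw [h5]
  exact mul_le_mul_of_nonneg_right h4 (by positivity)

theorem le_violationProb_of_isFar (S : Finset (PauliString n)) {ε : ℝ} (hε : 0 < ε) (hε1 : ε < 1)
    (hcard : ((insert 0 S).card : ℝ) ≤ (2 ^ n + 1) * ε ^ 4 / 144) (H : Hamiltonian n)
    (htr : (H : QMat n).trace = 0) (hH : opNorm (H : QMat n) ≤ 1) (hfar : IsFar S ε H) :
    evolTime ε ^ 2 * ε ^ 2 / 2 ≤ violationProb B S H (evolTime ε) := by
  set t := evolTime ε with ht
  have ht0 : 0 ≤ t := by rw [ht, evolTime]; positivity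
  have ht1 : t ≤ 1 := by rw [ht, evolTime]; linarith
  obtain ⟨ρ, hρ, hu⟩ := exists_coeff_evolution H hH ht0 ht1
  have hα : ε ^ 2 ≤ ∑ p ∈ (insert 0 S)ᶜ, ‖coeff (H : QMat n) p‖ ^ 2 := by
    refine (le_sum_coeff_of_isFar S hε H hfar).trans_eq (Finset.sum_subset ?_ ?_).symm
    · exact Finset.compl_subset_compl.2 (Finset.subset_insert _ _)
    · intro p hp hp'
      rw [Finset.mem_compl] at hp
      rw [Finset.mem_compl, not_not, Finset.mem_insert] at hp'
      rw [hp'.resolve_right hp, coeff, pauli_zero, mul_one, htr]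
      simp
  -- termwise, `|a + b|² ≥ 5/6 |a|² - 5 |b|²`
  have hsum : 5 / 6 * (t ^ 2 * ε ^ 2) - 5 * t ^ 4 ≤
      ∑ p ∈ (insert 0 S)ᶜ, ‖coeff (evolution H t) p‖ ^ 2 := by
    have h1 : ∀ p ∈ (insert 0 S)ᶜ, 5 / 6 * t ^ 2 * ‖coeff (H : QMat n) p‖ ^ 2 - 5 * ‖ρ p‖ ^ 2 ≤
        ‖coeff (evolution H t) p‖ ^ 2 := by
      intro p hp
      have hp0 : p ≠ 0 := by
        rintro rfl
        simp at hp
      rw [hu p hp0]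
      set a := -(Complex.I * (t : ℂ)) * coeff (H : QMat n) p with ha
      have hna : ‖a‖ = t * ‖coeff (H : QMat n) p‖ := by
        rw [ha, norm_mul, norm_neg, norm_mul, Complex.norm_I, one_mul, Complex.norm_real,
          Real.norm_of_nonneg ht0]
      have h2 : ‖a‖ ≤ ‖a + ρ p‖ + ‖ρ p‖ := by
        simpa using norm_sub_le (a + ρ p) (ρ p)
      have h3 : 5 / 6 * ‖a‖ ^ 2 - 5 * ‖ρ p‖ ^ 2 ≤ ‖a + ρ p‖ ^ 2 := by
        have h4 : ‖a‖ ^ 2 ≤ (‖a + ρ p‖ + ‖ρ p‖) ^ 2 := pow_le_pow_left₀ (norm_nonneg _) h2 2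
        nlinarith [sq_nonneg (‖a + ρ p‖ - 5 * ‖ρ p‖)]
      rw [hna] at h3
      linarith
    have h2 := Finset.sum_le_sum h1
    rw [Finset.sum_sub_distrib, ← Finset.mul_sum, ← Finset.mul_sum] at h2
    have h3 : ∑ p ∈ (insert 0 S)ᶜ, ‖ρ p‖ ^ 2 ≤ t ^ 4 :=
      le_trans (Finset.sum_le_sum_of_subset_of_nonneg (Finset.subset_univ _)
        fun _ _ _ => by positivity) hρ
    have h4 := mul_le_mul_of_nonneg_left hα (show 0 ≤ 5 / 6 * t ^ 2 by positivity)
    linarith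
  have hfrac : 143 / 144 ≤ 1 - ((insert 0 S).card : ℝ) / (2 ^ n + 1) := by
    have : ((insert 0 S).card : ℝ) / (2 ^ n + 1) ≤ 1 / 144 := by
      rw [div_le_iff₀ (by positivity)]
      have h4 : ε ^ 4 ≤ 1 := pow_le_one₀ hε.le hε1.le
      have h5 : (2 ^ n + 1 : ℝ) * ε ^ 4 ≤ (2 ^ n + 1) * 1 :=
        mul_le_mul_of_nonneg_left h4 (by positivity)
      linarith
    linarith
  refine le_trans ?_ (le_violationProb B S H t)
  have h6 : 25 / 36 * (t ^ 2 * ε ^ 2) = 5 / 6 * (t ^ 2 * ε ^ 2) - 5 * t ^ 4 := by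
    rw [ht, evolTime]
    ring
  rw [← h6] at hsum
  have h7 : 0 ≤ t ^ 2 * ε ^ 2 := by positivity
  calc t ^ 2 * ε ^ 2 / 2 ≤ 143 / 144 * (25 / 36 * (t ^ 2 * ε ^ 2)) := by linarith
    _ ≤ _ := mul_le_mul hfrac hsum (by positivity) (by linarith)

/-- The number of experiments. -/
noncomputable def numRounds (ε : ℝ) : ℕ := ⌈2 * Real.log 3 / (evolTime ε ^ 2 * ε ^ 2)⌉₊

theorem log_three_le : Real.log 3 ≤ 2 := by
  have := Real.log_le_sub_one_of_pos (show (0 : ℝ) < 3 by norm_num)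
  linarith

theorem numRounds_le {ε : ℝ} (hε : 0 < ε) (hε1 : ε < 1) : (numRounds ε : ℝ) ≤ 145 / ε ^ 4 := by
  have hlog : 0 ≤ Real.log 3 := Real.log_nonneg (by norm_num)
  -- the argument of the ceiling is `72 log 3 / ε ^ 4 ≤ 144 / ε ^ 4`
  have h := Nat.ceil_lt_add_one (a := 2 * Real.log 3 / (evolTime ε ^ 2 * ε ^ 2)) (by positivity)
  have h1 : 2 * Real.log 3 / (evolTime ε ^ 2 * ε ^ 2) ≤ 144 / ε ^ 4 := by
    have e : 2 * Real.log 3 / (evolTime ε ^ 2 * ε ^ 2) = 72 * Real.log 3 / ε ^ 4 := by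
      rw [evolTime]
      field_simp
      norm_num
    rw [e]
    exact div_le_div_of_nonneg_right (by linarith [log_three_le]) (by positivity)
  have h2 : 1 ≤ 1 / ε ^ 4 := by
    rw [le_div_iff₀ (by positivity), one_mul]
    exact pow_le_one₀ hε.le hε1.le
  have h3 : 145 / ε ^ 4 = 144 / ε ^ 4 + 1 / ε ^ 4 := by rw [← add_div]; norm_num
  rw [h3]
  exact h.le.trans (add_le_add h1 h2)

theorem verdictProb_null (S : Finset (PauliString n)) (ε : ℝ) (H : Hamiltonian n) :
    verdictProb B S ε H Verdict.null =
      ENNReal.ofReal ((1 - violationProb B S H (evolTime ε)) ^ numRounds ε) :=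
  testerLoop_null B S H _ _

theorem ofReal_two_thirds : ENNReal.ofReal (2 / 3) = 2 / 3 := by
  rw [ENNReal.ofReal_div_of_pos (by norm_num)]
  simp

theorem two_thirds_le_null (S : Finset (PauliString n)) {ε : ℝ} (hε : 0 < ε) (hε1 : ε < 1)
    (H : Hamiltonian n) (hH : opNorm (H : QMat n) ≤ 1) (hS : HasProperty S H) :
    2 / 3 ≤ verdictProb B S ε H Verdict.null := by
  set t := evolTime ε with ht
  have ht0 : 0 ≤ t := by rw [ht, evolTime]; positivity
  have ht1 : t ≤ 1 := by rw [ht, evolTime]; linarith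
  have hF := violationProb_le B S H hH hS ht0 ht1
  have hF0 := violationProb_nonneg B S H t
  rw [verdictProb_null, ← ofReal_two_thirds]
  refine ENNReal.ofReal_le_ofReal ?_
  -- Bernoulli's inequality
  have h1 := one_add_mul_le_pow (a := -violationProb B S H t)
    (by linarith [violationProb_le_one B S H t]) (numRounds ε)
  rw [← sub_eq_add_neg] at h1
  have h2 : (numRounds ε : ℝ) * violationProb B S H t ≤ 145 / ε ^ 4 * t ^ 4 :=
    mul_le_mul (numRounds_le hε hε1) hF hF0 (by positivity)
  have h3 : 145 / ε ^ 4 * t ^ 4 = 145 / 1296 := by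
    rw [ht, evolTime]
    field_simp
    norm_num
  rw [h3] at h2
  linarith

theorem two_thirds_le_alt (S : Finset (PauliString n)) {ε : ℝ} (hε : 0 < ε) (hε1 : ε < 1)
    (hcard : ((insert 0 S).card : ℝ) ≤ (2 ^ n + 1) * ε ^ 4 / 144) (H : Hamiltonian n)
    (htr : (H : QMat n).trace = 0) (hH : opNorm (H : QMat n) ≤ 1) (hfar : IsFar S ε H) :
    2 / 3 ≤ verdictProb B S ε H Verdict.alt := by
  have hF := le_violationProb_of_isFar B S hε hε1 hcard H htr hH hfar
  have hF1 := violationProb_le_one B S H (evolTime ε)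
  have hnull := verdictProb_null B S ε H
  set F := violationProb B S H (evolTime ε)
  have hx : 0 < evolTime ε ^ 2 * ε ^ 2 := by rw [evolTime]; positivity
  have h1 : Real.log 3 ≤ F * numRounds ε := by
    have h2 : 2 * Real.log 3 / (evolTime ε ^ 2 * ε ^ 2) ≤ numRounds ε := Nat.le_ceil _
    have h3 : Real.log 3 = evolTime ε ^ 2 * ε ^ 2 / 2 *
        (2 * Real.log 3 / (evolTime ε ^ 2 * ε ^ 2)) := by
      rw [div_mul_div_comm, mul_comm 2 (Real.log 3), mul_left_comm, mul_comm _ (2 : ℝ),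
        ← mul_assoc, mul_div_mul_right _ _ hx.ne']
      ring
    rw [h3]
    have h5 : 0 ≤ Real.log 3 := Real.log_nonneg (by norm_num)
    exact mul_le_mul hF h2 (by positivity) (by linarith)
  have h4 : (1 - F) ^ numRounds ε ≤ 1 / 3 := by
    calc (1 - F) ^ numRounds ε ≤ Real.exp (-F) ^ numRounds ε :=
          pow_le_pow_left₀ (by linarith) (Real.one_sub_le_exp_neg F) _
      _ = Real.exp (-(F * numRounds ε)) := by
          rw [← Real.exp_nat_mul]
          ring_nf
      _ ≤ Real.exp (-Real.log 3) := Real.exp_le_exp.2 (by linarith)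
      _ = 1 / 3 := by rw [Real.exp_neg, Real.exp_log (by norm_num), one_div]
  rw [verdictProb, pmf_verdict_alt]
  change 2 / 3 ≤ 1 - verdictProb B S ε H Verdict.null
  rw [hnull, ← ofReal_two_thirds, ← ENNReal.ofReal_one,
    ← ENNReal.ofReal_sub _ (pow_nonneg (by linarith) _)]
  exact ENNReal.ofReal_le_ofReal (by linarith)

/-- The bound on `|S ∪ {I}|` excludes `n = 0`. -/
theorem one_le_of_card_le {n : ℕ} {S : Finset (PauliString n)} {ε : ℝ} (hε : 0 < ε) (hε1 : ε < 1)
    (hcard : ((insert 0 S).card : ℝ) ≤ (2 ^ n + 1) * ε ^ 4 / 144) : 1 ≤ n := by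
  rcases Nat.eq_zero_or_pos n with rfl | hn
  · have h1 : (1 : ℝ) ≤ ((insert 0 S).card : ℝ) := by
      exact_mod_cast Finset.card_pos.2 ⟨0, Finset.mem_insert_self 0 S⟩
    have h2 : ε ^ 4 ≤ 1 := pow_le_one₀ hε.le hε1.le
    norm_num at hcard
    linarith
  · exact hn

end Bounds

/-! ### A calculus for programs of the random access machine -/

/-- Started in `s`, the program `p` halts after at most `k` steps in a store that satisfies `Q`. -/
def Computes (p : Program) (k : ℕ) (s : Store) (Q : Store → Prop) : Prop :=
  ∃ T s', Exec p s T s' ∧ T ≤ k ∧ Q s'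

namespace Computes

variable {p q : Program} {k k' : ℕ} {s : Store} {Q R : Store → Prop}

theorem mono (h : Computes p k s Q) (hk : k ≤ k') (hQ : ∀ s', Q s' → R s') :
    Computes p k' s R := by
  obtain ⟨T, s', he, hT, hs⟩ := h
  exact ⟨T, s', he, hT.trans hk, hQ _ hs⟩

theorem const {x c : ℕ} (h : Q (s.setReg x c)) : Computes (.const x c) 1 s Q :=
  ⟨_, _, .const x c s, le_rfl, h⟩

theorem copy {x y : ℕ} (h : Q (s.setReg x (s.reg y))) : Computes (.copy x y) 1 s Q :=
  ⟨_, _, .copy x y s, le_rfl, h⟩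

theorem inc {x : ℕ} (h : Q (s.setReg x (s.reg x + 1))) : Computes (.inc x) 1 s Q :=
  ⟨_, _, .inc x s, le_rfl, h⟩

theorem dec {x : ℕ} (h : Q (s.setReg x (s.reg x - 1))) : Computes (.dec x) 1 s Q :=
  ⟨_, _, .dec x s, le_rfl, h⟩

theorem load {x a : ℕ} (h : Q (s.setReg x (s.mem (s.reg a)))) : Computes (.load x a) 1 s Q :=
  ⟨_, _, .load x a s, le_rfl, h⟩

theorem seq (hp : Computes p k s Q) (hq : ∀ s', Q s' → Computes q k' s' R) :
    Computes (.seq p q) (k' + k) s R := by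
  obtain ⟨T, s', he, hT, hs⟩ := hp
  obtain ⟨T', s'', he', hT', hs'⟩ := hq s' hs
  exact ⟨_, _, .seq he he', by omega, hs'⟩

theorem const_seq {x c : ℕ} (h : Computes q k (s.setReg x c) R) :
    Computes (.seq (.const x c) q) (k + 1) s R :=
  .seq (k := 1) (.const (Q := fun s' => s' = _) rfl) (by rintro _ rfl; exact h)

theorem copy_seq {x y : ℕ} (h : Computes q k (s.setReg x (s.reg y)) R) :
    Computes (.seq (.copy x y) q) (k + 1) s R :=
  .seq (k := 1) (.copy (Q := fun s' => s' = _) rfl) (by rintro _ rfl; exact h)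

theorem inc_seq {x : ℕ} (h : Computes q k (s.setReg x (s.reg x + 1)) R) :
    Computes (.seq (.inc x) q) (k + 1) s R :=
  .seq (k := 1) (.inc (Q := fun s' => s' = _) rfl) (by rintro _ rfl; exact h)

theorem load_seq {x a : ℕ} (h : Computes q k (s.setReg x (s.mem (s.reg a))) R) :
    Computes (.seq (.load x a) q) (k + 1) s R :=
  .seq (k := 1) (.load (Q := fun s' => s' = _) rfl) (by rintro _ rfl; exact h)

theorem ifNonzero {x : ℕ} (hp : s.reg x ≠ 0 → Computes p k s Q)
    (hq : s.reg x = 0 → Computes q k s Q) : Computes (.ifNonzero x p q) (k + 1) s Q := by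
  by_cases hx : s.reg x = 0
  · obtain ⟨T, s', he, hT, hs⟩ := hq hx
    exact ⟨_, _, .ifFalse hx he, by omega, hs⟩
  · obtain ⟨T, s', he, hT, hs⟩ := hp hx
    exact ⟨_, _, .ifTrue hx he, by omega, hs⟩

/-- A loop whose invariant `I` is indexed by the number of passes that remain. -/
theorem whileNonzero {x : ℕ} (I : ℕ → Store → Prop) (hx : ∀ i s, I i s → s.reg x = i)
    (step : ∀ i s, I (i + 1) s → Computes p k s (I i)) (N : ℕ) (s : Store) (hs : I N s) :
    Computes (.whileNonzero x p) (N * (k + 1) + 1) s (I 0) := by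
  induction N generalizing s with
  | zero => exact ⟨_, _, .whileFalse (hx 0 s hs), by omega, hs⟩
  | succ N ih =>
    obtain ⟨T, s', he, hT, hs'⟩ := step N s hs
    obtain ⟨T', s'', he', hT', hs''⟩ := ih s' hs'
    refine ⟨_, _, .whileTrue (by rw [hx _ _ hs]; omega) he he', ?_, hs''⟩
    rw [Nat.succ_mul]
    omega

end Computes

@[simp]
theorem Store.setReg_mem (s : Store) (x v : ℕ) : (s.setReg x v).mem = s.mem := rfl

@[simp]
theorem Store.setReg_reg (s : Store) (x v y : ℕ) :
    (s.setReg x v).reg y = if y = x then v else s.reg y := by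
  simp [Store.setReg, Function.update_apply]

/-! ### The program that decides whether a round passes -/

/-- The bit encoded by a memory cell or a register. -/
def toBit (v : ℕ) : ZMod 2 := if v = 0 then 0 else 1

@[simp]
theorem toBit_eq_zero {v : ℕ} : toBit v = 0 ↔ v = 0 := by
  unfold toBit
  split_ifs with h <;> simp [h]

/-- The symplectic form on letters. -/
def letterForm (a b : ZMod 2 × ZMod 2) : ZMod 2 := a.1 * b.2 + a.2 * b.1

/-- The letter stored at an address. -/
def letterAt (M : ℕ → ℕ) (a : ℕ) : ZMod 2 × ZMod 2 := (toBit (M a), toBit (M (a + 1)))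

namespace Checker

/-- Adds the product of the bits in registers `x` and `y` to the bit in register `13`, which
accumulates parities. The instruction `copy 13 13` does nothing. -/
def toggle (x y : ℕ) : Program :=
  .ifNonzero x (.ifNonzero y (.ifNonzero 13 (.const 13 0) (.const 13 1)) (.copy 13 13))
    (.copy 13 13)

/-- Adds to register `13` the symplectic form of the letter in registers `15`, `16` and the letter
to which register `q` points, and moves the pointer on. -/
def absorb (q : ℕ) : Program :=
  .seq (.load 17 q) <| .seq (.inc q) <| .seq (toggle 16 17) <|
    .seq (.load 17 q) <| .seq (.inc q) (toggle 15 17)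

/-- One qubit: register `4` points to the letter of the generator, registers `8`, `9`, `10` point to
the letters of the string from `S` and of the two coset representatives. -/
def qubitStep : Program :=
  .seq (.load 15 4) <| .seq (.inc 4) <| .seq (.load 16 4) <| .seq (.inc 4) <|
    .seq (absorb 8) <| .seq (absorb 9) <| .seq (absorb 10) (.dec 11)

/-- One generator: register `14` becomes nonzero if the generator anticommutes with the product of
the three strings. Registers `3`, `5`, `6` hold their addresses and register `1` holds `n`. -/
def generatorStep : Program :=
  .seq (.copy 8 3) <| .seq (.copy 9 5) <| .seq (.copy 10 6) <| .seq (.copy 11 1) <|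
    .seq (.const 13 0) <| .seq (.whileNonzero 11 qubitStep) <|
      .seq (.ifNonzero 13 (.const 14 1) (.copy 13 13)) (.dec 12)

/-- Moves the pointer in register `x` on by the length of a string. -/
def advance (x : ℕ) : Program :=
  .seq (.copy 11 1) (.whileNonzero 11 (.seq (.inc x) (.seq (.inc x) (.dec 11))))

/-- One string from `S`: register `0` becomes nonzero if all generators commute. -/
def stringStep : Program :=
  .seq (.copy 4 7) <| .seq (.const 14 0) <| .seq (.copy 12 1) <|
    .seq (.whileNonzero 12 generatorStep) <|
      .seq (.ifNonzero 14 (.copy 13 13) (.const 0 1)) <| .seq (advance 3) (.dec 2)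

/-- Computes the addresses of the parts of the input. Register `2` counts the strings, including
one more string, which is read beyond the end of the input, where all cells are zero: it
is the identity. -/
def setup : Program :=
  .seq (.load 1 15) <| .seq (.inc 15) <| .seq (.load 2 15) <| .seq (.inc 2) <|
    .seq (.const 5 2) <| .seq (.copy 6 5) <| .seq (advance 6) <| .seq (.copy 7 6) <|
      .seq (advance 7) <| .seq (.copy 3 7) <| .seq (.copy 12 1)
        (.whileNonzero 12 (.seq (advance 3) (.dec 12)))

/-- The check of one round: the result is nonzero in register `0` if and only if the round passes. -/
def program : Program := .seq setup (.whileNonzero 2 stringStep)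

theorem toggle_computes (x y : ℕ) (s : Store) : Computes (toggle x y) 4 s fun s' =>
    s'.mem = s.mem ∧ (∀ z, z ≠ 13 → s'.reg z = s.reg z) ∧
      toBit (s'.reg 13) = toBit (s.reg 13) + toBit (s.reg x) * toBit (s.reg y) := by
  have h2 : (1 : ZMod 2) + 1 = 0 := by decide
  refine Computes.ifNonzero (fun hx => Computes.ifNonzero (fun hy => Computes.ifNonzero
    (fun h => .const ?_) (fun h => .const ?_)) (fun hy => .mono (.copy (Q := fun s' => s' = _) rfl)
      (by norm_num) ?_)) (fun hx => .mono (.copy (Q := fun s' => s' = _) rfl) (by norm_num) ?_)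
  · refine ⟨rfl, fun z hz => by simp [hz], ?_⟩
    simp [toBit, hx, hy, h, h2]
  · refine ⟨rfl, fun z hz => by simp [hz], ?_⟩
    simp [toBit, hx, hy, h]
  · rintro _ rfl
    refine ⟨rfl, fun z hz => by simp [hz], ?_⟩
    simp [toBit, hy]
  · rintro _ rfl
    refine ⟨rfl, fun z hz => by simp [hz], ?_⟩
    simp [toBit, hx]

theorem absorb_computes (q : ℕ) (hq : q ∉ [13, 15, 16, 17]) (s : Store) :
    Computes (absorb q) 12 s fun s' =>
      s'.mem = s.mem ∧ (∀ z, z ∉ [q, 13, 17] → s'.reg z = s.reg z) ∧ s'.reg q = s.reg q + 2 ∧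
      toBit (s'.reg 13) = toBit (s.reg 13) +
        letterForm (toBit (s.reg 15), toBit (s.reg 16)) (letterAt s.mem (s.reg q)) := by
  simp only [List.mem_cons, List.not_mem_nil, or_false, not_or] at hq
  obtain ⟨h13, h15, h16, h17⟩ := hq
  refine .load_seq ?_
  refine .inc_seq ?_
  refine .seq (k := 4) (toggle_computes 16 17 _) ?_
  rintro s1 ⟨m1, r1, t1⟩
  refine .load_seq ?_
  refine .inc_seq ?_
  refine .mono (toggle_computes 15 17 _) (by norm_num) ?_
  rintro s2 ⟨m2, r2, t2⟩
  have e17 := r1 17 (by norm_num)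
  have e15 := r1 15 (by norm_num)
  have eq := r1 q h13
  simp [h17, Ne.symm h13, Ne.symm h15, Ne.symm h16, Ne.symm h17, m1] at t1 t2 e17 e15 eq r1 ⊢
  refine ⟨m2.trans m1, ?_, ?_, ?_⟩
  · intro z hz1 hz2 hz3
    rw [r2 z hz2]
    simp [hz1, hz3, r1 z hz2]
  · rw [r2 q h13]
    simp [eq, h17]
  · rw [t2, t1, eq, e15]
    simp only [letterForm, letterAt]
    ring

theorem qubitStep_computes (s : Store) : Computes qubitStep 41 s fun s' =>
    s'.mem = s.mem ∧ (∀ z ∈ [0, 1, 2, 3, 5, 6, 7, 12, 14], s'.reg z = s.reg z) ∧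
      (∀ z ∈ [4, 8, 9, 10], s'.reg z = s.reg z + 2) ∧ s'.reg 11 = s.reg 11 - 1 ∧
      toBit (s'.reg 13) = toBit (s.reg 13) +
        (letterForm (letterAt s.mem (s.reg 4)) (letterAt s.mem (s.reg 8)) +
          letterForm (letterAt s.mem (s.reg 4)) (letterAt s.mem (s.reg 9)) +
          letterForm (letterAt s.mem (s.reg 4)) (letterAt s.mem (s.reg 10))) := by
  refine .load_seq ?_
  refine .inc_seq ?_
  refine .load_seq ?_
  refine .inc_seq ?_
  refine .seq (k := 12) (absorb_computes 8 (by norm_num) _) ?_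
  rintro s1 ⟨m1, r1, q1, t1⟩
  refine .seq (k := 12) (absorb_computes 9 (by norm_num) _) ?_
  rintro s2 ⟨m2, r2, q2, t2⟩
  refine .seq (k := 12) (absorb_computes 10 (by norm_num) _) ?_
  rintro s3 ⟨m3, r3, q3, t3⟩
  refine .dec ?_
  simp only [List.mem_cons, List.not_mem_nil, or_false, not_or, Store.setReg_mem,
    Store.setReg_reg] at m1 r1 q1 t1 r2 r3 ⊢
  have e1 : ∀ z ∈ [0, 1, 2, 3, 4, 5, 6, 7, 9, 10, 11, 12, 14, 15, 16], s1.reg z =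
      ((((s.setReg 15 (s.mem (s.reg 4))).setReg 4 (s.reg 4 + 1)).setReg 16
        (s.mem (s.reg 4 + 1))).setReg 4 (s.reg 4 + 2)).reg z := by
    intro z hz
    rw [r1 z (by revert hz; simp; omega)]
    simp
  have e2 : ∀ z ∈ [0, 1, 2, 3, 4, 5, 6, 7, 8, 10, 11, 12, 14, 15, 16], s2.reg z = s1.reg z :=
    fun z hz => r2 z (by revert hz; simp; omega)
  have e3 : ∀ z ∈ [0, 1, 2, 3, 4, 5, 6, 7, 8, 9, 11, 12, 14, 15, 16], s3.reg z = s2.reg z :=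
    fun z hz => r3 z (by revert hz; simp; omega)
  simp only [List.forall_mem_cons, List.not_mem_nil, Store.setReg_reg] at e1 e2 e3
  norm_num at *
  simp only [m2, m3, m1, q1, q2, q3, e1, e2, e3, t1, t2, t3, true_and, and_true]
  · simp only [letterForm, letterAt]
    ring

/-- The symplectic form of the letter at `g` and the product of the letters at `p`, `a`, `b`. -/
def formAt (M : ℕ → ℕ) (g p a b : ℕ) : ZMod 2 :=
  letterForm (letterAt M g) (letterAt M p) + letterForm (letterAt M g) (letterAt M a) +
    letterForm (letterAt M g) (letterAt M b)

/-- The same for strings of length `n`. -/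
def stringFormAt (M : ℕ → ℕ) (n g p a b : ℕ) : ZMod 2 :=
  ∑ k ∈ Finset.range n, formAt M (g + 2 * k) (p + 2 * k) (a + 2 * k) (b + 2 * k)

theorem qubitLoop_computes (n : ℕ) (s : Store) (hn : s.reg 11 = n) :
    Computes (.whileNonzero 11 qubitStep) (n * 42 + 1) s fun s' =>
      s'.mem = s.mem ∧ (∀ z ∈ [0, 1, 2, 3, 5, 6, 7, 12, 14], s'.reg z = s.reg z) ∧
      s'.reg 4 = s.reg 4 + 2 * n ∧
      toBit (s'.reg 13) = toBit (s.reg 13) +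
        stringFormAt s.mem n (s.reg 4) (s.reg 8) (s.reg 9) (s.reg 10) := by
  refine .mono (.whileNonzero (k := 41) (fun i s' => ∃ d, d + i = n ∧ s'.reg 11 = i ∧
    s'.mem = s.mem ∧ (∀ z ∈ [0, 1, 2, 3, 5, 6, 7, 12, 14], s'.reg z = s.reg z) ∧
    (∀ z ∈ [4, 8, 9, 10], s'.reg z = s.reg z + 2 * d) ∧
    toBit (s'.reg 13) = toBit (s.reg 13) +
      stringFormAt s.mem d (s.reg 4) (s.reg 8) (s.reg 9) (s.reg 10)) ?_ ?_ n s ?_) le_rfl ?_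
  · rintro i s' ⟨d, -, h, -⟩
    exact h
  · rintro i s1 ⟨d, hd, h11, hm, hk, hp, ht⟩
    refine .mono (qubitStep_computes s1) le_rfl ?_
    rintro s2 ⟨m2, k2, p2, c2, t2⟩
    refine ⟨d + 1, by omega, by omega, m2.trans hm, fun z hz => (k2 z hz).trans (hk z hz), ?_, ?_⟩
    · intro z hz
      rw [p2 z hz, hp z hz]
      ring
    · rw [t2, ht, hm, hp 4 (by simp), hp 8 (by simp), hp 9 (by simp), hp 10 (by simp)]
      simp only [stringFormAt, Finset.sum_range_succ, formAt]
      ring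
  · exact ⟨0, by simp, hn, rfl, fun _ _ => rfl, by simp, by simp [stringFormAt]⟩
  · rintro s' ⟨d, hd, -, hm, hk, hp, ht⟩
    obtain rfl : d = n := by omega
    exact ⟨hm, hk, hp 4 (by simp), ht⟩

theorem generatorStep_computes (n : ℕ) (s : Store) (hn : s.reg 1 = n) :
    Computes generatorStep (n * 42 + 9) s fun s' =>
      s'.mem = s.mem ∧ (∀ z ∈ [0, 1, 2, 3, 5, 6, 7], s'.reg z = s.reg z) ∧
      s'.reg 4 = s.reg 4 + 2 * n ∧ s'.reg 12 = s.reg 12 - 1 ∧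
      (s'.reg 14 = 0 ↔ s.reg 14 = 0 ∧
        stringFormAt s.mem n (s.reg 4) (s.reg 3) (s.reg 5) (s.reg 6) = 0) := by
  rw [show n * 42 + 9 = 3 + (n * 42 + 1) + 1 + 1 + 1 + 1 + 1 by ring]
  refine .copy_seq <| .copy_seq <| .copy_seq <| .copy_seq <| .const_seq ?_
  refine .seq (qubitLoop_computes n _ (by simp [hn])) ?_
  rintro s1 ⟨m1, k1, p1, t1⟩
  simp only [List.forall_mem_cons] at k1
  norm_num at k1 t1 p1 m1
  refine .seq (k := 2) (Q := fun s2 => s2.mem = s1.mem ∧ (∀ z, z ≠ 14 → z ≠ 13 →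
    s2.reg z = s1.reg z) ∧ (s2.reg 14 = 0 ↔ s1.reg 14 = 0 ∧ toBit (s1.reg 13) = 0))
    (.ifNonzero (fun h => .const ?_) (fun h => .copy ?_)) ?_
  · refine ⟨rfl, fun z h1 _ => by simp [h1], ?_⟩
    simp [h]
  · refine ⟨rfl, fun z h1 h2 => by simp [h2], ?_⟩
    simp [h]
  rintro s2 ⟨m2, k2, t2⟩
  refine .dec ?_
  simp only [List.forall_mem_cons]
  rw [t1] at t2
  norm_num
  simp [m2, m1, k2, k1, p1, t2, toBit]

theorem generatorLoop_computes (n : ℕ) (s : Store) (hn : s.reg 1 = n) (hn' : s.reg 12 = n) :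
    Computes (.whileNonzero 12 generatorStep) (n * (n * 42 + 9 + 1) + 1) s fun s' =>
      s'.mem = s.mem ∧ (∀ z ∈ [0, 1, 2, 3, 5, 6, 7], s'.reg z = s.reg z) ∧
      (s'.reg 14 = 0 ↔ s.reg 14 = 0 ∧ ∀ e < n,
        stringFormAt s.mem n (s.reg 4 + 2 * n * e) (s.reg 3) (s.reg 5) (s.reg 6) = 0) := by
  refine .mono (.whileNonzero (k := n * 42 + 9) (fun i s' => ∃ d, d + i = n ∧ s'.reg 12 = i ∧
    s'.mem = s.mem ∧ (∀ z ∈ [0, 1, 2, 3, 5, 6, 7], s'.reg z = s.reg z) ∧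
    s'.reg 4 = s.reg 4 + 2 * n * d ∧ (s'.reg 14 = 0 ↔ s.reg 14 = 0 ∧ ∀ e < d,
        stringFormAt s.mem n (s.reg 4 + 2 * n * e) (s.reg 3) (s.reg 5) (s.reg 6) = 0))
    ?_ ?_ n s ?_) le_rfl ?_
  · rintro i s' ⟨d, -, h, -⟩
    exact h
  · rintro i s1 ⟨d, hd, h12, hm, hk, hp, ht⟩
    refine .mono (generatorStep_computes n s1 ((hk 1 (by simp)).trans hn)) le_rfl ?_
    rintro s2 ⟨m2, k2, p2, c2, t2⟩
    refine ⟨d + 1, by omega, by omega, m2.trans hm, fun z hz => (k2 z hz).trans (hk z hz), ?_, ?_⟩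
    · rw [p2, hp]
      ring
    · rw [t2, ht, hm, hp, hk 3 (by simp), hk 5 (by simp), hk 6 (by simp), and_assoc,
        Nat.forall_lt_succ_right]
  · exact ⟨0, by simp, hn', rfl, fun _ _ => rfl, by simp, by simp⟩
  · rintro s' ⟨d, hd, -, hm, hk, -, ht⟩
    obtain rfl : d = n := by omega
    exact ⟨hm, hk, ht⟩

theorem advance_computes (x n : ℕ) (s : Store) (hn : s.reg 1 = n) (hx : x ≠ 11) :
    Computes (advance x) (n * 4 + 2) s fun s' =>
      s'.mem = s.mem ∧ (∀ z, z ≠ x → z ≠ 11 → s'.reg z = s.reg z) ∧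
      s'.reg x = s.reg x + 2 * n := by
  refine .copy_seq ?_
  refine .mono (.whileNonzero (k := 3) (fun i s' => ∃ d, d + i = n ∧ s'.reg 11 = i ∧
    s'.mem = s.mem ∧ (∀ z, z ≠ x → z ≠ 11 → s'.reg z = s.reg z) ∧
    s'.reg x = s.reg x + 2 * d) ?_ ?_ n _ ?_) le_rfl ?_
  · rintro i s' ⟨d, -, h, -⟩
    exact h
  · rintro i s1 ⟨d, hd, h11, hm, hk, hp⟩
    refine .inc_seq <| .inc_seq <| .dec ⟨d + 1, by omega, ?_, ?_, ?_, ?_⟩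
    · simp [hx.symm, h11]
    · simp [hm]
    · intro z h1 h2
      simp [h1, h2, hk]
    · simp [hx, hp]
      ring
  · exact ⟨0, by simp, by simp [hn], rfl, fun z _ h => by simp [h], by simp [hx]⟩
  · rintro s' ⟨d, hd, -, hm, hk, hp⟩
    obtain rfl : d = n := by omega
    exact ⟨hm, hk, hp⟩

theorem stringStep_computes (n : ℕ) (s : Store) (hn : s.reg 1 = n) :
    Computes stringStep (n * (n * 42 + 10) + n * 4 + 9) s fun s' =>
      s'.mem = s.mem ∧ (∀ z ∈ [1, 5, 6, 7], s'.reg z = s.reg z) ∧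
      s'.reg 3 = s.reg 3 + 2 * n ∧ s'.reg 2 = s.reg 2 - 1 ∧
      (s'.reg 0 ≠ 0 ↔ s.reg 0 ≠ 0 ∨ ∀ e < n,
        stringFormAt s.mem n (s.reg 7 + 2 * n * e) (s.reg 3) (s.reg 5) (s.reg 6) = 0) := by
  refine .mono (k := (n * 4 + 2 + 1 + 2) + (n * (n * 42 + 10) + 1) + 1 + 1 + 1) ?_
    (by omega) (fun _ h => h)
  refine .copy_seq <| .const_seq <| .copy_seq ?_
  refine .seq (generatorLoop_computes n _ (by simp [hn]) (by simp [hn])) ?_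
  rintro s1 ⟨m1, k1, t1⟩
  simp only [List.forall_mem_cons] at k1
  norm_num at k1 t1 m1
  refine .seq (k := 2) (k' := n * 4 + 2 + 1) (Q := fun s2 => s2.mem = s1.mem ∧
    (∀ z, z ≠ 0 → z ≠ 13 → s2.reg z = s1.reg z) ∧
      (s2.reg 0 ≠ 0 ↔ s1.reg 0 ≠ 0 ∨ s1.reg 14 = 0))
    (.ifNonzero (fun h => .copy ?_) (fun h => .const ?_)) ?_
  · refine ⟨rfl, fun z h1 h2 => by simp [h2], ?_⟩
    simp [h]
  · refine ⟨rfl, fun z h1 h2 => by simp [h1], ?_⟩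
    simp [h]
  rintro s2 ⟨m2, k2, t2⟩
  rw [add_comm (n * 4 + 2)]
  refine .seq (advance_computes 3 n s2 (by simp [k2, k1, hn]) (by norm_num)) ?_
  rintro s3 ⟨m3, k3, p3⟩
  refine .dec ?_
  rw [t1] at t2
  simp only [List.forall_mem_cons]
  norm_num
  simp only [ne_eq] at t2
  simp [m3, m2, m1, k3, k2, k1, p3, t2]

theorem stringLoop_computes (n m : ℕ) (s : Store) (hn : s.reg 1 = n) (hm' : s.reg 2 = m)
    (h0 : s.reg 0 = 0) :
    Computes (.whileNonzero 2 stringStep) (m * (n * (n * 42 + 10) + n * 4 + 9 + 1) + 1) s fun s' =>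
      (s'.reg 0 ≠ 0 ↔ ∃ c < m, ∀ e < n, stringFormAt s.mem n (s.reg 7 + 2 * n * e)
        (s.reg 3 + 2 * n * c) (s.reg 5) (s.reg 6) = 0) := by
  refine .mono (.whileNonzero (k := n * (n * 42 + 10) + n * 4 + 9) (fun i s' => ∃ d, d + i = m ∧
    s'.reg 2 = i ∧ s'.mem = s.mem ∧ (∀ z ∈ [1, 5, 6, 7], s'.reg z = s.reg z) ∧
    s'.reg 3 = s.reg 3 + 2 * n * d ∧ (s'.reg 0 ≠ 0 ↔ ∃ c < d, ∀ e < n,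
      stringFormAt s.mem n (s.reg 7 + 2 * n * e)
        (s.reg 3 + 2 * n * c) (s.reg 5) (s.reg 6) = 0))
    ?_ ?_ m s ?_) le_rfl ?_
  · rintro i s' ⟨d, -, h, -⟩
    exact h
  · rintro i s1 ⟨d, hd, h2, hm, hk, hp, ht⟩
    refine .mono (stringStep_computes n s1 ((hk 1 (by simp)).trans hn)) le_rfl ?_
    rintro s2 ⟨m2, k2, p2, c2, t2⟩
    refine ⟨d + 1, by omega, by omega, m2.trans hm, fun z hz => (k2 z hz).trans (hk z hz), ?_, ?_⟩
    · rw [p2, hp]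
      ring
    · rw [t2, ht, hm, hp, hk 5 (by simp), hk 6 (by simp), hk 7 (by simp),
        Nat.exists_lt_succ_right]
  · exact ⟨0, by simp, hm', rfl, fun _ _ => rfl, by simp, by simp [h0]⟩
  · rintro s' ⟨d, hd, -, hm, hk, -, ht⟩
    obtain rfl : d = m := by omega
    exact ht

theorem setup_computes (n m : ℕ) (s : Store) (hs : s.reg = fun _ => 0) (hn : s.mem 0 = n)
    (hm : s.mem 1 = m) : Computes setup (n * (n * 4 + 4) + n * 8 + 14) s fun s' =>
      s'.mem = s.mem ∧ s'.reg 0 = 0 ∧ s'.reg 1 = n ∧ s'.reg 2 = m + 1 ∧ s'.reg 5 = 2 ∧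
      s'.reg 6 = 2 + 2 * n ∧ s'.reg 7 = 2 + 4 * n ∧ s'.reg 3 = 2 + 4 * n + 2 * n * n := by
  refine .mono (k := (n * (n * 4 + 3 + 1) + 1 + 1 + 1) + (n * 4 + 2) + 1 + (n * 4 + 2) + 1 + 1 +
    1 + 1 + 1 + 1) ?_ (by ring_nf; omega) (fun _ h => h)
  refine .load_seq <| .inc_seq <| .load_seq <| .inc_seq <| .const_seq <| .copy_seq ?_
  refine .seq (advance_computes 6 n _ (by simp [hs, hn]) (by norm_num)) ?_
  rintro s1 ⟨m1, k1, p1⟩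
  refine .copy_seq ?_
  norm_num [hs, hn, hm] at k1 p1 m1
  refine .seq (advance_computes 7 n _ (by simp [k1]) (by norm_num)) ?_
  rintro s2 ⟨m2, k2, p2⟩
  refine .copy_seq <| .copy_seq ?_
  norm_num at k2 p2 m2
  refine .mono (.whileNonzero (k := n * 4 + 3) (fun i s' => ∃ d, d + i = n ∧
    s'.reg 12 = i ∧ s'.mem = s2.mem ∧ (∀ z ∈ [0, 1, 2, 5, 6, 7], s'.reg z = s2.reg z) ∧
    s'.reg 3 = s2.reg 7 + 2 * n * d) ?_ ?_ n _ ?_) le_rfl ?_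
  · rintro i s' ⟨d, -, h, -⟩
    exact h
  · rintro i s3 ⟨d, hd, h12, h3, hk, hp⟩
    rw [show n * 4 + 3 = 1 + (n * 4 + 2) by ring]
    refine .seq
      (advance_computes 3 n s3 (by simp [hk, k2, k1]) (by norm_num)) ?_
    rintro s4 ⟨m4, k4, p4⟩
    refine .dec ⟨d + 1, by omega, ?_, m4.trans h3, ?_, ?_⟩
    · simp [k4, h12]
    · simp only [List.forall_mem_cons] at hk ⊢
      norm_num at hk ⊢
      simp [k4, hk]
    · simp [p4, hp]
      ring
  · refine ⟨0, by simp, by simp [k2, k1], rfl, ?_, by simp⟩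
    simp
  · rintro s' ⟨d, hd, -, h3, hk, hp⟩
    obtain rfl : d = n := by omega
    simp only [List.forall_mem_cons] at hk
    norm_num at hk
    simp [h3, hk, hp, m2, m1, k2, k1, p2, p1]
    omega

/-- On an input in the format of `checkInput`, the program decides whether one of the strings in
the list, or the string that is read beyond the end of the input, solves the parity checks. -/
theorem program_computes (n m : ℕ) (s : Store) (hs : s.reg = fun _ => 0) (hn : s.mem 0 = n)
    (hm : s.mem 1 = m) : Computes program (100 * (m + 1) * (n + 1) ^ 2) s fun s' =>
      (s'.reg 0 ≠ 0 ↔ ∃ c < m + 1, ∀ e < n, stringFormAt s.mem n (2 + 4 * n + 2 * n * e)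
        (2 + 4 * n + 2 * n * n + 2 * n * c) 2 (2 + 2 * n) = 0) := by
  refine .mono (.seq (setup_computes n m s hs hn hm) (k' := (m + 1) *
    (n * (n * 42 + 10) + n * 4 + 9 + 1) + 1) ?_) ?_ (fun _ h => h)
  · rintro s1 ⟨m1, r0, r1, r2, r5, r6, r7, r3⟩
    refine .mono (stringLoop_computes n (m + 1) s1 r1 r2 r0) le_rfl ?_
    rw [m1, r5, r6, r7, r3]
    exact fun _ h => h
  · nlinarith [Nat.zero_le (m * n ^ 2), Nat.zero_le (m * n), Nat.zero_le (n ^ 2)]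

end Checker

/-! ### Correctness and running time of the check -/

section Check

theorem getD_flatMap {α β : Type*} (f : α → List β) (c : ℕ) (d : β) (xs : List α)
    (hf : ∀ x, (f x).length = c) {k i : ℕ} (hk : k < xs.length) (hi : i < c) :
    (xs.flatMap f).getD (c * k + i) d = (f xs[k]).getD i d := by
  induction xs generalizing k with
  | nil => simp at hk
  | cons x xs ih =>
    rw [List.flatMap_cons]
    cases k with
    | zero =>
      rw [mul_zero, zero_add, List.getD_append _ _ _ _ (by rw [hf]; exact hi)]
      rfl
    | succ k =>
      rw [List.getD_append_right _ _ _ _ (by rw [hf, mul_add]; omega), hf,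
        show c * (k + 1) + i - c = c * k + i by rw [mul_add]; omega,
        ih (by simpa using hk)]
      rfl

theorem length_flatMap_const {α β : Type*} (f : α → List β) (c : ℕ) (xs : List α)
    (hf : ∀ x, (f x).length = c) : (xs.flatMap f).length = c * xs.length := by
  simp [List.length_flatMap, hf, mul_comm]

variable {n : ℕ}

theorem length_stringBits (p : PauliString n) : (stringBits p).length = 2 * n := by
  rw [stringBits, length_flatMap_const _ 2 _ fun _ => rfl, List.length_finRange]

theorem toBit_val (z : ZMod 2) : toBit z.val = z := by
  revert z; decide

/-- The string `p` is stored in the memory `M` from the address `a` on. -/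
def StoredAt (M : ℕ → ℕ) (a : ℕ) (p : PauliString n) : Prop :=
  ∀ k : Fin n, letterAt M (a + 2 * k) = p k

theorem storedAt_of_getD (M : ℕ → ℕ) (a : ℕ) (p : PauliString n)
    (h : ∀ i < 2 * n, M (a + i) = (stringBits p).getD i 0) : StoredAt M a p := by
  intro k
  have hk := k.2
  have key : ∀ i < 2, M (a + 2 * k + i) = [(p k).1.val, (p k).2.val].getD i 0 := by
    intro i hi
    rw [add_assoc, h _ (by omega), stringBits,
      getD_flatMap _ 2 0 _ (fun _ => rfl) (by simp) hi]
    simp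
  have h0 := key 0 (by norm_num)
  have h1 := key 1 (by norm_num)
  rw [letterAt, h1, show a + 2 * (k : ℕ) = a + 2 * k + 0 from rfl, h0]
  simp [toBit_val]

theorem letterForm_add (a b c : ZMod 2 × ZMod 2) :
    letterForm a (b + c) = letterForm a b + letterForm a c := by
  simp only [letterForm, Prod.fst_add, Prod.snd_add]
  ring

theorem stringSign_eq_sum (p q : PauliString n) :
    stringSign p q = if ∑ k, letterForm (p k) (q k) = 0 then 1 else -1 := by
  have h : ∀ s : Finset (Fin n), ∏ k ∈ s, letterSign (p k) (q k) =
      if ∑ k ∈ s, letterForm (p k) (q k) = 0 then 1 else -1 := by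
    intro s
    induction s using Finset.induction_on with
    | empty => simp
    | insert k s hk ih =>
      rw [Finset.prod_insert hk, Finset.sum_insert hk, ih, letterSign]
      change (if letterForm (p k) (q k) = 0 then (1 : ℤ) else -1) * _ = _
      have h2 : (1 : ZMod 2) + 1 = 0 := by decide
      rcases bit_cases (letterForm (p k) (q k)) with h | h <;>
        rcases bit_cases (∑ k ∈ s, letterForm (p k) (q k)) with h' | h' <;>
        simp [h, h', h2]
  exact h _

theorem stringFormAt_eq_zero_iff {M : ℕ → ℕ} {g p a b : ℕ} {G P A B : PauliString n}
    (hG : StoredAt M g G) (hP : StoredAt M p P) (hA : StoredAt M a A) (hB : StoredAt M b B) :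
    Checker.stringFormAt M n g p a b = 0 ↔ commSign G (P + A + B) = 1 := by
  have h : Checker.stringFormAt M n g p a b = ∑ k, letterForm (G k) ((P + A + B) k) := by
    rw [Checker.stringFormAt, Finset.sum_range]
    refine Finset.sum_congr rfl fun k _ => ?_
    rw [Checker.formAt, hG k, hP k, hA k, hB k]
    simp only [Pi.add_apply, letterForm_add]
  rw [h, commSign_eq_one_iff_stringSign, stringSign_eq_sum]
  split_ifs with h0
  · exact iff_of_true h0 rfl
  · exact iff_of_false h0 (by norm_num)

variable (B : StabilizerMUB n)

/-- The layout of the input in the memory. -/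
theorem checkInput_layout (L : List (PauliString n)) (r : Round n) :
    let M := (initialStore (checkInput B L r)).mem
    M 0 = n ∧ M 1 = L.length ∧ StoredAt M 2 (B.rep r.basis r.input) ∧
      StoredAt M (2 + 2 * n) (B.rep r.basis r.outcome) ∧
      (∀ e : Fin n, StoredAt M (2 + 4 * n + 2 * n * e) (B.gen r.basis e)) ∧
      (∀ (c : ℕ) (hc : c < L.length),
        StoredAt M (2 + 4 * n + 2 * n * n + 2 * n * c) L[c]) ∧
      StoredAt M (2 + 4 * n + 2 * n * n + 2 * n * L.length) (0 : PauliString n) := by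
  intro M
  set l1 := stringBits (B.rep r.basis r.input) with hl1
  set l2 := stringBits (B.rep r.basis r.outcome) with hl2
  set l3 := (List.finRange n).flatMap (fun k => stringBits (B.gen r.basis k)) with hl3
  set l4 := L.flatMap stringBits with hl4
  have len1 : l1.length = 2 * n := length_stringBits _
  have len2 : l2.length = 2 * n := length_stringBits _
  have len3 : l3.length = 2 * n * n := by
    rw [hl3, length_flatMap_const _ (2 * n) _ fun _ => length_stringBits _, List.length_finRange]
  have len4 : l4.length = 2 * n * L.length :=
    length_flatMap_const _ (2 * n) _ fun _ => length_stringBits _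
  have hM : ∀ a, M a = ([n, L.length] ++ (l1 ++ (l2 ++ (l3 ++ l4)))).getD a 0 := by
    intro a
    simp only [← List.append_assoc]
    rfl
  have h1 : ∀ i, M (2 + i) = (l1 ++ (l2 ++ (l3 ++ l4))).getD i 0 := by
    intro i
    rw [hM, List.getD_append_right _ _ _ _ (by simp)]
    congr 1
    simp
  have h2 : ∀ i, M (2 + 2 * n + i) = (l2 ++ (l3 ++ l4)).getD i 0 := by
    intro i
    rw [add_assoc, h1, List.getD_append_right _ _ _ _ (by omega)]
    congr 1
    omega
  have h3 : ∀ i, M (2 + 4 * n + i) = (l3 ++ l4).getD i 0 := by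
    intro i
    rw [show 2 + 4 * n + i = 2 + 2 * n + (2 * n + i) by ring, h2,
      List.getD_append_right _ _ _ _ (by omega)]
    congr 1
    omega
  have h4 : ∀ i, M (2 + 4 * n + 2 * n * n + i) = l4.getD i 0 := by
    intro i
    rw [add_assoc, h3, List.getD_append_right _ _ _ _ (by omega)]
    congr 1
    omega
  refine ⟨by simp [hM], by simp [hM], ?_, ?_, ?_, ?_, ?_⟩
  · refine storedAt_of_getD _ _ _ fun i hi => ?_
    rw [h1, List.getD_append _ _ _ _ (by omega)]
  · refine storedAt_of_getD _ _ _ fun i hi => ?_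
    rw [h2, List.getD_append _ _ _ _ (by omega)]
  · intro e
    refine storedAt_of_getD _ _ _ fun i hi => ?_
    have hlt : 2 * n * e + i < 2 * n * n := by
      have : 2 * n * (e + 1) ≤ 2 * n * n := Nat.mul_le_mul_left _ e.2
      rw [mul_add] at this
      omega
    rw [add_assoc, h3, List.getD_append _ _ _ _ (by omega), hl3,
      getD_flatMap _ (2 * n) 0 _ (fun _ => length_stringBits _) (by simp) hi]
    simp
  · intro c hc
    refine storedAt_of_getD _ _ _ fun i hi => ?_
    rw [add_assoc, h4, hl4, getD_flatMap _ (2 * n) 0 _ (fun _ => length_stringBits _) hc hi]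
  · intro k
    have h5 : ∀ i, M (2 + 4 * n + 2 * n * n + 2 * n * L.length + i) = 0 := by
      intro i
      rw [add_assoc, h4, List.getD_eq_default _ _ (by omega)]
    rw [letterAt, add_assoc _ _ 1, h5, h5]
    rfl

theorem program_decides (S : Finset (PauliString n)) (L : List (PauliString n))
    (hL : ∀ p, p ∈ L ↔ p ∈ S) (r : Round n) :
    ∃ T s, Exec Checker.program (initialStore (checkInput B L r)) T s ∧
      T ≤ 100 * (L.length + 1) * (n + 1) ^ 2 ∧ (s.reg 0 ≠ 0 ↔ r.Passes B S) := by
  obtain ⟨hn, hm, h1, h2, h3, h4, h5⟩ := checkInput_layout B L r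
  obtain ⟨T, s, he, hT, hs⟩ := Checker.program_computes n L.length _ rfl hn hm
  refine ⟨T, s, he, hT, hs.trans ?_⟩
  rw [Round.Passes, B.related_iff]
  constructor
  · rintro ⟨c, hc, h⟩
    rcases (Nat.lt_succ_iff.1 hc).lt_or_eq with hc | rfl
    · refine ⟨L[c], Finset.mem_insert_of_mem ((hL _).1 (List.getElem_mem hc)), ?_⟩
      rw [B.mem_group_iff_gen]
      exact fun e => (stringFormAt_eq_zero_iff (h3 e) (h4 c hc) h1 h2).1 (h e e.2)
    · refine ⟨0, Finset.mem_insert_self _ _, ?_⟩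
      rw [B.mem_group_iff_gen]
      exact fun e => (stringFormAt_eq_zero_iff (h3 e) h5 h1 h2).1 (h e e.2)
  · rintro ⟨p, hp, h⟩
    rw [B.mem_group_iff_gen] at h
    rcases Finset.mem_insert.1 hp with rfl | hp
    · exact ⟨L.length, Nat.lt_succ_self _, fun e he' =>
        (stringFormAt_eq_zero_iff (h3 ⟨e, he'⟩) h5 h1 h2).2 (h ⟨e, he'⟩)⟩
    · obtain ⟨c, hc, rfl⟩ := List.getElem_of_mem ((hL p).2 hp)
      exact ⟨c, Nat.lt_succ_of_lt hc, fun e he' =>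
        (stringFormAt_eq_zero_iff (h3 ⟨e, he'⟩) (h4 c hc) h1 h2).2 (h ⟨e, he'⟩)⟩

theorem exists_classicalRun (hn : 1 ≤ n) (S : Finset (PauliString n)) (L : List (PauliString n))
    (hnd : L.Nodup) (hL : ∀ p, p ∈ L ↔ p ∈ S) (rs : List (Round n)) :
    ∃ T, ClassicalRun Checker.program B S L rs T ∧
      T ≤ rs.length * (800 * n ^ 2 * (insert 0 S).card) := by
  have hlen : L.length + 1 ≤ 2 * (insert 0 S).card := by
    have h1 : L.length = S.card := by
      rw [← List.toFinset_card_of_nodup hnd]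
      congr 1
      ext p
      simp [hL]
    have h2 : S.card ≤ (insert 0 S).card := Finset.card_le_card (Finset.subset_insert _ _)
    have h3 : 0 < (insert 0 S).card := Finset.card_pos.2 ⟨0, Finset.mem_insert_self _ _⟩
    omega
  have hcost : 100 * (L.length + 1) * (n + 1) ^ 2 ≤ 800 * n ^ 2 * (insert 0 S).card := by
    have h4 : (n + 1) ^ 2 ≤ 4 * n ^ 2 := by nlinarith
    calc 100 * (L.length + 1) * (n + 1) ^ 2 ≤ 100 * (2 * (insert 0 S).card) * (4 * n ^ 2) :=
          Nat.mul_le_mul (Nat.mul_le_mul_left _ hlen) h4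
      _ = 800 * n ^ 2 * (insert 0 S).card := by ring
  induction rs with
  | nil => exact ⟨0, .nil, by simp⟩
  | cons r rs ih =>
    obtain ⟨T', hrun, hT'⟩ := ih
    obtain ⟨T, s, he, hT, hs⟩ := program_decides B S L hL r
    refine ⟨T + T', .cons he hs hrun, ?_⟩
    rw [List.length_cons, Nat.succ_mul, add_comm T]
    exact add_le_add hT' (hT.trans hcost)

end Check

/-! ### The action of Clifford gates on Pauli strings -/

section Clifford

variable {n : ℕ}

/-- The action of a gate on the Pauli strings by conjugation, up to signs. -/
def Gate.act : Gate n → PauliString n → PauliString n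
  | .hadamard k, g => Function.update g k (g k).swap
  | .phase k, g => Function.update g k ((g k).1, (g k).2 + (g k).1)
  | .cnot c k _, g =>
      Function.update (Function.update g k ((g k).1 + (g c).1, (g k).2)) c
        ((g c).1, (g c).2 + (g k).2)

/-- The action of a circuit on the Pauli strings by conjugation, up to signs. -/
def circuitAct : List (Gate n) → PauliString n → PauliString n
  | [], g => g
  | γ :: γs, g => circuitAct γs (γ.act g)

theorem tensor_eq_smul (A A' : Fin n → Matrix (Fin 2) (Fin 2) ℂ) (k : Fin n) (s : ℂ)
    (hk : A k = s • A' k) (h : ∀ j, j ≠ k → A j = A' j) : tensor A = s • tensor A' := by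
  ext x y
  simp only [tensor, Matrix.of_apply, Matrix.smul_apply, smul_eq_mul]
  rw [Fintype.prod_eq_mul_prod_compl k, Fintype.prod_eq_mul_prod_compl k, hk, ← mul_assoc]
  congr 1
  refine Finset.prod_congr rfl fun j hj => ?_
  rw [h j (by simpa using hj)]

theorem onQubit_mul_pauli (A : Matrix (Fin 2) (Fin 2) ℂ) (k : Fin n) (g : PauliString n)
    (a : ZMod 2 × ZMod 2) (s : ℂ) (h : A * sigma (g k) = s • (sigma a * A)) :
    onQubit A k * pauli g = s • (pauli (Function.update g k a) * onQubit A k) := by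
  rw [onQubit, pauli, pauli, tensor_mul, tensor_mul]
  refine tensor_eq_smul _ _ k s ?_ fun j hj => ?_
  · simpa using h
  · simp [hj]

theorem hadamard_mul_sigma (a : ZMod 2 × ZMod 2) : ∃ s : ℤˣ,
    ((1 / Real.sqrt 2 : ℂ) • !![1, 1; 1, -1]) * sigma a =
      ((s : ℤ) : ℂ) • (sigma a.swap * ((1 / Real.sqrt 2 : ℂ) • !![1, 1; 1, -1])) := by
  refine ⟨if a = (1, 1) then -1 else 1, ?_⟩
  rw [Matrix.smul_mul, Matrix.mul_smul, smul_comm]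
  congr 1
  rcases a with ⟨a, b⟩
  rcases bit_cases a with rfl | rfl <;> rcases bit_cases b with rfl | rfl <;>
    simp [sigma]

theorem phase_mul_sigma (a : ZMod 2 × ZMod 2) : ∃ s : ℤˣ,
    !![1, 0; 0, Complex.I] * sigma a =
      ((s : ℤ) : ℂ) • (sigma (a.1, a.2 + a.1) * !![1, 0; 0, Complex.I]) := by
  have h2 : (1 : ZMod 2) + 1 = 0 := by decide
  refine ⟨if a = (1, 1) then -1 else 1, ?_⟩
  rcases a with ⟨a, b⟩
  rcases bit_cases a with rfl | rfl <;> rcases bit_cases b with rfl | rfl <;>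
    simp [sigma, h2]

theorem cnot_sigma (a b : ZMod 2 × ZMod 2) : ∃ s : ℤˣ, ∀ x x' y y' : Fin 2,
    sigma a x y * sigma b (x' + x) y' =
      ((s : ℤ) : ℂ) *
        (sigma (a.1, a.2 + b.2) x y * sigma (b.1 + a.1, b.2) x' (y' + y)) := by
  have h2 : (1 : ZMod 2) + 1 = 0 := by decide
  have h3 : (1 : Fin 2) + 1 = 0 := by decide
  refine ⟨if a.1 = 1 ∧ b.2 = 1 ∧ a.2 = b.1 then -1 else 1, ?_⟩
  rcases a with ⟨a, a'⟩
  rcases b with ⟨b, b'⟩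
  simp only [Fin.forall_fin_two]
  rcases bit_cases a with rfl | rfl <;> rcases bit_cases a' with rfl | rfl <;>
    rcases bit_cases b with rfl | rfl <;> rcases bit_cases b' with rfl | rfl <;>
    simp [sigma, h2, h3]

/-- The permutation of the computational basis by the controlled-NOT gate with control `c` and
target `k`. -/
def flipBit (c k : Fin n) (y : Bits n) : Bits n := Function.update y k (y k + y c)

theorem flipBit_flipBit {c k : Fin n} (h : c ≠ k) (y : Bits n) : flipBit c k (flipBit c k y) = y := by
  have h2 : ∀ a b : Fin 2, a + b + b = a := by decide
  funext j
  by_cases hj : j = k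
  · subst hj
    simp [flipBit, h, h2]
  · simp [flipBit, hj]

theorem cnot_mul_apply (c k : Fin n) (h : c ≠ k) (A : QMat n) (x y : Bits n) :
    ((Gate.cnot c k h).matrix * A) x y = A (flipBit c k x) y := by
  rw [Matrix.mul_apply, Finset.sum_eq_single (flipBit c k x)]
  · change (if x = flipBit c k (flipBit c k x) then (1 : ℂ) else 0) * _ = _
    rw [if_pos (flipBit_flipBit h x).symm, one_mul]
  · intro z _ hz
    simp only [Gate.matrix, Matrix.of_apply]
    rw [if_neg, zero_mul]
    intro hx
    apply hz
    rw [hx]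
    exact (flipBit_flipBit h z).symm
  · simp

theorem mul_cnot_apply (c k : Fin n) (h : c ≠ k) (A : QMat n) (x y : Bits n) :
    (A * (Gate.cnot c k h).matrix) x y = A x (flipBit c k y) := by
  rw [Matrix.mul_apply, Finset.sum_eq_single (flipBit c k y)]
  · simp [Gate.matrix, flipBit]
  · intro z _ hz
    simp only [Gate.matrix, Matrix.of_apply]
    rw [if_neg (by exact hz), mul_zero]
  · simp

theorem Gate.matrix_mul_pauli (γ : Gate n) (g : PauliString n) :
    ∃ s : ℤˣ, γ.matrix * pauli g = ((s : ℤ) : ℂ) • (pauli (γ.act g) * γ.matrix) := by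
  cases γ with
  | hadamard k =>
    obtain ⟨s, hs⟩ := hadamard_mul_sigma (g k)
    exact ⟨s, onQubit_mul_pauli _ k g _ _ hs⟩
  | phase k =>
    obtain ⟨s, hs⟩ := phase_mul_sigma (g k)
    exact ⟨s, onQubit_mul_pauli _ k g _ _ hs⟩
  | cnot c k h =>
    obtain ⟨s, hs⟩ := cnot_sigma (g c) (g k)
    refine ⟨s, ?_⟩
    ext x y
    rw [cnot_mul_apply, Matrix.smul_apply, mul_cnot_apply, smul_eq_mul]
    simp only [pauli, tensor, Matrix.of_apply]
    have split : ∀ f : Fin n → ℂ, ∏ j, f j = f c * f k * ∏ j ∈ {c}ᶜ \ {k}, f j := by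
      intro f
      rw [Fintype.prod_eq_mul_prod_compl c, mul_assoc,
        ← Finset.prod_sdiff (s₁ := {k}) (s₂ := {c}ᶜ) (by simpa using h),
        Finset.prod_singleton, mul_comm (f k)]
    rw [split, split, ← mul_assoc]
    congr 1
    · simp only [Gate.act, flipBit, Function.update_self, Function.update_of_ne h,
        Function.update_of_ne h.symm]
      exact hs _ _ _ _
    · refine Finset.prod_congr rfl fun j hj => ?_
      simp only [Finset.mem_sdiff, Finset.mem_compl, Finset.mem_singleton] at hj
      simp [Gate.act, flipBit, hj.1, hj.2]

theorem onQubit_mul (A A' : Matrix (Fin 2) (Fin 2) ℂ) (k : Fin n) :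
    onQubit A k * onQubit A' k = onQubit (A * A') k := by
  rw [onQubit, onQubit, onQubit, tensor_mul]
  congr 1
  funext j
  by_cases hj : j = k
  · subst hj
    simp
  · simp [hj]

theorem onQubit_one (k : Fin n) : onQubit 1 k = (1 : QMat n) := by
  rw [onQubit, ← tensor_one]
  congr 1
  funext j
  by_cases hj : j = k
  · subst hj
    simp
  · simp [hj]

theorem onQubit_conjTranspose (A : Matrix (Fin 2) (Fin 2) ℂ) (k : Fin n) :
    (onQubit A k)ᴴ = onQubit Aᴴ k := by
  rw [onQubit, onQubit, tensor_conjTranspose]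
  congr 1
  funext j
  by_cases hj : j = k
  · subst hj
    simp
  · simp [hj]

theorem inv_sqrt_two_mul_self : (1 / Real.sqrt 2 : ℂ) * (1 / Real.sqrt 2) = 1 / 2 := by
  rw [div_mul_div_comm, one_mul, ← Complex.ofReal_mul, Real.mul_self_sqrt (by norm_num)]
  norm_num

theorem hadamard_sq : ((1 / Real.sqrt 2 : ℂ) • !![1, 1; 1, -1]) *
    ((1 / Real.sqrt 2 : ℂ) • !![1, 1; 1, -1]) = (1 : Matrix (Fin 2) (Fin 2) ℂ) := by
  rw [Matrix.smul_mul, Matrix.mul_smul, smul_smul, inv_sqrt_two_mul_self]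
  ext i j
  fin_cases i <;> fin_cases j <;> norm_num

theorem cnot_sq (c k : Fin n) (h : c ≠ k) :
    (Gate.cnot c k h).matrix * (Gate.cnot c k h).matrix = 1 := by
  ext x y
  rw [cnot_mul_apply, Gate.matrix, Matrix.of_apply, Matrix.one_apply]
  refine if_congr ⟨fun hxy => ?_, fun hxy => by rw [hxy]; rfl⟩ rfl rfl
  rw [← flipBit_flipBit h x, hxy]
  exact flipBit_flipBit h y

theorem cnot_conjTranspose (c k : Fin n) (h : c ≠ k) :
    ((Gate.cnot c k h).matrix)ᴴ = (Gate.cnot c k h).matrix := by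
  ext x y
  simp only [Matrix.conjTranspose_apply, Gate.matrix, Matrix.of_apply]
  rw [apply_ite star, star_one, star_zero]
  refine if_congr ⟨fun hxy => ?_, fun hxy => ?_⟩ rfl rfl
  · rw [hxy]
    exact (flipBit_flipBit h x).symm
  · rw [hxy]
    exact (flipBit_flipBit h y).symm

theorem Gate.matrix_unitary (γ : Gate n) : γ.matrixᴴ * γ.matrix = 1 := by
  cases γ with
  | hadamard k =>
    rw [Gate.matrix, onQubit_conjTranspose, onQubit_mul, ← onQubit_one k]
    congr 1
    have : ((1 / Real.sqrt 2 : ℂ) • !![1, 1; 1, -1])ᴴ =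
        ((1 / Real.sqrt 2 : ℂ) • !![1, 1; 1, -1] : Matrix (Fin 2) (Fin 2) ℂ) := by
      ext i j
      fin_cases i <;> fin_cases j <;> simp
    rw [this, hadamard_sq]
  | phase k =>
    rw [Gate.matrix, onQubit_conjTranspose, onQubit_mul, ← onQubit_one k]
    congr 1
    ext i j
    fin_cases i <;> fin_cases j <;> simp [Matrix.mul_apply, Fin.sum_univ_two]
  | cnot c k h => rw [cnot_conjTranspose, cnot_sq]

theorem circuitMatrix_unitary (c : List (Gate n)) :
    (circuitMatrix c)ᴴ * circuitMatrix c = 1 := by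
  induction c with
  | nil => simp [circuitMatrix]
  | cons γ γs ih =>
    rw [circuitMatrix, Matrix.conjTranspose_mul, mul_assoc, ← mul_assoc _ (circuitMatrix γs), ih,
      one_mul, γ.matrix_unitary]

theorem circuitMatrix_unitary' (c : List (Gate n)) :
    circuitMatrix c * (circuitMatrix c)ᴴ = 1 :=
  mul_eq_one_comm.1 (circuitMatrix_unitary c)

theorem circuitMatrix_append (c c' : List (Gate n)) :
    circuitMatrix (c ++ c') = circuitMatrix c' * circuitMatrix c := by
  induction c with
  | nil => simp [circuitMatrix]
  | cons γ γs ih => simp only [List.cons_append, circuitMatrix, ih, mul_assoc]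

theorem circuitAct_append (c c' : List (Gate n)) (g : PauliString n) :
    circuitAct (c ++ c') g = circuitAct c' (circuitAct c g) := by
  induction c generalizing g with
  | nil => rfl
  | cons γ γs ih => exact ih _

theorem circuitMatrix_mul_pauli (c : List (Gate n)) (g : PauliString n) : ∃ s : ℤˣ,
    circuitMatrix c * pauli g = ((s : ℤ) : ℂ) • (pauli (circuitAct c g) * circuitMatrix c) := by
  induction c generalizing g with
  | nil => exact ⟨1, by simp [circuitMatrix, circuitAct]⟩
  | cons γ γs ih =>
    obtain ⟨s, hs⟩ := γ.matrix_mul_pauli g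
    obtain ⟨s', hs'⟩ := ih (γ.act g)
    refine ⟨s * s', ?_⟩
    rw [circuitMatrix, mul_assoc, hs, Matrix.mul_smul, ← mul_assoc, hs', Matrix.smul_mul, smul_smul,
      circuitAct, mul_assoc]
    push_cast
    rfl

theorem circuitMatrix_conj_pauli (c : List (Gate n)) (g : PauliString n) : ∃ s : ℤˣ,
    circuitMatrix c * pauli g * (circuitMatrix c)ᴴ = ((s : ℤ) : ℂ) • pauli (circuitAct c g) := by
  obtain ⟨s, hs⟩ := circuitMatrix_mul_pauli c g
  refine ⟨s, ?_⟩
  rw [hs, Matrix.smul_mul, mul_assoc, circuitMatrix_unitary', mul_one]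

theorem commSign_circuitAct (c : List (Gate n)) {g h : PauliString n} (hgh : commSign g h = 1) :
    commSign (circuitAct c g) (circuitAct c h) = 1 := by
  rw [commSign_eq_one_iff] at hgh ⊢
  have key : ∀ g : PauliString n, ∃ s : ℤˣ, pauli (circuitAct c g) =
      ((s : ℤ) : ℂ) • (circuitMatrix c * pauli g * (circuitMatrix c)ᴴ) := by
    intro g
    obtain ⟨s, hs⟩ := circuitMatrix_conj_pauli c g
    refine ⟨s, ?_⟩
    rw [hs, smul_smul, ← Int.cast_mul, ← Units.val_mul, Int.units_mul_self]
    simp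
  obtain ⟨s, hs⟩ := key g
  obtain ⟨s', hs'⟩ := key h
  have hm : ∀ g h : PauliString n, circuitMatrix c * pauli g * (circuitMatrix c)ᴴ *
      (circuitMatrix c * pauli h * (circuitMatrix c)ᴴ) =
      circuitMatrix c * (pauli g * pauli h) * (circuitMatrix c)ᴴ := by
    intro g h
    calc _ = circuitMatrix c * pauli g * ((circuitMatrix c)ᴴ * circuitMatrix c) *
          (pauli h * (circuitMatrix c)ᴴ) := by simp only [mul_assoc]
      _ = _ := by rw [circuitMatrix_unitary, mul_one]; simp only [mul_assoc]
  rw [hs, hs', Matrix.smul_mul, Matrix.smul_mul, Matrix.mul_smul, Matrix.mul_smul, hm, hm, hgh,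
    smul_comm]

/-! ### A circuit that turns commuting Pauli strings into strings of `I` and `Z` -/

/-- Single-qubit gates on `E` that turn the letters of one string on `E` into `I` and `Z`. -/
theorem exists_circuit_letters (g : PauliString n) (E : Finset (Fin n)) :
    ∃ c : List (Gate n), c.length ≤ 2 * E.card ∧
      (∀ k ∈ E, (circuitAct c g k).1 = 0) ∧ (∀ k ∈ E, g k ≠ 0 → circuitAct c g k ≠ 0) ∧
      ∀ h, ∀ k ∉ E, circuitAct c h k = h k := by
  induction E using Finset.induction_on with
  | empty => exact ⟨[], by simp, by simp, by simp, fun _ _ _ => rfl⟩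
  | insert q E hq ih =>
    obtain ⟨c, hlen, hx, hne, hout⟩ := ih
    have one : ∃ c' : List (Gate n), c'.length ≤ 2 ∧ (circuitAct c' (circuitAct c g) q).1 = 0 ∧
        (g q ≠ 0 → circuitAct c' (circuitAct c g) q ≠ 0) ∧
        ∀ h, ∀ k, k ≠ q → circuitAct c' h k = h k := by
      have hgq := hout g q hq
      rcases hg : g q with ⟨a, b⟩
      rw [hg] at hgq
      have h2 : (1 : ZMod 2) + 1 = 0 := by decide
      rcases bit_cases a with rfl | rfl
      · exact ⟨[], by simp, by simp [circuitAct, hgq], by simp [circuitAct, hgq],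
          fun _ _ _ => rfl⟩
      · rcases bit_cases b with rfl | rfl
        · refine ⟨[.hadamard q], by simp, by simp [circuitAct, Gate.act, hgq],
            by simp [circuitAct, Gate.act, hgq], fun h k hk => by simp [circuitAct, Gate.act, hk]⟩
        · refine ⟨[.phase q, .hadamard q], by simp, by simp [circuitAct, Gate.act, hgq, h2],
            by simp [circuitAct, Gate.act, hgq],
            fun h k hk => by simp [circuitAct, Gate.act, hk]⟩
    obtain ⟨c', hlen', hx', hne', hout'⟩ := one
    refine ⟨c ++ c', ?_, ?_, ?_, ?_⟩
    · rw [List.length_append, Finset.card_insert_of_notMem hq]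
      omega
    · intro k hk
      rw [circuitAct_append]
      rcases Finset.mem_insert.1 hk with rfl | hkE
      · exact hx'
      · rw [hout' _ _ (by rintro rfl; exact hq hkE)]
        exact hx k hkE
    · intro k hk
      rw [circuitAct_append]
      rcases Finset.mem_insert.1 hk with rfl | hkE
      · exact hne'
      · rw [hout' _ _ (by rintro rfl; exact hq hkE)]
        exact hne k hkE
    · intro h k hk
      rw [Finset.mem_insert, not_or] at hk
      rw [circuitAct_append, hout' _ _ hk.1, hout _ _ hk.2]

/-- Controlled-NOT gates that collect the letters `Z` of one string on `E` at the qubit `q`. -/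
theorem exists_circuit_collect (g : PauliString n) (q : Fin n) (hgq : g q = (0, 1))
    (E : Finset (Fin n)) (hqE : q ∉ E) (hE : ∀ k ∈ E, (g k).1 = 0) :
    ∃ c : List (Gate n), c.length ≤ E.card ∧ (∀ k ∈ E, circuitAct c g k = 0) ∧
      circuitAct c g q = (0, 1) ∧ ∀ h, ∀ k, k ≠ q → k ∉ E → circuitAct c h k = h k := by
  induction E using Finset.induction_on with
  | empty => exact ⟨[], by simp, by simp, hgq, fun _ _ _ _ => rfl⟩
  | insert p E hp ih =>
    rw [Finset.mem_insert, not_or] at hqE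
    obtain ⟨c, hlen, hx, hc, hout⟩ := ih hqE.2 fun k hk => hE k (Finset.mem_insert_of_mem hk)
    have hgp := hout g p (Ne.symm hqE.1) hp
    have hp0 := hE p (Finset.mem_insert_self _ _)
    have h2 : (1 : ZMod 2) + 1 = 0 := by decide
    have one : ∃ c' : List (Gate n), c'.length ≤ 1 ∧ circuitAct c' (circuitAct c g) p = 0 ∧
        circuitAct c' (circuitAct c g) q = (0, 1) ∧
        ∀ h, ∀ k, k ≠ q → k ≠ p → circuitAct c' h k = h k := by
      rcases hg : g p with ⟨a, b⟩
      rw [hg] at hgp hp0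
      dsimp only at hp0
      subst hp0
      rcases bit_cases b with rfl | rfl
      · exact ⟨[], by simp, hgp, hc, fun _ _ _ _ => rfl⟩
      · refine ⟨[.cnot p q (Ne.symm hqE.1)], by simp, ?_, ?_, ?_⟩
        · simp [circuitAct, Gate.act, hgp, hc, h2]
        · simp [circuitAct, Gate.act, hgp, hc, hqE.1]
        · intro h k hk hk'
          simp [circuitAct, Gate.act, hk, hk']
    obtain ⟨c', hlen', hx', hc', hout'⟩ := one
    refine ⟨c ++ c', ?_, ?_, ?_, ?_⟩
    · rw [List.length_append, Finset.card_insert_of_notMem hp]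
      omega
    · intro k hk
      rw [circuitAct_append]
      rcases Finset.mem_insert.1 hk with rfl | hkE
      · exact hx'
      · rw [hout' _ _ (by rintro rfl; exact hqE.2 hkE) (by rintro rfl; exact hp hkE)]
        exact hx k hkE
    · rw [circuitAct_append]
      exact hc'
    · intro h k hk hkE
      rw [Finset.mem_insert, not_or] at hkE
      rw [circuitAct_append, hout' _ _ hk hkE.1, hout _ _ hk hkE.2]

/-- A string that commutes with a string `g`, and does so letter by letter away from the qubit `q`,
has no `X`-part at `q` if `g` has the letter `Z` there. -/
theorem fst_eq_zero_of_commSign {g h : PauliString n} {q : Fin n} (hq : g q = (0, 1))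
    (hk : ∀ k, k ≠ q → letterSign (g k) (h k) = 1) (hgh : commSign g h = 1) : (h q).1 = 0 := by
  rw [commSign_eq_one_iff_stringSign, stringSign,
    Finset.prod_eq_single q (fun k _ hne => hk k hne) (by simp), hq, letterSign] at hgh
  by_contra hne
  have : (0 : ZMod 2) * (h q).2 + 1 * (h q).1 ≠ 0 := by simpa using hne
  rw [if_neg this] at hgh
  norm_num at hgh

/-- Pairwise commuting strings, all of whose letters outside `D` are `I` or `Z`, are turned into
strings of `I` and `Z` by a circuit. As long as some string `g` has an `X`-part at some `q ∈ D`,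
gates on `D` turn `g` into the letter `Z` at `q`, up to letters `I` and `Z` outside `D`; as
all strings commute with `g`, the qubit `q` can then be removed from `D`. -/
theorem exists_circuit_of_commute (m : ℕ) (D : Finset (Fin n)) (hm : D.card = m)
    (G : Set (PauliString n)) (hcomm : ∀ g ∈ G, ∀ h ∈ G, commSign g h = 1)
    (hD : ∀ g ∈ G, ∀ k ∉ D, (g k).1 = 0) :
    ∃ c : List (Gate n), c.length ≤ 3 * n * m ∧ ∀ g ∈ G, ∀ k, (circuitAct c g k).1 = 0 := by
  induction m generalizing D G with
  | zero =>
    rw [Finset.card_eq_zero] at hm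
    subst hm
    exact ⟨[], by simp, fun g hg k => hD g hg k (by simp)⟩
  | succ m ih =>
    by_cases hall : ∀ g ∈ G, ∀ k, (g k).1 = 0
    · exact ⟨[], by simp, hall⟩
    push Not at hall
    obtain ⟨g, hg, q, hgq⟩ := hall
    have hqD : q ∈ D := by
      by_contra hc
      exact hgq (hD g hg q hc)
    obtain ⟨c1, len1, x1, ne1, out1⟩ := exists_circuit_letters g D
    have hq1 : circuitAct c1 g q = (0, 1) := by
      have h1 := x1 q hqD
      have h2 := ne1 q hqD (by intro h0; simp [h0] at hgq)
      rcases hc : circuitAct c1 g q with ⟨a, b⟩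
      rw [hc] at h1 h2
      dsimp only at h1
      subst h1
      rcases bit_cases b with rfl | rfl
      · exact absurd rfl h2
      · rfl
    obtain ⟨c2, len2, x2, hq2, out2⟩ := exists_circuit_collect (circuitAct c1 g) q hq1 (D.erase q)
      (Finset.notMem_erase q D) fun k hk => x1 k (Finset.mem_of_mem_erase hk)
    have out : ∀ h, ∀ k ∉ D, circuitAct (c1 ++ c2) h k = h k := by
      intro h k hk
      rw [circuitAct_append, out2 _ k (by rintro rfl; exact hk hqD)
        (fun hk' => hk (Finset.mem_of_mem_erase hk')), out1 _ k hk]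
    have hcard : (D.erase q).card = m := by rw [Finset.card_erase_of_mem hqD, hm]; rfl
    obtain ⟨c3, len3, x3⟩ := ih (D.erase q) hcard (circuitAct (c1 ++ c2) '' G) (by
      rintro _ ⟨h, hh, rfl⟩ _ ⟨h', hh', rfl⟩
      exact commSign_circuitAct _ (hcomm h hh h' hh')) (by
      rintro _ ⟨h, hh, rfl⟩ k hk
      by_cases hkD : k ∈ D
      · have hkq : k = q := by
          by_contra hne
          exact hk (Finset.mem_erase.2 ⟨hne, hkD⟩)
        subst hkq
        have hgk : circuitAct (c1 ++ c2) g k = (0, 1) := by rw [circuitAct_append, hq2]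
        refine fst_eq_zero_of_commSign hgk (fun l hl => ?_)
          (commSign_circuitAct _ (hcomm g hg h hh))
        by_cases hlD : l ∈ D
        · rw [circuitAct_append c1 c2 g, x2 l (Finset.mem_erase.2 ⟨hl, hlD⟩)]
          simp [letterSign]
        · rw [out g l hlD, out h l hlD, letterSign, hD g hg l hlD, hD h hh l hlD]
          simp
      · rw [out h k hkD, hD h hh k hkD])
    refine ⟨c1 ++ c2 ++ c3, ?_, fun h hh k => ?_⟩
    · have hn : D.card ≤ n := by simpa using Finset.card_le_univ D
      rw [List.length_append, List.length_append, Nat.mul_succ]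
      omega
    · rw [circuitAct_append]
      exact x3 _ ⟨h, hh, rfl⟩ k

theorem exists_circuit_of_commute_univ (G : Set (PauliString n))
    (hcomm : ∀ g ∈ G, ∀ h ∈ G, commSign g h = 1) :
    ∃ c : List (Gate n), c.length ≤ 3 * n ^ 2 ∧ ∀ g ∈ G, ∀ k, (circuitAct c g k).1 = 0 := by
  obtain ⟨c, hc, h⟩ := exists_circuit_of_commute n Finset.univ (by simp) G hcomm (by simp)
  exact ⟨c, hc.trans_eq (by ring), h⟩

end Clifford

/-! ### Circuits for the states and the measurements -/

section Circuits

variable {n : ℕ}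

theorem pauli_apply_of_ne {g : PauliString n} (hg : ∀ k, (g k).1 = 0) {x y : Bits n}
    (hxy : x ≠ y) : pauli g x y = 0 := by
  obtain ⟨k, hk⟩ := Function.ne_iff.1 hxy
  rw [pauli, tensor, Matrix.of_apply]
  refine Finset.prod_eq_zero (Finset.mem_univ k) ?_
  have h0 := hg k
  rcases hgk : g k with ⟨a, b⟩
  rw [hgk] at h0
  dsimp only at h0
  subst h0
  revert hk
  generalize x k = u
  generalize y k = v
  revert u v
  rcases bit_cases b with rfl | rfl <;> simp [Fin.forall_fin_two, sigma]

/-- A vector whose rank-one projector is diagonal is a basis vector up to a phase. -/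
theorem exists_eq_smul_single (v : Bits n → ℂ) (hv : star v ⬝ᵥ v = 1)
    (hdiag : ∀ x y, x ≠ y → Matrix.vecMulVec v (star v) x y = 0) :
    ∃ x, ∃ θ : ℝ, v = Complex.exp (Complex.I * θ) • Pi.single x 1 := by
  have hne : v ≠ 0 := by
    rintro rfl
    simp at hv
  obtain ⟨x, hx⟩ := Function.ne_iff.1 hne
  have hzero : ∀ y, y ≠ x → v y = 0 := by
    intro y hy
    have h := hdiag x y hy.symm
    rw [Matrix.vecMulVec_apply, mul_eq_zero] at h
    simpa using h.resolve_left hx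
  have hvx : v = v x • Pi.single x 1 := by
    funext y
    by_cases hy : y = x
    · subst hy
      simp
    · simp [hy, hzero y hy]
  have hnorm : ‖v x‖ = 1 := by
    rw [dotProduct, Finset.sum_eq_single x (fun y _ hy => by simp [hzero y hy]) (by simp)] at hv
    simp only [Pi.star_apply, Complex.star_def] at hv
    rw [← Complex.normSq_eq_conj_mul_self, Complex.normSq_eq_norm_sq] at hv
    have h2 : ‖v x‖ ^ 2 = 1 := by exact_mod_cast hv
    nlinarith [norm_nonneg (v x)]
  refine ⟨x, (v x).arg, ?_⟩
  conv_lhs => rw [hvx]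
  congr 1
  conv_lhs => rw [← Complex.norm_mul_exp_arg_mul_I (v x), hnorm]
  rw [mul_comm Complex.I]
  simp

theorem unitary_inner {U : QMat n} (hU : Uᴴ * U = 1) (v w : Bits n → ℂ) :
    star (U *ᵥ v) ⬝ᵥ (U *ᵥ w) = star v ⬝ᵥ w := by
  rw [Matrix.star_mulVec, ← Matrix.dotProduct_mulVec, Matrix.mulVec_mulVec, hU, Matrix.one_mulVec]

/-- A circuit that turns the stabilizer group of a basis into strings of `I` and `Z` maps the
basis to the computational basis. -/
theorem exists_implementsMeasurement (B : StabilizerMUB n) (i : Fin (2 ^ n + 1)) :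
    ∃ c : List (Gate n), c.length ≤ 3 * n ^ 2 ∧ ImplementsMeasurement c (B.ket i) := by
  classical
  obtain ⟨c, hlen, hc⟩ := exists_circuit_of_commute_univ (B.group i : Set (PauliString n))
    fun g hg h hh => B.commSign_of_mem hg hh
  refine ⟨c, hlen, ?_⟩
  set U := circuitMatrix c with hU
  have hunit : Uᴴ * U = 1 := circuitMatrix_unitary c
  have hsingle : ∀ j, ∃ x, ∃ θ : ℝ,
      U *ᵥ B.ket i j = Complex.exp (Complex.I * θ) • Pi.single x 1 := by
    intro j
    refine exists_eq_smul_single _ (by rw [unitary_inner hunit, B.ket_unit]) ?_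
    intro x y hxy
    have h1 : Matrix.vecMulVec (U *ᵥ B.ket i j) (star (U *ᵥ B.ket i j)) =
        U * stabProj (B.group i) (B.sign i) (B.rep i j) * Uᴴ := by
      rw [← B.ket_proj, Matrix.mul_vecMulVec, Matrix.vecMulVec_mul, Matrix.star_mulVec]
    rw [h1, stabProj, Matrix.mul_smul, Matrix.smul_mul, Finset.mul_sum, Finset.sum_mul,
      Matrix.smul_apply, Matrix.sum_apply, Finset.sum_eq_zero, smul_zero]
    intro p hp
    obtain ⟨s, hs⟩ := circuitMatrix_conj_pauli c p
    rw [signedPauli, Matrix.mul_smul, Matrix.mul_smul, Matrix.smul_mul, Matrix.smul_mul, hs]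
    simp only [Matrix.smul_apply]
    rw [pauli_apply_of_ne (hc p (by simpa using hp)) hxy]
    simp
  choose e θ he using hsingle
  have hinj : Function.Injective e := by
    intro j l hjl
    by_contra hne
    have h0 : star (U *ᵥ B.ket i l) ⬝ᵥ (U *ᵥ B.ket i j) = 0 := by
      rw [unitary_inner hunit, B.ket_orthogonal i hne]
    rw [he, he, ← hjl] at h0
    simp at h0
  have hbij : Function.Bijective e := by
    rw [Fintype.bijective_iff_injective_and_card]
    exact ⟨hinj, by simp⟩
  exact ⟨Equiv.ofBijective e hbij, fun j => ⟨θ j, he j⟩⟩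

theorem exists_inverse_circuit (c : List (Gate n)) : ∃ c' : List (Gate n),
    c'.length ≤ 3 * c.length ∧ circuitMatrix c' * circuitMatrix c = 1 := by
  induction c with
  | nil => exact ⟨[], by simp, by simp [circuitMatrix]⟩
  | cons γ γs ih =>
    obtain ⟨c', hlen, hc'⟩ := ih
    have one : ∃ d : List (Gate n), d.length ≤ 3 ∧ circuitMatrix d * γ.matrix = 1 := by
      cases γ with
      | hadamard k =>
        refine ⟨[.hadamard k], by simp, ?_⟩
        simp only [circuitMatrix, one_mul]
        rw [Gate.matrix, onQubit_mul, hadamard_sq, onQubit_one]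
      | phase k =>
        refine ⟨[.phase k, .phase k, .phase k], by simp, ?_⟩
        simp only [circuitMatrix, one_mul, Gate.matrix, onQubit_mul]
        rw [← onQubit_one k]
        congr 1
        ext i j
        fin_cases i <;> fin_cases j <;> simp
      | cnot p q h =>
        refine ⟨[.cnot p q h], by simp, ?_⟩
        simp only [circuitMatrix, one_mul]
        rw [cnot_sq]
    obtain ⟨d, hd, hdm⟩ := one
    refine ⟨c' ++ d, ?_, ?_⟩
    · rw [List.length_append, List.length_cons]
      omega
    · rw [circuitMatrix_append, circuitMatrix]
      calc circuitMatrix d * circuitMatrix c' * (circuitMatrix γs * γ.matrix) =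
          circuitMatrix d * (circuitMatrix c' * circuitMatrix γs) * γ.matrix := by
            simp only [mul_assoc]
        _ = 1 := by rw [hc', mul_one, hdm]

theorem onQubit_not_mulVec (k : Fin n) (x : Bits n) :
    onQubit !![0, 1; 1, 0] k *ᵥ Pi.single x 1 =
      Pi.single (Function.update x k (x k + 1)) (1 : ℂ) := by
  funext y
  rw [Matrix.mulVec_single_one, Matrix.col_apply, onQubit, tensor, Matrix.of_apply]
  have h1 : ∀ u v : Fin 2, (!![0, 1; 1, 0] : Matrix (Fin 2) (Fin 2) ℂ) u v =
      if u = v + 1 then 1 else 0 := by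
    simp [Fin.forall_fin_two]
  by_cases hy : y = Function.update x k (x k + 1)
  · rw [hy, Pi.single_eq_same]
    refine Finset.prod_eq_one fun j _ => ?_
    by_cases hj : j = k
    · subst hj
      simp [h1]
    · simp [hj]
  · rw [Pi.single_eq_of_ne hy]
    obtain ⟨j, hj⟩ := Function.ne_iff.1 hy
    refine Finset.prod_eq_zero (Finset.mem_univ j) ?_
    by_cases hjk : j = k
    · subst hjk
      simp only [Function.update_self] at hj ⊢
      rw [h1, if_neg hj]
    · simp only [Function.update_of_ne hjk] at hj ⊢
      simp [hj]

/-- The circuit `H S S H` is the Pauli matrix `X`. -/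
theorem circuitMatrix_not (k : Fin n) :
    circuitMatrix [.hadamard k, .phase k, .phase k, .hadamard k] = onQubit !![0, 1; 1, 0] k := by
  simp only [circuitMatrix, one_mul, Gate.matrix, onQubit_mul]
  congr 1
  simp only [Matrix.smul_mul, Matrix.mul_smul, smul_smul, inv_sqrt_two_mul_self]
  ext i j
  fin_cases i <;> fin_cases j <;> norm_num [Matrix.mul_apply, Fin.sum_univ_two]

theorem exists_circuit_single (x : Bits n) : ∃ c : List (Gate n), c.length ≤ 4 * n ∧
    circuitMatrix c *ᵥ Pi.single 0 1 = Pi.single x 1 := by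
  have key : ∀ E : Finset (Fin n), ∃ c : List (Gate n), c.length ≤ 4 * E.card ∧
      circuitMatrix c *ᵥ Pi.single 0 1 = Pi.single (fun k => if k ∈ E then x k else 0) 1 := by
    intro E
    induction E using Finset.induction_on with
    | empty => exact ⟨[], by simp, by
        simp only [circuitMatrix, Matrix.one_mulVec, Finset.notMem_empty, if_false]
        rfl⟩
    | insert k E hk ih =>
      obtain ⟨c, hlen, hc⟩ := ih
      by_cases hxk : x k = 0
      · refine ⟨c, hlen.trans (Nat.mul_le_mul_left _ (Finset.card_le_card
          (Finset.subset_insert _ _))), ?_⟩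
        rw [hc]
        congr 1
        funext j
        by_cases hj : j = k
        · subst hj
          simp [hxk]
        · simp [hj]
      · refine ⟨c ++ [.hadamard k, .phase k, .phase k, .hadamard k], ?_, ?_⟩
        · rw [List.length_append, Finset.card_insert_of_notMem hk]
          simp only [List.length_cons, List.length_nil]
          omega
        · rw [circuitMatrix_append, ← Matrix.mulVec_mulVec, hc, circuitMatrix_not,
            onQubit_not_mulVec]
          congr 1
          funext j
          by_cases hj : j = k
          · subst hj
            simp only [Function.update_self, hk, if_false, Finset.mem_insert_self, if_true]
            omega
          · simp [hj]
  obtain ⟨c, hlen, hc⟩ := key Finset.univ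
  exact ⟨c, by simpa using hlen, by simpa using hc⟩

theorem exists_prepares (B : StabilizerMUB n) (i : Fin (2 ^ n + 1)) (j : Fin (2 ^ n)) :
    ∃ c : List (Gate n), c.length ≤ 9 * n ^ 2 + 4 * n ∧ Prepares c (B.ket i j) := by
  obtain ⟨c, hlen, e, he⟩ := exists_implementsMeasurement B i
  obtain ⟨θ, hθ⟩ := he j
  obtain ⟨c', hlen', hc'⟩ := exists_inverse_circuit c
  obtain ⟨cx, hlenx, hcx⟩ := exists_circuit_single (e j)
  refine ⟨cx ++ c', ?_, -θ, ?_⟩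
  · rw [List.length_append]
    omega
  · have h1 : circuitMatrix c' *ᵥ (circuitMatrix c *ᵥ B.ket i j) = B.ket i j := by
      rw [Matrix.mulVec_mulVec, hc', Matrix.one_mulVec]
    rw [hθ, Matrix.mulVec_smul] at h1
    rw [circuitMatrix_append, ← Matrix.mulVec_mulVec, hcx, ← h1, smul_smul, ← Complex.exp_add]
    simp

end Circuits

/-! ### The stabilizer basis of a maximal commuting group -/

section Basis

variable {n : ℕ}

theorem Gate.act_act (γ : Gate n) (g : PauliString n) : γ.act (γ.act g) = g := by
  have h2 : ∀ a b : ZMod 2, a + b + b = a := by decide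
  funext j
  cases γ with
  | hadamard k =>
    by_cases hj : j = k
    · subst hj
      simp [Gate.act]
    · simp [Gate.act, hj]
  | phase k =>
    by_cases hj : j = k
    · subst hj
      simp [Gate.act, h2]
    · simp [Gate.act, hj]
  | cnot c k h =>
    by_cases hj : j = k
    · subst hj
      simp [Gate.act, h2, h.symm]
    · by_cases hj' : j = c
      · subst hj'
        simp [Gate.act, h2, h.symm]
      · simp [Gate.act, hj, hj']

theorem Gate.act_add (γ : Gate n) (g h : PauliString n) :
    γ.act (g + h) = γ.act g + γ.act h := by
  funext j
  cases γ with
  | hadamard k =>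
    by_cases hj : j = k
    · subst hj
      simp [Gate.act]
    · simp [Gate.act, hj]
  | phase k =>
    by_cases hj : j = k
    · subst hj
      simp [Gate.act, add_add_add_comm]
    · simp [Gate.act, hj]
  | cnot c k hc =>
    by_cases hj : j = k
    · subst hj
      simp [Gate.act, hc.symm, add_add_add_comm]
    · by_cases hj' : j = c
      · subst hj'
        simp [Gate.act, add_add_add_comm]
      · simp [Gate.act, hj, hj']

theorem circuitAct_add (c : List (Gate n)) (g h : PauliString n) :
    circuitAct c (g + h) = circuitAct c g + circuitAct c h := by
  induction c generalizing g h with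
  | nil => rfl
  | cons γ γs ih => rw [circuitAct, γ.act_add, ih]; rfl

theorem circuitAct_injective (c : List (Gate n)) : Function.Injective (circuitAct c) := by
  induction c with
  | nil => exact fun _ _ h => h
  | cons γ γs ih =>
    exact ih.comp (Function.LeftInverse.injective (g := γ.act) γ.act_act)

theorem sigma_zType_mul (a b : ZMod 2 × ZMod 2) (ha : a.1 = 0) (hb : b.1 = 0) :
    sigma a * sigma b = sigma (a + b) := by
  have h2 : (1 : ZMod 2) + 1 = 0 := by decide
  rcases a with ⟨a, a'⟩
  rcases b with ⟨b, b'⟩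
  dsimp only at ha hb
  subst ha hb
  rcases bit_cases a' with rfl | rfl <;> rcases bit_cases b' with rfl | rfl <;>
    simp [sigma, h2]

theorem pauli_zType_mul {g h : PauliString n} (hg : ∀ k, (g k).1 = 0) (hh : ∀ k, (h k).1 = 0) :
    pauli g * pauli h = pauli (g + h) := by
  rw [pauli, pauli, pauli, tensor_mul]
  congr 1
  funext k
  exact sigma_zType_mul _ _ (hg k) (hh k)

/-- The strings of `I` and `Z` sum up to the projector onto the first vector of the computational
basis. -/
theorem sum_pauli_zType : ∑ b : Fin n → ZMod 2, pauli (fun k => ((0, b k) : ZMod 2 × ZMod 2)) =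
    (2 ^ n : ℂ) • Matrix.vecMulVec (Pi.single 0 1) (star (Pi.single 0 1)) := by
  have h1 : ∀ x y : Fin 2, ∑ b : ZMod 2, sigma (0, b) x y = if x = 0 ∧ y = 0 then 2 else 0 := by
    have h2 : ∀ f : ZMod 2 → ℂ, ∑ a, f a = f 0 + f 1 := fun f => Fin.sum_univ_two f
    simp only [h2, Fin.forall_fin_two]
    norm_num [sigma]
  ext x y
  have h3 : (∑ b : Fin n → ZMod 2, pauli (fun k => ((0, b k) : ZMod 2 × ZMod 2))) x y =
      ∏ k, ∑ b : ZMod 2, sigma (0, b) (x k) (y k) := by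
    rw [Matrix.sum_apply, Finset.prod_univ_sum, Fintype.piFinset_univ]
    rfl
  rw [h3]
  simp only [h1, Matrix.smul_apply, Matrix.vecMulVec_apply, Pi.star_apply]
  by_cases hx : x = 0
  · by_cases hy : y = 0
    · simp [hx, hy]
    · obtain ⟨k, hk⟩ := Function.ne_iff.1 hy
      rw [Finset.prod_eq_zero (Finset.mem_univ k) (if_neg fun h => hk h.2)]
      simp [hy]
  · obtain ⟨k, hk⟩ := Function.ne_iff.1 hx
    rw [Finset.prod_eq_zero (Finset.mem_univ k) (if_neg fun h => hk h.1)]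
    simp [hx]

/-- A maximal commuting group has signs and a joint eigenvector: a Clifford circuit turns it into
the group of all strings of `I` and `Z`, and signs and eigenvector are pulled back from there. -/
theorem exists_sign_ket (G : AddSubgroup (PauliString n)) (hcard : Nat.card G = 2 ^ n)
    (hcomm : ∀ g ∈ G, ∀ h ∈ G, commSign g h = 1) :
    ∃ (ζ : PauliString n → ℤˣ) (φ : Bits n → ℂ),
      (∀ g ∈ G, ∀ h ∈ G, signedPauli ζ g * signedPauli ζ h = signedPauli ζ (g + h)) ∧
      star φ ⬝ᵥ φ = 1 ∧ ∀ r, Matrix.vecMulVec (pauli r *ᵥ φ) (star (pauli r *ᵥ φ)) =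
        stabProj G ζ r := by
  classical
  obtain ⟨c, -, hc⟩ := exists_circuit_of_commute_univ (G : Set (PauliString n)) hcomm
  choose ζ hζ using circuitMatrix_conj_pauli c
  set U := circuitMatrix c with hU
  have hUU : Uᴴ * U = 1 := circuitMatrix_unitary c
  have hUU' : U * Uᴴ = 1 := circuitMatrix_unitary' c
  have hS : ∀ g, signedPauli ζ g = Uᴴ * pauli (circuitAct c g) * U := by
    intro g
    have h1 : ((ζ g : ℤ) : ℂ) • (U * pauli g * Uᴴ) = pauli (circuitAct c g) := by
      rw [hζ, smul_smul, ← Int.cast_mul, ← Units.val_mul, Int.units_mul_self]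
      simp
    rw [← h1, Matrix.mul_smul, Matrix.smul_mul, signedPauli]
    congr 1
    calc pauli g = (Uᴴ * U) * pauli g * (Uᴴ * U) := by rw [hUU, one_mul, mul_one]
      _ = Uᴴ * (U * pauli g * Uᴴ) * U := by simp only [mul_assoc]
  have hsum : ∑ p : PauliString n with p ∈ G, signedPauli ζ p =
      (2 ^ n : ℂ) • (Uᴴ * Matrix.vecMulVec (Pi.single 0 1) (star (Pi.single 0 1)) * U) := by
    simp only [hS]
    rw [← Finset.sum_mul, ← Finset.mul_sum, ← Matrix.smul_mul, ← Matrix.mul_smul,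
      ← sum_pauli_zType]
    congr 2
    rw [← Finset.sum_subtype_of_mem (p := fun p => p ∈ G) _ (by simp)]
    let f : G → (Fin n → ZMod 2) := fun p k => (circuitAct c p k).2
    have hf : Function.Bijective f := by
      rw [Fintype.bijective_iff_injective_and_card]
      constructor
      · rintro ⟨p, hp⟩ ⟨q, hq⟩ hpq
        have : circuitAct c p = circuitAct c q := by
          funext k
          exact Prod.ext ((hc p hp k).trans (hc q hq k).symm) (congrFun hpq k)
        exact Subtype.ext (circuitAct_injective c this)
      · rw [← Nat.card_eq_fintype_card, hcard]
        simp
    rw [← hf.sum_comp]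
    refine Finset.sum_congr (by ext; simp) fun p _ => ?_
    congr 1
    funext k
    exact Prod.ext (hc p p.2 k) rfl
  refine ⟨ζ, Uᴴ *ᵥ Pi.single 0 1, ?_, ?_, ?_⟩
  · intro g hg h hh
    rw [hS, hS, hS, circuitAct_add, ← pauli_zType_mul (hc g hg) (hc h hh)]
    calc Uᴴ * pauli (circuitAct c g) * U * (Uᴴ * pauli (circuitAct c h) * U) =
        Uᴴ * pauli (circuitAct c g) * (U * Uᴴ) * (pauli (circuitAct c h) * U) := by
          simp only [mul_assoc]
      _ = _ := by rw [hUU', mul_one]; simp only [mul_assoc]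
  · rw [unitary_inner (by rwa [Matrix.conjTranspose_conjTranspose])]
    simp
  · intro r
    have h0 : Matrix.vecMulVec (Uᴴ *ᵥ Pi.single 0 1) (star (Uᴴ *ᵥ Pi.single 0 1)) =
        (1 / 2 ^ n : ℂ) • ∑ p : PauliString n with p ∈ G, signedPauli ζ p := by
      rw [hsum, smul_smul, one_div_mul_cancel (pow_ne_zero _ two_ne_zero), one_smul,
        Matrix.mul_vecMulVec, Matrix.vecMulVec_mul, Matrix.star_mulVec,
        Matrix.conjTranspose_conjTranspose]
    have h1 : Matrix.vecMulVec (pauli r *ᵥ (Uᴴ *ᵥ Pi.single 0 1))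
        (star (pauli r *ᵥ (Uᴴ *ᵥ Pi.single 0 1))) = pauli r *
          Matrix.vecMulVec (Uᴴ *ᵥ Pi.single 0 1) (star (Uᴴ *ᵥ Pi.single 0 1)) * pauli r := by
      rw [Matrix.star_mulVec (pauli r), pauli_conjTranspose, Matrix.mul_vecMulVec,
        Matrix.vecMulVec_mul]
    rw [h1, h0, stabProj, Matrix.mul_smul, Matrix.smul_mul, Finset.mul_sum, Finset.sum_mul]
    congr 1
    refine Finset.sum_congr rfl fun p _ => ?_
    rw [signedPauli, Matrix.mul_smul, Matrix.smul_mul, pauli_mul_comm_sign r p, Matrix.smul_mul,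
      mul_assoc, pauli_sq, mul_one, smul_comm, commSign_comm]

theorem exists_rep (G : AddSubgroup (PauliString n)) (hcard : Nat.card G = 2 ^ n) :
    ∃ rep : Fin (2 ^ n) → PauliString n, Function.Bijective
      fun j => (QuotientAddGroup.mk (rep j) : PauliString n ⧸ G) := by
  have h1 := AddSubgroup.card_eq_card_quotient_mul_card_addSubgroup G
  have h2 : Nat.card (PauliString n) = 2 ^ n * 2 ^ n := by
    simp [Nat.card_eq_fintype_card, ← mul_pow]
  rw [h2, hcard] at h1
  have h3 : Nat.card (PauliString n ⧸ G) = 2 ^ n :=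
    (Nat.eq_of_mul_eq_mul_right (by positivity) h1).symm
  have e : Fin (2 ^ n) ≃ PauliString n ⧸ G := (Finite.equivFinOfCardEq h3).symm
  refine ⟨fun j => (e j).out, ?_⟩
  simp only [QuotientAddGroup.out_eq']
  exact e.bijective

end Basis

/-! ### A partition of the Pauli group into maximal commuting groups -/

section Spread

/-- There are `2 ^ n` symmetric matrices over the field of two elements whose differences are
invertible: the bilinear forms `(x, y) ↦ Tr(a x y)` on the field of `2 ^ n` elements. -/
theorem exists_symmetric_family (n : ℕ) : ∃ M : Fin (2 ^ n) → Matrix (Fin n) (Fin n) (ZMod 2),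
    (∀ a, (M a).IsSymm) ∧ ∀ a b, a ≠ b → ∀ x, M a *ᵥ x = M b *ᵥ x → x = 0 := by
  rcases Nat.eq_zero_or_pos n with rfl | hn
  · exact ⟨fun _ => 0, fun _ => by simp [Matrix.IsSymm], fun _ _ _ _ _ => Subsingleton.elim _ _⟩
  have : Fact (Nat.Prime 2) := ⟨Nat.prime_two⟩
  let F := GaloisField 2 n
  have hcard : Nat.card F = 2 ^ n := GaloisField.card 2 n hn.ne'
  have hrank : Module.finrank (ZMod 2) F = n := GaloisField.finrank 2 hn.ne'
  let b : Module.Basis (Fin n) (ZMod 2) F := Module.finBasisOfFinrankEq (ZMod 2) F hrank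
  have : Finite F := Nat.finite_of_card_ne_zero (by rw [hcard]; positivity)
  let e : Fin (2 ^ n) ≃ F := (Finite.equivFinOfCardEq hcard).symm
  refine ⟨fun a => Matrix.of fun i j => Algebra.trace (ZMod 2) F (e a * b i * b j), ?_, ?_⟩
  · intro a
    ext i j
    simp only [Matrix.transpose_apply, Matrix.of_apply]
    congr 1
    ring
  · intro a a' hne x hx
    set y : F := ∑ j, x j • b j with hy
    have h1 : ∀ (a : Fin (2 ^ n)) i, ((Matrix.of fun i j =>
        Algebra.trace (ZMod 2) F (e a * b i * b j)) *ᵥ x) i =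
        Algebra.trace (ZMod 2) F (e a * y * b i) := by
      intro a i
      rw [hy, Finset.mul_sum, Finset.sum_mul, map_sum, Matrix.mulVec, dotProduct]
      refine Finset.sum_congr rfl fun j _ => ?_
      rw [Matrix.of_apply, mul_comm _ (x j), ← smul_eq_mul, ← map_smul]
      congr 1
      rw [mul_smul_comm, smul_mul_assoc]
      congr 1
      ring
    have h2 : ∀ z, Algebra.trace (ZMod 2) F ((e a - e a') * y * z) = 0 := by
      intro z
      rw [← b.sum_repr z, Finset.mul_sum, map_sum]
      refine Finset.sum_eq_zero fun i _ => ?_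
      rw [mul_smul_comm, map_smul, sub_mul, sub_mul, map_sub, ← h1, ← h1, hx, sub_self, smul_zero]
    have h3 : (e a - e a') * y = 0 :=
      (traceForm_nondegenerate (ZMod 2) F).1 _ fun z => by
        rw [Algebra.traceForm_apply]
        exact h2 z
    have h4 : y = 0 := (mul_eq_zero.1 h3).resolve_left (sub_ne_zero.2 (e.injective.ne hne))
    have h5 := b.linearIndependent
    rw [Fintype.linearIndependent_iff] at h5
    exact funext (h5 x h4)

variable {n : ℕ}

/-- The string with the given `X`-part and `Z`-part. -/
def ofParts (x z : Fin n → ZMod 2) : PauliString n := fun k => (x k, z k)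

theorem commSign_ofParts_iff (x z : Fin n → ZMod 2) (g : PauliString n) :
    commSign (ofParts x z) g = 1 ↔
      x ⬝ᵥ (fun k => (g k).2) + z ⬝ᵥ (fun k => (g k).1) = 0 := by
  have h : ∑ k, letterForm (ofParts x z k) (g k) =
      x ⬝ᵥ (fun k => (g k).2) + z ⬝ᵥ (fun k => (g k).1) := by
    rw [dotProduct, dotProduct, ← Finset.sum_add_distrib]
    rfl
  rw [commSign_eq_one_iff_stringSign, stringSign_eq_sum, h]
  split_ifs with h0
  · exact iff_of_true rfl h0
  · exact iff_of_false (by norm_num) h0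

/-- A group of `2 ^ n` strings that is its own commutant, with `n` generators. -/
structure IsMaximalCommuting (G : AddSubgroup (PauliString n)) : Prop where
  card : Nat.card G = 2 ^ n
  mem_iff : ∀ g, g ∈ G ↔ ∀ h ∈ G, commSign h g = 1
  exists_gen : ∃ gen : Fin n → PauliString n, AddSubgroup.closure (Set.range gen) = G

/-- The image of an injective homomorphism from bit vectors is maximal commuting if it is its own
commutant. -/
theorem isMaximalCommuting_range (f : (Fin n → ZMod 2) →+ PauliString n)
    (hf : Function.Injective f) (h : ∀ g, g ∈ f.range ↔ ∀ x, commSign (f x) g = 1) :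
    IsMaximalCommuting f.range where
  card := by
    rw [← Nat.card_congr (AddMonoidHom.ofInjective hf).toEquiv]
    simp
  mem_iff g := by
    rw [h]
    simp
  exists_gen := by
    refine ⟨fun k => f (Pi.single k 1), ?_⟩
    refine le_antisymm ?_ ?_
    · rw [AddSubgroup.closure_le]
      rintro _ ⟨k, rfl⟩
      exact ⟨_, rfl⟩
    · rintro _ ⟨x, rfl⟩
      rw [← Finset.univ_sum_single x, map_sum]
      refine sum_mem fun k _ => ?_
      rcases bit_cases (x k) with hk | hk <;> rw [hk]
      · simp
      · exact AddSubgroup.subset_closure ⟨k, rfl⟩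

theorem add_eq_zero_bits {x y : Fin n → ZMod 2} : x + y = 0 ↔ x = y := by
  have h2 : ∀ a b : ZMod 2, a + b = 0 ↔ a = b := by decide
  simp only [funext_iff, Pi.add_apply, Pi.zero_apply, h2]

/-- The graph of a matrix, as a set of Pauli strings. -/
def graphHom (M : Matrix (Fin n) (Fin n) (ZMod 2)) : (Fin n → ZMod 2) →+ PauliString n where
  toFun x := ofParts x (M *ᵥ x)
  map_zero' := by simp; rfl
  map_add' x y := by
    rw [Matrix.mulVec_add]
    rfl

/-- The strings of `I` and `Z`. -/
def zHom : (Fin n → ZMod 2) →+ PauliString n where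
  toFun z := ofParts 0 z
  map_zero' := rfl
  map_add' x y := by
    funext k
    simp [ofParts]

theorem mem_range_graphHom (M : Matrix (Fin n) (Fin n) (ZMod 2)) (g : PauliString n) :
    g ∈ (graphHom M).range ↔ (fun k => (g k).2) = M *ᵥ fun k => (g k).1 := by
  constructor
  · rintro ⟨x, rfl⟩
    rfl
  · intro h
    refine ⟨fun k => (g k).1, ?_⟩
    funext k
    exact Prod.ext rfl (congrFun h k).symm

theorem mem_range_zHom (g : PauliString n) : g ∈ (zHom (n := n)).range ↔ ∀ k, (g k).1 = 0 := by
  constructor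
  · rintro ⟨x, rfl⟩ k
    rfl
  · intro h
    exact ⟨fun k => (g k).2, funext fun k => Prod.ext (h k).symm rfl⟩

theorem isMaximalCommuting_graph {M : Matrix (Fin n) (Fin n) (ZMod 2)} (hM : M.IsSymm) :
    IsMaximalCommuting (graphHom M).range := by
  refine isMaximalCommuting_range _ (fun x y h => ?_) fun g => ?_
  · funext k
    exact congrArg Prod.fst (congrFun h k)
  · have h1 : ∀ x, commSign (graphHom M x) g = 1 ↔
        ((fun k => (g k).2) + M *ᵥ fun k => (g k).1) ⬝ᵥ x = 0 := by
      intro x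
      change commSign (ofParts x (M *ᵥ x)) g = 1 ↔ _
      rw [commSign_ofParts_iff, add_dotProduct, dotProduct_comm x]
      rw [dotProduct_comm (M *ᵥ x), Matrix.dotProduct_mulVec, ← Matrix.mulVec_transpose, hM]
    rw [mem_range_graphHom]
    simp only [h1]
    rw [← add_eq_zero_bits]
    exact ⟨fun h x => by rw [h, zero_dotProduct], fun h => dotProduct_eq_zero _ h⟩

theorem isMaximalCommuting_z : IsMaximalCommuting (zHom (n := n)).range := by
  refine isMaximalCommuting_range _ (fun x y h => ?_) fun g => ?_
  · funext k
    exact congrArg Prod.snd (congrFun h k)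
  · have h1 : ∀ x, commSign (zHom x) g = 1 ↔ (fun k => (g k).1) ⬝ᵥ x = 0 := by
      intro x
      change commSign (ofParts 0 x) g = 1 ↔ _
      rw [commSign_ofParts_iff, zero_dotProduct, zero_add, dotProduct_comm]
    rw [mem_range_zHom]
    simp only [h1]
    constructor
    · intro h x
      rw [show (fun k => (g k).1) = 0 from funext h, zero_dotProduct]
    · exact fun h => congrFun (dotProduct_eq_zero _ h)

/-- The graphs of the symmetric matrices of a family with invertible differences, together with the
strings of `I` and `Z`, partition the nontrivial Pauli strings. -/
theorem exists_spread (n : ℕ) : ∃ G : Fin (2 ^ n + 1) → AddSubgroup (PauliString n),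
    (∀ i, IsMaximalCommuting (G i)) ∧ (∀ i i', i ≠ i' → G i ⊓ G i' = ⊥) ∧
      ∀ g, ∃ i, g ∈ G i := by
  obtain ⟨M, hsymm, hker⟩ := exists_symmetric_family n
  let G : Fin (2 ^ n + 1) → AddSubgroup (PauliString n) :=
    Fin.lastCases (zHom (n := n)).range fun a => (graphHom (M a)).range
  have hlast : G (Fin.last _) = (zHom (n := n)).range := Fin.lastCases_last ..
  have hcast : ∀ a, G (Fin.castSucc a) = (graphHom (M a)).range := fun a =>
    Fin.lastCases_castSucc ..
  have hzero : ∀ a g, g ∈ (graphHom (M a)).range → (fun k => (g k).1) = 0 → g = 0 := by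
    intro a g hg h
    rw [mem_range_graphHom, h, Matrix.mulVec_zero] at hg
    funext k
    exact Prod.ext (congrFun h k) (congrFun hg k)
  refine ⟨G, ?_, ?_, ?_⟩
  · intro i
    induction i using Fin.lastCases with
    | last => rw [hlast]; exact isMaximalCommuting_z
    | cast a => rw [hcast]; exact isMaximalCommuting_graph (hsymm a)
  · intro i i' hne
    rw [eq_bot_iff]
    intro g hg
    obtain ⟨h1, h2⟩ := AddSubgroup.mem_inf.1 hg
    rw [AddSubgroup.mem_bot]
    induction i using Fin.lastCases with
    | last =>
      induction i' using Fin.lastCases with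
      | last => exact absurd rfl hne
      | cast a' =>
        rw [hlast, mem_range_zHom] at h1
        rw [hcast] at h2
        exact hzero a' g h2 (funext h1)
    | cast a =>
      induction i' using Fin.lastCases with
      | last =>
        rw [hcast] at h1
        rw [hlast, mem_range_zHom] at h2
        exact hzero a g h1 (funext h2)
      | cast a' =>
        rw [hcast] at h1 h2
        refine hzero a g h1 (hker a a' (fun h => hne (by rw [h])) _ ?_)
        rw [← (mem_range_graphHom _ _).1 h1, ← (mem_range_graphHom _ _).1 h2]
  · intro g
    by_cases hg : (fun k => (g k).1) = 0
    · refine ⟨Fin.last _, ?_⟩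
      rw [hlast, mem_range_zHom]
      exact congrFun hg
    · -- `a ↦ M a x` is injective for `x ≠ 0`, hence surjective
      have hbij : Function.Bijective fun a => M a *ᵥ fun k => (g k).1 := by
        rw [Fintype.bijective_iff_injective_and_card]
        refine ⟨fun a a' h => ?_, by simp⟩
        by_contra hne
        exact hg (hker a a' hne _ h)
      obtain ⟨a, ha⟩ := hbij.2 fun k => (g k).2
      refine ⟨Fin.castSucc a, ?_⟩
      rw [hcast, mem_range_graphHom]
      exact ha.symm

theorem nonempty_stabilizerMUB (n : ℕ) : Nonempty (StabilizerMUB n) := by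
  obtain ⟨G, hG, hinter, hcover⟩ := exists_spread n
  have hcomm : ∀ i, ∀ g ∈ G i, ∀ h ∈ G i, commSign g h = 1 := fun i g hg h hh =>
    ((hG i).mem_iff h).1 hh g hg
  choose gen hgen using fun i => (hG i).exists_gen
  choose ζ φ hmul hunit hproj using fun i => exists_sign_ket (G i) (hG i).card (hcomm i)
  choose rep hrep using fun i => exists_rep (G i) (hG i).card
  exact ⟨{
    group := G
    card_group := fun i => (hG i).card
    mem_group_iff := fun i g => by
      rw [(hG i).mem_iff]
      refine forall₂_congr fun h _ => ?_
      rw [commSign_comm, commSign_eq_one_iff]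
    inter_group := hinter
    cover := hcover
    gen := gen
    closure_gen := hgen
    sign := ζ
    sign_mul := hmul
    rep := rep
    rep_bijective := hrep
    ket := fun i j => pauli (rep i j) *ᵥ φ i
    ket_unit := fun i j => by rw [StabilizerMUB.pauli_mulVec_inner, hunit]
    ket_proj := fun i j => hproj i (rep i j) }⟩

end Spread

end HamiltonianTesting

theorem mainTheorem1 :
    (∀ n : ℕ, Nonempty (StabilizerMUB n)) ∧
    ∃ (prog : Program) (C : ℝ), 0 < C ∧
      ∀ (n : ℕ) (B : StabilizerMUB n) (S : Finset (PauliString n)) (ε : ℝ),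
        0 < ε → ε < 1 →
        ((insert 0 S).card : ℝ) ≤ (2 ^ n + 1) * ε ^ 4 / 144 →
        ∀ H : Hamiltonian n, (H : QMat n).trace = 0 → opNorm (H : QMat n) ≤ 1 →
          -- correctness
          (HasProperty S H → 2 / 3 ≤ verdictProb B S ε H Verdict.null) ∧
          (IsFar S ε H → 2 / 3 ≤ verdictProb B S ε H Verdict.alt) ∧
          -- complexity of every run
          (∀ o ∈ (tester B S ε H).support,
            (o.rounds.length : ℝ) ≤ C / ε ^ 4 ∧
            (o.rounds.length : ℝ) * evolTime ε ≤ C / ε ^ 3 ∧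
            ∀ L : List (PauliString n), L.Nodup → (∀ p, p ∈ L ↔ p ∈ S) →
              ∃ T : ℕ, ClassicalRun prog B S L o.rounds T ∧
                (T : ℝ) ≤ C * (n : ℝ) ^ 2 * ((insert 0 S).card : ℝ) / ε ^ 4) ∧
          -- states and measurements are efficiently implementable
          (∀ i, ∃ c : List (Gate n), (c.length : ℝ) ≤ C * (n : ℝ) ^ 2 ∧
            ImplementsMeasurement c (B.ket i)) ∧
          (∀ i j, ∃ c : List (Gate n), (c.length : ℝ) ≤ C * (n : ℝ) ^ 2 ∧
            Prepares c (B.ket i j)) := by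
  -- `116000 = 145 * 800`: at most `145 / ε ^ 4` rounds, and `800 n ^ 2 |S ∪ {I}|` steps for each
  refine ⟨nonempty_stabilizerMUB, Checker.program, 116000, by norm_num, ?_⟩
  intro n B S ε hε hε1 hcard H htr hH
  have hn : 1 ≤ n := one_le_of_card_le hε hε1 hcard
  have hn' : (1 : ℝ) ≤ n := by exact_mod_cast hn
  refine ⟨two_thirds_le_null B S hε hε1 H hH, two_thirds_le_alt B S hε hε1 hcard H htr hH, ?_,
    ?_, ?_⟩
  · intro o ho
    have hlen : (o.rounds.length : ℝ) ≤ 145 / ε ^ 4 := by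
      refine le_trans ?_ (numRounds_le hε hε1)
      exact_mod_cast length_rounds_le B S H _ _ o ho
    refine ⟨hlen.trans (div_le_div_of_nonneg_right (by norm_num) (by positivity)), ?_, ?_⟩
    · refine (mul_le_mul_of_nonneg_right hlen (by rw [evolTime]; positivity)).trans ?_
      rw [evolTime, show 145 / ε ^ 4 * (ε / 6) = (145 / 6) / ε ^ 3 by field_simp]
      exact div_le_div_of_nonneg_right (by norm_num) (by positivity)
    · intro L hnd hL
      obtain ⟨T, hrun, hT⟩ := exists_classicalRun B hn S L hnd hL o.rounds
      refine ⟨T, hrun, ?_⟩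
      have hT' : (T : ℝ) ≤ o.rounds.length * (800 * n ^ 2 * (insert 0 S).card) := by
        exact_mod_cast hT
      refine hT'.trans ((mul_le_mul_of_nonneg_right hlen (by positivity)).trans_eq ?_)
      ring
  · intro i
    obtain ⟨c, hc, h⟩ := exists_implementsMeasurement B i
    refine ⟨c, ?_, h⟩
    have hc' : (c.length : ℝ) ≤ 3 * n ^ 2 := by exact_mod_cast hc
    nlinarith
  · intro i j
    obtain ⟨c, hc, h⟩ := exists_prepares B i j
    refine ⟨c, ?_, h⟩
    have hc' : (c.length : ℝ) ≤ 9 * n ^ 2 + 4 * n := by exact_mod_cast hc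
    nlinarith
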